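/- **Setting.** Two independent discrete memoryless broadcast channels with finite alphabets are given: a forward channel $X_f\to(Y_f,Z_f)$ with law $P_{Y_fZ_f|X_f}$ (Alice sends $X_f$, Bob receives $Y_f$, Eve receives $Z_f$) and a backward channel $X_b\to(Y_b,Z_b)$ with law $P_{Y_bZ_b|X_b}$ (Bob sends $X_b$, Alice receives $Y_b$, Eve receives $Z_b$). A broadcast channel $X\to(Y,Z)$ is *stochastically degraded in favor of $Y$* if there are $\tilde Y,\tilde Z$ such that $X\leftrightarrow\tilde Y\leftrightarrow\tilde Z$ is a Markov chain, $P_{\tilde Y|X}=P_{Y|X}$ and $P_{\tilde Z|X}=P_{Z|X}$ (in favor of $Z$: exchange the roles of the two outputs); it *consists of independent channels* if $P_{YZ|X}=P_{Y|X}P_{Z|X}$. The pair is an *sd-2DMBC* if each of the two broadcast channels is stochastically degraded (in favor of $Y$ or in favor of $Z$) and consists of independent channels. A *protocol* has finitely many rounds; in each round Alice or Bob sends a sequence of prescribed length over her or his channel, computed from her or his own local randomness (the two parties' local randomness being independent of each other and of the channels) and the sequences that she or he sent and received in the previous rounds. At the end Alice's (Bob's) view consists of all sequences she (he) sent and received,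 and Eve's view $\mathrm{View}_E$ of all sequences she received. One of Alice and Bob computes a key $S$ as a function of her or his view, and the other one computes an estimate $\hat S$ as a function of her or his view. If the forward and backward channels are used $n_f$ and $n_b$ times, the protocol is $(R,\delta)$-*secure* if $$\frac{H(S)}{n_f+n_b}>R-\delta,\qquad \Pr(\hat S\ne S)<\delta,\qquad \frac{H(S|\mathrm{View}_E)}{H(S)}>1-\delta .$$ The *secret-key capacity* $C^{sd\text{-}2DMBC}_{sk}$ is the largest (supremum) $R\ge0$ such that for every $\delta>0$ there is an $(R,\delta)$-secure protocol; it is $0$ if there is no such $R$. Entropies and mutual informations are in bits, and $[x]_+=\max\{x,0\}$. **Proposition.** For every sd-2DMBC, $$C^{sd\text{-}2DMBC}_{sk}\ \ge\ \max\{L'_A,L'_B\},$$ where $$L'_A=\sup\left\{\frac{n_f I(V_f;X_f|Z_f)+n_b[I(X_b;Y_b)-I(X_b;Z_b)]_+}{n_f+n_b}\ :\ n_f I(V_f;Y_f|X_f)<n_b I(X_b;Y_b)\right\},$$ $$L'_B=\sup\left\{\frac{n_b I(V_b;X_b|Z_b)+n_f[I(X_f;Y_f)-I(X_f;Z_f)]_+}{n_f+n_b}\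 :\ n_b I(V_b;Y_b|X_b)<n_f I(X_f;Y_f)\right\}.$$ In $L'_A$ the supremum is over nonnegative integers $n_f,n_b$, all distributions of $X_f$ and of $X_b$ (with $(Y_f,Z_f)$ and $(Y_b,Z_b)$ the corresponding channel outputs) and all discrete random variables $V_f$ (with values in an arbitrary set) such that $V_f\leftrightarrow Y_f\leftrightarrow(X_f,Z_f)$ is a Markov chain; in $L'_B$ it is over the same data with $f$ and $b$ exchanged, so that $V_b\leftrightarrow Y_b\leftrightarrow(X_b,Z_b)$. A supremum over the empty set is $0$. -/

import Mathlib

open scoped ENNReal NNReal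

universe u

noncomputable section

namespace SKE

/-! ### Shannon information measures of finite random variables, in bits

A random variable is a function on the sample space `Ω` of a probability mass function `p`. -/

/-- Shannon entropy (in bits) of a probability mass function on a finite set. -/
def entropy {α : Type*} [Fintype α] (p : PMF α) : ℝ :=
  ∑ a, -((p a).toReal * Real.logb 2 (p a).toReal)

/-- `H(A)` -/
def H {Ω α : Type*} [Fintype α] (p : PMF Ω) (A : Ω → α) : ℝ :=
  entropy (p.map A)

/-- `H(A | B) = -∑ P(a, b) log P(a | b)`; `A` is finite and `B` is an arbitrary discrete random
variable (for `P(B = b) = 0` the summand is `0`). -/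
def condH {Ω α β : Type*} [Fintype α] (p : PMF Ω) (A : Ω → α) (B : Ω → β) : ℝ :=
  ∑' b, ∑ a, -((p.map fun ω => (A ω, B ω)) (a, b)).toReal *
    Real.logb 2 (((p.map fun ω => (A ω, B ω)) (a, b)).toReal / ((p.map B) b).toReal)

/-- `I(A ; B) = H(A) - H(A | B)` -/
def mutualInfo {Ω α β : Type*} [Fintype α] (p : PMF Ω) (A : Ω → α) (B : Ω → β) : ℝ :=
  H p A - condH p A B

/-- `I(A ; B | C) = H(A | C) - H(A | B, C)`, where `A` is finite and `B`, `C` are arbitrary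
discrete random variables. -/
def condMutualInfo {Ω α β γ : Type*} [Fintype α] (p : PMF Ω)
    (A : Ω → α) (B : Ω → β) (C : Ω → γ) : ℝ :=
  condH p A C - condH p A (fun ω => (B ω, C ω))

/-! ### Discrete memoryless broadcast channels -/

/-- A discrete memoryless broadcast channel `X → (Y, Z)`, given by the conditional distribution
`P_{YZ|X}`; `Y` goes to the legitimate receiver and `Z` to Eve. -/
abbrev DMBC (X Y Z : Type u) : Type u := X → PMF (Y × Z)

namespace DMBC

variable {X Y Z : Type u}

/-- `P_{Y|X}` -/
def toY (W : DMBC X Y Z) (x : X) : PMF Y := (W x).map Prod.fst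

/-- `P_{Z|X}` -/
def toZ (W : DMBC X Y Z) (x : X) : PMF Z := (W x).map Prod.snd

/-- The same broadcast channel with the two outputs exchanged. -/
def swap (W : DMBC X Y Z) : DMBC X Z Y := fun x => (W x).map Prod.swap

/-- `X ↔ Y ↔ Z` is a Markov chain for every input distribution:
`P_{YZ|X}(y, z | x) = P_{Y|X}(y | x) D(z | y)` for some channel `D`. -/
def IsMarkov (W : DMBC X Y Z) : Prop :=
  ∃ D : Y → PMF Z, ∀ x y z, W x (y, z) = W.toY x y * D y z

/-- Stochastically degraded in favor of `Y`: there are `Ỹ, Z̃` with `X ↔ Ỹ ↔ Z̃` Markov,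
`P_{Ỹ|X} = P_{Y|X}` and `P_{Z̃|X} = P_{Z|X}`. -/
def IsStochDegradedY (W : DMBC X Y Z) : Prop :=
  ∃ Q : DMBC X Y Z, Q.IsMarkov ∧ (∀ x, Q.toY x = W.toY x) ∧ (∀ x, Q.toZ x = W.toZ x)

/-- Stochastically degraded in favor of `Z`. -/
def IsStochDegradedZ (W : DMBC X Y Z) : Prop := W.swap.IsStochDegradedY

/-- Independent channels: `P_{YZ|X} = P_{Y|X} P_{Z|X}`. -/
def HasIndependentChannels (W : DMBC X Y Z) : Prop :=
  ∀ x y z, W x (y, z) = W.toY x y * W.toZ x z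

/-- Stochastically degraded (in favor of `Y` or of `Z`) with independent channels. -/
def IsSD (W : DMBC X Y Z) : Prop :=
  (W.IsStochDegradedY ∨ W.IsStochDegradedZ) ∧ W.HasIndependentChannels

/-- Output of `n` uses of the memoryless channel on the input sequence `x`:
`P(o | x) = ∏ i, W(o_i | x_i)`. -/
def block [Fintype Y] [Fintype Z] (W : DMBC X Y Z) {n : ℕ} (x : Fin n → X) :
    PMF (Fin n → Y × Z) :=
  PMF.ofFintype (fun o => ∏ i, W (x i) (o i)) (by
    classical
    have h : ∀ i, ∑ o : Y × Z, W (x i) o = 1 := fun i => by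
      rw [← tsum_fintype (L := .unconditional _)]; exact (W (x i)).tsum_coe
    rw [← Fintype.prod_sum (fun i o => W (x i) o)]
    simp [h])

end DMBC

/-! ### Protocols over a pair of independent broadcast channels

The forward channel `Xf → (Yf, Zf)` goes from Alice to Bob and Eve, the backward channel
`Xb → (Yb, Zb)` from Bob to Alice and Eve. -/

/-- The two legitimate parties. -/
inductive Party where
  | alice
  | bob

/-- A communication round: who sends, and the length of the sequence sent. -/
structure Round where
  sender : Party
  len : ℕ

/-- The sequences seen by somebody who sees symbols of `A` in the rounds in which Alice sends and
symbols of `B` in the rounds in which Bob sends. The head of the list is the latest round. -/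
def View (A B : Type u) : List Round → Type u
  | [] => PUnit
  | ⟨.alice, n⟩ :: rs => View A B rs × (Fin n → A)
  | ⟨.bob, n⟩ :: rs => View A B rs × (Fin n → B)

/-- Views over finite alphabets form a finite type. -/
@[reducible] def View.fintype (A B : Type u) [Fintype A] [Fintype B] : (rs : List Round) → Fintype (View A B rs)
  | [] => inferInstanceAs (Fintype PUnit)
  | ⟨.alice, n⟩ :: rs =>
      letI := View.fintype A B rs
      inferInstanceAs (Fintype (View A B rs × (Fin n → A)))
  | ⟨.bob, n⟩ :: rs =>
      letI := View.fintype A B rs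
      inferInstanceAs (Fintype (View A B rs × (Fin n → B)))

instance (A B : Type u) [Fintype A] [Fintype B] (rs : List Round) : Fintype (View A B rs) :=
  View.fintype A B rs

/-- Number of uses of the forward channel. -/
def forwardUses : List Round → ℕ
  | [] => 0
  | ⟨.alice, n⟩ :: rs => forwardUses rs + n
  | ⟨.bob, _⟩ :: rs => forwardUses rs

/-- Number of uses of the backward channel. -/
def backwardUses : List Round → ℕ
  | [] => 0
  | ⟨.alice, _⟩ :: rs => backwardUses rs
  | ⟨.bob, n⟩ :: rs => backwardUses rs + n

/-- The communication part of a protocol: in each round the sender computes the sequence to be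
sent from the sender's local randomness (`RA` for Alice, `RB` for Bob) and all sequences the
sender has sent and received in the previous rounds. -/
inductive Communication (Xf Yf Xb Yb : Type u) (RA RB : Type) : List Round → Type u
  | start : Communication Xf Yf Xb Yb RA RB []
  | alice {rs : List Round} (c : Communication Xf Yf Xb Yb RA RB rs) (n : ℕ)
      (enc : RA → View Xf Yb rs → (Fin n → Xf)) :
      Communication Xf Yf Xb Yb RA RB (⟨.alice, n⟩ :: rs)
  | bob {rs : List Round} (c : Communication Xf Yf Xb Yb RA RB rs) (n : ℕ)
      (enc : RB → View Yf Xb rs → (Fin n → Xb)) :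
      Communication Xf Yf Xb Yb RA RB (⟨.bob, n⟩ :: rs)

section

variable {Xf Yf Zf Xb Yb Zb : Type u} [Fintype Yf] [Fintype Zf] [Fintype Yb] [Fintype Zb]

/-- Joint law of Alice's and Bob's (independent) local randomness and of the views of Alice, Bob
and Eve after the given rounds of communication. -/
def Communication.law (Wf : DMBC Xf Yf Zf) (Wb : DMBC Xb Yb Zb) {RA RB : Type}
    (pA : PMF RA) (pB : PMF RB) : {rs : List Round} → Communication Xf Yf Xb Yb RA RB rs →
      PMF (RA × RB × View Xf Yb rs × View Yf Xb rs × View Zf Zb rs)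
  | _, .start => pA.bind fun a => pB.map fun b => (a, b, PUnit.unit, PUnit.unit, PUnit.unit)
  | _, .alice c n enc =>
      (Communication.law Wf Wb pA pB c).bind fun (a, b, vA, vB, vE) =>
        (Wf.block (enc a vA)).map fun o =>
          (a, b, (vA, enc a vA), (vB, fun i => (o i).1), (vE, fun i => (o i).2))
  | _, .bob c n enc =>
      (Communication.law Wf Wb pA pB c).bind fun (a, b, vA, vB, vE) =>
        (Wb.block (enc b vB)).map fun o =>
          (a, b, (vA, fun i => (o i).1), (vB, enc b vB), (vE, fun i => (o i).2))

end

/-- A secret-key establishment protocol: local randomness of the two parties, communication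
rounds, and finally the two parties' functions of their own views (the sequences they sent and
received) into the key set `Fin keyCard`; `owner` is the party whose value is the key `S`, and the
other party's value is the estimate `Ŝ`. -/
structure Protocol (Xf Yf Xb Yb : Type u) where
  RA : Type
  RB : Type
  pA : PMF RA
  pB : PMF RB
  rounds : List Round
  comm : Communication Xf Yf Xb Yb RA RB rounds
  keyCard : ℕ
  keyA : View Xf Yb rounds → Fin keyCard
  keyB : View Yf Xb rounds → Fin keyCard
  owner : Party

namespace Protocol

variable {Xf Yf Zf Xb Yb Zb : Type u} [Fintype Yf] [Fintype Zf] [Fintype Yb] [Fintype Zb]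

/-- The key `S`, as a function of Alice's and Bob's views. -/
def key (P : Protocol Xf Yf Xb Yb) (vA : View Xf Yb P.rounds) (vB : View Yf Xb P.rounds) :
    Fin P.keyCard :=
  match P.owner with
  | .alice => P.keyA vA
  | .bob => P.keyB vB

/-- The estimate `Ŝ`, as a function of Alice's and Bob's views. -/
def keyEst (P : Protocol Xf Yf Xb Yb) (vA : View Xf Yb P.rounds) (vB : View Yf Xb P.rounds) :
    Fin P.keyCard :=
  match P.owner with
  | .alice => P.keyB vB
  | .bob => P.keyA vA

/-- Joint law of `(S, Ŝ, View_E)`. -/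
def outcome (P : Protocol Xf Yf Xb Yb) (Wf : DMBC Xf Yf Zf) (Wb : DMBC Xb Yb Zb) :
    PMF (Fin P.keyCard × Fin P.keyCard × View Zf Zb P.rounds) :=
  (P.comm.law Wf Wb P.pA P.pB).map fun (_, _, vA, vB, vE) =>
    (P.key vA vB, P.keyEst vA vB, vE)

/-- The protocol is `(R, δ)`-secure: `H(S) / (n_f + n_b) > R - δ`, `Pr(Ŝ ≠ S) < δ` and
`H(S | View_E) / H(S) > 1 - δ`. -/
def IsSecure (P : Protocol Xf Yf Xb Yb) (Wf : DMBC Xf Yf Zf) (Wb : DMBC Xb Yb Zb)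
    (R δ : ℝ) : Prop :=
  let μ := P.outcome Wf Wb
  let S : Fin P.keyCard × Fin P.keyCard × View Zf Zb P.rounds → Fin P.keyCard := fun ω => ω.1
  let S' : Fin P.keyCard × Fin P.keyCard × View Zf Zb P.rounds → Fin P.keyCard := fun ω => ω.2.1
  let viewE : Fin P.keyCard × Fin P.keyCard × View Zf Zb P.rounds → View Zf Zb P.rounds :=
    fun ω => ω.2.2
  H μ S / ((forwardUses P.rounds : ℝ) + (backwardUses P.rounds : ℝ)) > R - δ ∧
    (μ.toOuterMeasure {ω | S' ω ≠ S ω}).toReal < δ ∧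
    condH μ S viewE / H μ S > 1 - δ

end Protocol

section

variable {Xf Yf Zf Xb Yb Zb : Type u} [Fintype Yf] [Fintype Zf] [Fintype Yb] [Fintype Zb]

/-- The rate `R` is achievable: for every `δ > 0` there is an `(R, δ)`-secure protocol. -/
def IsAchievable (Wf : DMBC Xf Yf Zf) (Wb : DMBC Xb Yb Zb) (R : ℝ) : Prop :=
  ∀ δ : ℝ, 0 < δ → ∃ P : Protocol Xf Yf Xb Yb, P.IsSecure Wf Wb R δ

/-- The secret-key capacity of the pair of channels, in bits per channel use: the largest
achievable rate `R ≥ 0`. It is `0` if no rate is achievable. -/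
def capacity (Wf : DMBC Xf Yf Zf) (Wb : DMBC Xb Yb Zb) : ℝ≥0∞ :=
  ⨆ (R : ℝ≥0) (_ : IsAchievable Wf Wb (R : ℝ)), (R : ℝ≥0∞)

end

/-! ### The lower bound -/

section

variable {X Y Z : Type u}

/-- Law of `(X, Y, Z)` for an input distribution `pX`. -/
def ioLaw (W : DMBC X Y Z) (pX : PMF X) : PMF (X × Y × Z) :=
  pX.bind fun x => (W x).map fun (y, z) => (x, y, z)

/-- Law of `(V, X, Y, Z)` with `V ↔ Y ↔ (X, Z)` a Markov chain, where `P_{V|Y}` is `τ` and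
`V` is a discrete random variable with values in an arbitrary set. -/
def auxLaw {V : Type} (W : DMBC X Y Z) (pX : PMF X) (τ : Y → PMF V) :
    PMF (V × X × Y × Z) :=
  (ioLaw W pX).bind fun (x, y, z) => (τ y).map fun v => (v, x, y, z)

/-- `I(X ; Y)` -/
def infoXY [Fintype X] (W : DMBC X Y Z) (pX : PMF X) : ℝ :=
  mutualInfo (ioLaw W pX) (fun ω => ω.1) (fun ω => ω.2.1)

/-- `I(X ; Z)` -/
def infoXZ [Fintype X] (W : DMBC X Y Z) (pX : PMF X) : ℝ :=
  mutualInfo (ioLaw W pX) (fun ω => ω.1) (fun ω => ω.2.2)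

/-- `I(V ; X | Z)`, computed as `I(X ; V | Z) = H(X | Z) - H(X | V, Z)` since `V` need not be
finite. -/
def infoVXgivenZ [Fintype X] {V : Type} (W : DMBC X Y Z) (pX : PMF X) (τ : Y → PMF V) : ℝ :=
  condMutualInfo (auxLaw W pX τ) (fun ω => ω.2.1) (fun ω => ω.1) (fun ω => ω.2.2.2)

/-- `I(V ; Y | X)`, computed as `I(Y ; V | X) = H(Y | X) - H(Y | V, X)`. -/
def infoVYgivenX [Fintype Y] {V : Type} (W : DMBC X Y Z) (pX : PMF X) (τ : Y → PMF V) : ℝ :=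
  condMutualInfo (auxLaw W pX τ) (fun ω => ω.2.2.1) (fun ω => ω.1) (fun ω => ω.2.1)

end

/-- With channel `1` used first and channel `2` used in the other direction: the supremum, over
`n₁`, `n₂`, input distributions of the two channels and auxiliary variables `V` with
`V ↔ Y₁ ↔ (X₁, Z₁)` such that `n₁ I(V; Y₁ | X₁) < n₂ I(X₂; Y₂)`, of
`(n₁ I(V; X₁ | Z₁) + n₂ [I(X₂; Y₂) - I(X₂; Z₂)]₊) / (n₁ + n₂)`. -/
def lowerBound {X₁ Y₁ Z₁ X₂ Y₂ Z₂ : Type u} [Fintype X₁] [Fintype Y₁]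
    [Fintype X₂] (W₁ : DMBC X₁ Y₁ Z₁) (W₂ : DMBC X₂ Y₂ Z₂) : ℝ≥0∞ :=
  ⨆ (n₁ : ℕ) (n₂ : ℕ) (V : Type) (p₁ : PMF X₁) (τ : Y₁ → PMF V) (p₂ : PMF X₂)
    (_ : (n₁ : ℝ) * infoVYgivenX W₁ p₁ τ < (n₂ : ℝ) * infoXY W₂ p₂),
    ENNReal.ofReal
      (((n₁ : ℝ) * infoVXgivenZ W₁ p₁ τ + (n₂ : ℝ) * max (infoXY W₂ p₂ - infoXZ W₂ p₂) 0) /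
        ((n₁ : ℝ) + (n₂ : ℝ)))

/-- `L'_A`: Alice initiates over the forward channel. -/
def LA {Xf Yf Zf Xb Yb Zb : Type u} [Fintype Xf] [Fintype Yf] [Fintype Xb]
    (Wf : DMBC Xf Yf Zf) (Wb : DMBC Xb Yb Zb) : ℝ≥0∞ :=
  lowerBound Wf Wb

/-- `L'_B`: Bob initiates over the backward channel. -/
def LB {Xf Yf Zf Xb Yb Zb : Type u} [Fintype Xf] [Fintype Xb] [Fintype Yb]
    (Wf : DMBC Xf Yf Zf) (Wb : DMBC Xb Yb Zb) : ℝ≥0∞ :=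
  lowerBound Wb Wf

end SKE

end

noncomputable section

namespace SKE

open Finset Filter Topology

set_option linter.unusedSectionVars false

/-- The real indicator of a proposition. -/
def ind (p : Prop) : ℝ := @ite ℝ p (Classical.propDecidable p) 1 0

lemma ind_of {p : Prop} (h : p) : ind p = 1 := by simp [ind, h]

lemma ind_not {p : Prop} (h : ¬p) : ind p = 0 := by simp [ind, h]

lemma ind_nonneg (p : Prop) : 0 ≤ ind p := by
  by_cases h : p <;> simp [ind, h]

lemma ind_le_one (p : Prop) : ind p ≤ 1 := by
  by_cases h : p <;> simp [ind, h]

lemma ind_le_ind {p q : Prop} (h : p → q) : ind p ≤ ind q := by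
  by_cases hp : p
  · rw [ind_of hp, ind_of (h hp)]
  · rw [ind_not hp]; exact ind_nonneg q

lemma ind_mul_self (p : Prop) : ind p * ind p = ind p := by
  by_cases h : p <;> simp [ind, h]

lemma ind_and (p q : Prop) : ind (p ∧ q) = ind p * ind q := by
  by_cases h : p <;> by_cases h' : q <;> simp [ind, h, h']

lemma ind_or_le {p q r : Prop} (h : p → q ∨ r) : ind p ≤ ind q + ind r := by
  by_cases hp : p
  · rcases h hp with h | h
    · rw [ind_of hp, ind_of h]; linarith [ind_nonneg r]
    · rw [ind_of hp, ind_of h]; linarith [ind_nonneg q]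
  · rw [ind_not hp]; linarith [ind_nonneg r, ind_nonneg q]

lemma ind_add_ind_not (p : Prop) : ind p + ind (¬p) = 1 := by
  by_cases h : p <;> simp [ind, h]

lemma sum_ind_eq_mul {α : Type*} [Fintype α] (a : α) (f : α → ℝ) :
    ∑ s, ind (a = s) * f s = f a := by
  rw [Finset.sum_eq_single a]
  · simp [ind]
  · intro b _ hb; rw [ind_not (Ne.symm hb), zero_mul]
  · simp

lemma sum_ind_eq {α : Type*} [Fintype α] (a : α) : ∑ s, ind (a = s) = 1 := by
  simpa using sum_ind_eq_mul a (fun _ => (1 : ℝ))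

/-- A weighted average which is at most `b` has a term which is at most `b`. -/
lemma exists_le_of_average_le {ι : Type*} [Fintype ι] {μ f : ι → ℝ} {b : ℝ}
    (hμ : ∀ i, 0 ≤ μ i) (h1 : ∑ i, μ i = 1) (h : ∑ i, μ i * f i ≤ b) : ∃ i, f i ≤ b := by
  by_contra! hc
  obtain ⟨i, -, hi⟩ : ∃ i ∈ Finset.univ, 0 < μ i := by
    by_contra! h0
    have : ∑ i, μ i ≤ 0 := Finset.sum_nonpos h0
    linarith
  have : ∑ i, μ i * b < ∑ i, μ i * f i :=
    Finset.sum_lt_sum (fun j _ => mul_le_mul_of_nonneg_left (hc j).le (hμ j))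
      ⟨i, Finset.mem_univ i, mul_lt_mul_of_pos_left (hc i) hi⟩
  rw [← Finset.sum_mul, h1, one_mul] at this
  linarith

/-! ### Product weights on function spaces -/

section Pi

variable {ι α R : Type*} [Fintype ι] [DecidableEq ι] [Fintype α] [CommSemiring R]

lemma sum_pi_prod (r : ι → α → R) : ∑ g : ι → α, ∏ i, r i (g i) = ∏ i, ∑ a, r i a :=
  (Fintype.prod_sum r).symm

lemma sum_pi_prod_one {q : ι → α → R} (hq : ∀ i, ∑ a, q i a = 1) :
    ∑ g : ι → α, ∏ i, q i (g i) = 1 := by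
  rw [sum_pi_prod]; simp [hq]

lemma sum_pi_apply {q : ι → α → R} (hq : ∀ i, ∑ a, q i a = 1) (j : ι) (h : α → R) :
    ∑ g : ι → α, (∏ i, q i (g i)) * h (g j) = ∑ a, q j a * h a := by
  have key := sum_pi_prod fun i a => q i a * if i = j then h a else 1
  have h1 : ∀ g : ι → α, ∏ i, (q i (g i) * if i = j then h (g i) else 1)
      = (∏ i, q i (g i)) * h (g j) := by
    intro g
    rw [Finset.prod_mul_distrib]
    congr 1
    rw [Finset.prod_ite_eq' Finset.univ j (fun i => h (g i))]
    simp
  simp only [h1] at key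
  rw [key, ← Finset.mul_prod_erase _ _ (Finset.mem_univ j)]
  rw [Finset.prod_eq_one (s := Finset.univ.erase j)]
  · simp
  · intro i hi
    simp [Finset.ne_of_mem_erase hi, hq]

lemma sum_pi_apply₂ {q : ι → α → R} (hq : ∀ i, ∑ a, q i a = 1) {j k : ι} (hjk : j ≠ k)
    (h h' : α → R) :
    ∑ g : ι → α, (∏ i, q i (g i)) * (h (g j) * h' (g k))
      = (∑ a, q j a * h a) * ∑ a, q k a * h' a := by
  have key := sum_pi_prod fun i a =>
    q i a * ((if i = j then h a else 1) * if i = k then h' a else 1)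
  have h1 : ∀ g : ι → α,
      ∏ i, (q i (g i) * ((if i = j then h (g i) else 1) * if i = k then h' (g i) else 1))
      = (∏ i, q i (g i)) * (h (g j) * h' (g k)) := by
    intro g
    rw [Finset.prod_mul_distrib, Finset.prod_mul_distrib]
    congr 2
    · rw [Finset.prod_ite_eq' Finset.univ j (fun i => h (g i))]; simp
    · rw [Finset.prod_ite_eq' Finset.univ k (fun i => h' (g i))]; simp
  simp only [h1] at key
  rw [key, ← Finset.mul_prod_erase _ _ (Finset.mem_univ j),
    ← Finset.mul_prod_erase _ _ (Finset.mem_erase.2 ⟨hjk.symm, Finset.mem_univ k⟩)]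
  rw [Finset.prod_eq_one (s := (Finset.univ.erase j).erase k)]
  · simp [hjk, hjk.symm]
  · intro i hi
    simp only [Finset.mem_erase] at hi
    simp [hi.1, hi.2.1, hq]

end Pi

/-! ### Privacy amplification -/

/-- A weighted family of functions into a set of `N` elements with uniform values that are
pairwise independent at the level of collisions. -/
structure IsHashFamily {I K M : Type*} [Fintype I] (μ : I → ℝ) (h : I → K → M) (c : ℝ) :
    Prop where
  nonneg : ∀ i, 0 ≤ μ i
  sum_one : ∑ i, μ i = 1
  value : ∀ k s, ∑ i, μ i * ind (h i k = s) = c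
  pair : ∀ k k' s, k ≠ k' → ∑ i, μ i * (ind (h i k = s) * ind (h i k' = s)) = c ^ 2

lemma IsHashFamily.centered {I K M : Type*} [Fintype I] [DecidableEq K] {μ : I → ℝ} {h : I → K → M}
    {c : ℝ} (hh : IsHashFamily μ h c) (k k' : K) (s : M) :
    ∑ i, μ i * ((ind (h i k = s) - c) * (ind (h i k' = s) - c))
      = if k = k' then c - c ^ 2 else 0 := by
  have e : ∀ i, μ i * ((ind (h i k = s) - c) * (ind (h i k' = s) - c))
      = μ i * (ind (h i k = s) * ind (h i k' = s)) - c * (μ i * ind (h i k = s))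
        - c * (μ i * ind (h i k' = s)) + c ^ 2 * μ i := fun i => by ring
  simp only [e, Finset.sum_add_distrib, Finset.sum_sub_distrib, ← Finset.mul_sum, hh.value,
    hh.sum_one]
  split_ifs with hk
  · subst hk
    simp only [ind_mul_self, hh.value]; ring
  · rw [hh.pair k k' s hk]; ring

lemma sum_abs_le_sqrt {I : Type*} [Fintype I] {μ : I → ℝ} (hμ : ∀ i, 0 ≤ μ i)
    (h1 : ∑ i, μ i = 1) (D : I → ℝ) : ∑ i, μ i * |D i| ≤ √(∑ i, μ i * D i ^ 2) := by
  apply Real.le_sqrt_of_sq_le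
  have := Finset.sum_sq_le_sum_mul_sum_of_sq_le_mul Finset.univ (r := fun i => μ i * |D i|)
    (f := μ) (g := fun i => μ i * D i ^ 2) (fun i _ => hμ i)
    (fun i _ => mul_nonneg (hμ i) (sq_nonneg _))
    (fun i _ => by rw [mul_pow, sq_abs]; exact le_of_eq (by ring))
  rwa [h1, one_mul] at this

lemma IsHashFamily.sum_abs_le {I K M : Type*} [Fintype I] [Fintype K] {μ : I → ℝ}
    {h : I → K → M} {c : ℝ} (hh : IsHashFamily μ h c) (P : K → ℝ) (s : M) :
    ∑ i, μ i * |∑ k, (ind (h i k = s) - c) * P k| ≤ √((c - c ^ 2) * ∑ k, P k ^ 2) := by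
  classical
  refine (sum_abs_le_sqrt hh.nonneg hh.sum_one _).trans (Real.sqrt_le_sqrt ?_)
  have e : ∀ i, μ i * (∑ k, (ind (h i k = s) - c) * P k) ^ 2
      = ∑ k, ∑ k', P k * P k' *
        (μ i * ((ind (h i k = s) - c) * (ind (h i k' = s) - c))) := by
    intro i
    rw [pow_two, Finset.sum_mul_sum, Finset.mul_sum]
    refine Finset.sum_congr rfl fun k _ => ?_
    rw [Finset.mul_sum]
    exact Finset.sum_congr rfl fun k' _ => by ring
  simp only [e]
  rw [Finset.sum_comm]
  rw [Finset.mul_sum]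
  refine Finset.sum_le_sum fun k _ => ?_
  rw [Finset.sum_comm]
  simp only [← Finset.mul_sum, hh.centered]
  rw [Finset.sum_eq_single k]
  · simp only [if_true]
    exact le_of_eq (by ring)
  · intro b _ hb; simp [Ne.symm hb]
  · simp

/-- Leftover hashing: for a random hash function, the hash value of `k` is close to uniform given
`e`, if the weight `P k e` rarely exceeds `T * Q e`. -/
theorem IsHashFamily.leftover {I K E : Type*} [Fintype I] [Fintype K] [Fintype E] {N : ℕ}
    (hN : 0 < N) {μ : I → ℝ} {h : I → K → Fin N} (hh : IsHashFamily μ h (1 / N))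
    {P : K → E → ℝ} (hP : ∀ k e, 0 ≤ P k e) (hP1 : ∑ k, ∑ e, P k e ≤ 1)
    {Q : E → ℝ} (hQ : ∀ e, 0 ≤ Q e) (hQ1 : ∑ e, Q e ≤ 1) {T : ℝ} (hT : 0 ≤ T) :
    ∑ i, μ i * ∑ s, ∑ e, |∑ k, (ind (h i k = s) - 1 / N) * P k e|
      ≤ 2 * ∑ k, ∑ e, P k e * ind (T * Q e < P k e) + √((N - 1) * T) := by
  have hNR : (0 : ℝ) < N := by exact_mod_cast hN
  have hN1 : (0 : ℝ) ≤ (N : ℝ) - 1 := by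
    have : (1 : ℝ) ≤ N := by exact_mod_cast hN
    linarith
  have hNN : (0 : ℝ) ≤ ((N : ℝ) - 1) / N ^ 2 := by positivity
  set A : K → E → ℝ := fun k e => P k e * ind (¬ T * Q e < P k e) with hA
  set B : K → E → ℝ := fun k e => P k e * ind (T * Q e < P k e) with hB
  have hB0 : ∀ k e, 0 ≤ B k e := fun k e => mul_nonneg (hP k e) (ind_nonneg _)
  have hA0 : ∀ k e, 0 ≤ A k e := fun k e => mul_nonneg (hP k e) (ind_nonneg _)
  have hAP : ∀ k e, A k e ≤ P k e := fun k e =>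
    mul_le_of_le_one_right (hP k e) (ind_le_one _)
  have hPAB : ∀ k e, P k e = A k e + B k e := fun k e => by
    rw [hA, hB]; simp only
    rw [← mul_add, add_comm, ind_add_ind_not, mul_one]
  have hAT : ∀ k e, A k e ≤ T * Q e := fun k e => by
    by_cases hc : T * Q e < P k e
    · simp only [hA]; rw [ind_not (not_not.2 hc), mul_zero]; exact mul_nonneg hT (hQ e)
    · exact (hAP k e).trans (not_lt.1 hc)
  have h1 : ∀ i s e, |∑ k, (ind (h i k = s) - 1 / N) * P k e|
      ≤ |∑ k, (ind (h i k = s) - 1 / N) * A k e|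
        + (∑ k, ind (h i k = s) * B k e + 1 / N * ∑ k, B k e) := by
    intro i s e
    have : ∑ k, (ind (h i k = s) - 1 / N) * P k e
        = ∑ k, (ind (h i k = s) - 1 / N) * A k e
          + (∑ k, ind (h i k = s) * B k e - 1 / N * ∑ k, B k e) := by
      rw [Finset.mul_sum, ← Finset.sum_sub_distrib, ← Finset.sum_add_distrib]
      exact Finset.sum_congr rfl fun k _ => by rw [hPAB k e]; ring
    rw [this]
    refine (abs_add_le _ _).trans (add_le_add_right ?_ _)
    have a1 : 0 ≤ ∑ k, ind (h i k = s) * B k e :=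
      Finset.sum_nonneg fun k _ => mul_nonneg (ind_nonneg _) (hB0 k e)
    have a2 : 0 ≤ 1 / (N : ℝ) * ∑ k, B k e :=
      mul_nonneg (by positivity) (Finset.sum_nonneg fun k _ => hB0 k e)
    rw [abs_le]; constructor <;> linarith
  have h2 : ∀ i, ∑ s, ∑ e, (∑ k, ind (h i k = s) * B k e + 1 / N * ∑ k, B k e)
      = 2 * ∑ k, ∑ e, B k e := by
    intro i
    simp only [Finset.sum_add_distrib]
    have b1 : ∑ s : Fin N, ∑ e, ∑ k, ind (h i k = s) * B k e = ∑ k, ∑ e, B k e := by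
      rw [Finset.sum_comm' (t' := Finset.univ) (s' := fun _ => Finset.univ) (by simp)]
      rw [Finset.sum_comm (s := (Finset.univ : Finset K))]
      refine Finset.sum_congr rfl fun e _ => ?_
      rw [Finset.sum_comm]
      refine Finset.sum_congr rfl fun k _ => ?_
      rw [← Finset.sum_mul, sum_ind_eq, one_mul]
    have b2 : ∑ s : Fin N, ∑ e, 1 / (N : ℝ) * ∑ k, B k e = ∑ k, ∑ e, B k e := by
      rw [Finset.sum_const, Finset.card_univ, Fintype.card_fin, nsmul_eq_mul, ← Finset.mul_sum,
        Finset.sum_comm]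
      field_simp
    rw [b1, b2]; ring
  have h3 : ∀ s e, ∑ i, μ i * |∑ k, (ind (h i k = s) - 1 / N) * A k e|
      ≤ √((N - 1) / N ^ 2 * T) * ((Q e + ∑ k, P k e) / 2) := by
    intro s e
    refine (hh.sum_abs_le (fun k => A k e) s).trans ?_
    have hP' : 0 ≤ ∑ k, P k e := Finset.sum_nonneg fun k _ => hP k e
    have c1 : (1 / (N : ℝ) - (1 / N) ^ 2) * ∑ k, A k e ^ 2
        ≤ (N - 1) / N ^ 2 * T * (Q e * ∑ k, P k e) := by
      have : ∑ k, A k e ^ 2 ≤ T * Q e * ∑ k, P k e := by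
        rw [Finset.mul_sum]
        refine Finset.sum_le_sum fun k _ => ?_
        rw [pow_two]
        exact mul_le_mul (hAT k e) (hAP k e) (hA0 k e) (mul_nonneg hT (hQ e))
      calc (1 / (N : ℝ) - (1 / N) ^ 2) * ∑ k, A k e ^ 2
          = (N - 1) / N ^ 2 * ∑ k, A k e ^ 2 := by congr 1; field_simp
        _ ≤ (N - 1) / N ^ 2 * (T * Q e * ∑ k, P k e) := by gcongr
        _ = _ := by ring
    refine (Real.sqrt_le_sqrt c1).trans ?_
    rw [Real.sqrt_mul (by positivity)]
    gcongr
    rw [Real.sqrt_le_iff]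
    have := hQ e
    constructor
    · positivity
    · nlinarith [sq_nonneg (Q e - ∑ k, P k e)]
  calc ∑ i, μ i * ∑ s, ∑ e, |∑ k, (ind (h i k = s) - 1 / N) * P k e|
      ≤ ∑ i, μ i * (∑ s, ∑ e, |∑ k, (ind (h i k = s) - 1 / N) * A k e|
          + 2 * ∑ k, ∑ e, B k e) := by
        refine Finset.sum_le_sum fun i _ => mul_le_mul_of_nonneg_left ?_ (hh.nonneg i)
        rw [← h2 i, ← Finset.sum_add_distrib]
        refine Finset.sum_le_sum fun s _ => ?_
        rw [← Finset.sum_add_distrib]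
        exact Finset.sum_le_sum fun e _ => h1 i s e
    _ = ∑ s, ∑ e, ∑ i, μ i * |∑ k, (ind (h i k = s) - 1 / N) * A k e|
          + 2 * ∑ k, ∑ e, B k e := by
        simp only [mul_add, Finset.sum_add_distrib, ← Finset.sum_mul, hh.sum_one, one_mul]
        congr 1
        simp only [Finset.mul_sum]
        rw [Finset.sum_comm]
        exact Finset.sum_congr rfl fun s _ => Finset.sum_comm
    _ ≤ ∑ s : Fin N, ∑ e, √((N - 1) / N ^ 2 * T) * ((Q e + ∑ k, P k e) / 2) + 2 * ∑ k, ∑ e, B k e := by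
        gcongr with s _ e _
        exact h3 s e
    _ ≤ _ := by
        rw [add_comm]
        gcongr
        rw [Finset.sum_const, Finset.card_univ, Fintype.card_fin, nsmul_eq_mul,
          ← Finset.mul_sum, ← Finset.sum_div, Finset.sum_add_distrib,
          Finset.sum_comm (s := (Finset.univ : Finset E))]
        have d1 : (N : ℝ) * √((N - 1) / N ^ 2 * T) = √((N - 1) * T) := by
          rw [show ((N : ℝ) - 1) * T = N ^ 2 * ((N - 1) / N ^ 2 * T) by field_simp, Real.sqrt_mul (by positivity : (0 : ℝ) ≤ (N : ℝ) ^ 2),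
            Real.sqrt_sq hNR.le]
        rw [← mul_assoc, d1]
        refine mul_le_of_le_one_right (Real.sqrt_nonneg _) ?_
        linarith

/-- Uniformly random functions, composed with a map all of whose fibres have the same size, form
a hash family. -/
lemma isHashFamily_uniform {K M M' : Type*} [Fintype K] [DecidableEq K] [Fintype M] [Nonempty M]
    (f : M → M') {c : ℝ} (hc : ∀ s, ∑ m, 1 / (Fintype.card M : ℝ) * ind (f m = s) = c) :
    IsHashFamily (fun _ : K → M => ∏ _k : K, (1 / Fintype.card M : ℝ)) (fun g k => f (g k)) c := by
  have hq : ∀ _k : K, ∑ _m : M, (1 / Fintype.card M : ℝ) = 1 := fun _ => by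
    simp
  refine ⟨fun g => by positivity, ?_, ?_, ?_⟩
  · exact sum_pi_prod_one (q := fun (_ : K) (_ : M) => (1 / Fintype.card M : ℝ)) hq
  · intro k s
    rw [sum_pi_apply (q := fun (_ : K) (_ : M) => (1 / Fintype.card M : ℝ)) hq k
      (fun m => ind (f m = s)), hc]
  · intro k k' s hk
    rw [sum_pi_apply₂ (q := fun (_ : K) (_ : M) => (1 / Fintype.card M : ℝ)) hq hk
      (fun m => ind (f m = s)) (fun m => ind (f m = s)), hc, pow_two]

lemma IsHashFamily.collision {I K M : Type*} [Fintype I] [Fintype M] {μ : I → ℝ}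
    {h : I → K → M} {c : ℝ} (hh : IsHashFamily μ h c) {k k' : K} (hk : k ≠ k') :
    ∑ i, μ i * ind (h i k = h i k') = Fintype.card M * c ^ 2 := by
  have e : ∀ i, μ i * ind (h i k = h i k')
      = ∑ s, μ i * (ind (h i k = s) * ind (h i k' = s)) := fun i => by
    rw [← Finset.mul_sum, sum_ind_eq_mul (h i k) fun s => ind (h i k' = s)]
    simp only [eq_comm]
  simp only [e]
  rw [Finset.sum_comm]
  simp [hh.pair k k' _ hk]

/-! ### Decoding -/

/-- A decoder that picks a candidate passing the test `good` fails only if the true value does not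
pass the test or some other candidate does. -/
lemma exists_decoder {M B : Type*} [Fintype M] [Nonempty M] (good : M → B → Prop) :
    ∃ d : B → M, ∀ m b, ind (d b ≠ m)
      ≤ ind (¬ good m b) + ∑ m', ind (m' ≠ m) * ind (good m' b) := by
  classical
  refine ⟨fun b => if h : ∃ m, good m b then h.choose else Classical.arbitrary M,
    fun m b => ?_⟩
  have hs : 0 ≤ ∑ m', ind (m' ≠ m) * ind (good m' b) :=
    Finset.sum_nonneg fun m' _ => mul_nonneg (ind_nonneg _) (ind_nonneg _)
  by_cases hg : good m b
  · have hex : ∃ m, good m b := ⟨m, hg⟩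
    simp only [dif_pos hex]
    rw [ind_not (not_not.2 hg), zero_add]
    by_cases hm : hex.choose = m
    · rw [ind_not (not_not.2 hm)]; exact hs
    · refine le_trans ?_ (Finset.single_le_sum (f := fun m' => ind (m' ≠ m) * ind (good m' b))
        (fun m' _ => mul_nonneg (ind_nonneg _) (ind_nonneg _)) (Finset.mem_univ hex.choose))
      rw [ind_of hex.choose_spec, mul_one]
  · rw [ind_of hg]
    linarith [ind_le_one ((if h : ∃ m, good m b then h.choose else Classical.arbitrary M) ≠ m)]

/-- Slepian–Wolf coding: the value `v` can be recovered from a random hash value and side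
information `x`. -/
lemma exists_slepian_wolf {I V X M : Type*} [Fintype I] [Fintype V] [Nonempty V]
    {μ : I → ℝ} (hμ : ∀ i, 0 ≤ μ i) (hμ1 : ∑ i, μ i = 1) {h : I → V → M} {c : ℝ} (hc0 : 0 ≤ c)
    (hc : ∀ v v', v ≠ v' → ∑ i, μ i * ind (h i v = h i v') ≤ c)
    {r : V → X → ℝ} (hr : ∀ v x, 0 ≤ r v x) (hr1 : ∀ x, ∑ v, r v x ≤ 1) {t : ℝ} (ht : 0 < t) :
    ∃ d : I → M → X → V, ∀ v x,
      ∑ i, μ i * ind (d i (h i v) x ≠ v) ≤ ind (r v x < t) + c / t := by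
  choose d hd using fun i => exists_decoder
    (fun (v : V) (b : M × X) => h i v = b.1 ∧ t ≤ r v b.2)
  refine ⟨fun i m x => d i (m, x), fun v x => ?_⟩
  have hcount : ∑ v', ind (t ≤ r v' x) ≤ 1 / t := by
    rw [le_div_iff₀ ht, Finset.sum_mul]
    refine le_trans (Finset.sum_le_sum fun v' _ => ?_) (hr1 x)
    by_cases hv : t ≤ r v' x
    · rw [ind_of hv, one_mul]; exact hv
    · rw [ind_not hv, zero_mul]; exact hr v' x
  calc ∑ i, μ i * ind (d i (h i v, x) ≠ v)
      ≤ ∑ i, μ i * (ind (r v x < t)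
        + ∑ v', ind (v' ≠ v) * (ind (h i v' = h i v) * ind (t ≤ r v' x))) := by
        refine Finset.sum_le_sum fun i _ => mul_le_mul_of_nonneg_left ?_ (hμ i)
        refine (hd i v (h i v, x)).trans (add_le_add ?_ ?_)
        · exact ind_le_ind fun hn => by simpa using hn
        · exact le_of_eq (Finset.sum_congr rfl fun v' _ => by rw [ind_and])
    _ = ind (r v x < t)
        + ∑ v', ind (v' ≠ v) * (ind (t ≤ r v' x) * ∑ i, μ i * ind (h i v' = h i v)) := by
        simp only [mul_add, Finset.sum_add_distrib, ← Finset.sum_mul, hμ1, one_mul]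
        congr 1
        simp only [Finset.mul_sum]
        rw [Finset.sum_comm]
        exact Finset.sum_congr rfl fun v' _ => Finset.sum_congr rfl fun i _ => by ring
    _ ≤ ind (r v x < t) + ∑ v', ind (t ≤ r v' x) * c := by
        refine add_le_add_right (Finset.sum_le_sum fun v' _ => ?_) _
        by_cases hv : v' = v
        · rw [ind_not (not_not.2 hv), zero_mul]; exact mul_nonneg (ind_nonneg _) hc0
        · rw [ind_of hv, one_mul]
          exact mul_le_mul_of_nonneg_left (hc v' v hv) (ind_nonneg _)
    _ ≤ _ := by
        rw [← Finset.sum_mul]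
        gcongr
        calc (∑ v', ind (t ≤ r v' x)) * c ≤ 1 / t * c := by gcongr
          _ = c / t := by ring

/-- Channel coding with a random codebook: every message is decoded correctly with high
probability on average. -/
lemma exists_channel_decoder {M A B Ω : Type*} [Fintype M] [DecidableEq M] [Nonempty M]
    [Fintype A] [Fintype Ω]
    {q : A → ℝ} (hq : ∀ a, 0 ≤ q a) (hq1 : ∑ a, q a = 1)
    {W : A → Ω → ℝ} (hW : ∀ a ω, 0 ≤ W a ω) (hW1 : ∀ a, ∑ ω, W a ω = 1) (bf : Ω → B)
    {ρ : A → B → ℝ} (hρ0 : ∀ a b, 0 ≤ ρ a b) (hρ : ∀ b, ∑ a, q a * ρ a b ≤ 1)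
    {γ : ℝ} (hγ : 0 < γ) :
    ∃ d : (M → A) → B → M, ∀ m, ∑ cb : M → A, (∏ i, q (cb i)) *
        ∑ ω, W (cb m) ω * ind (d cb (bf ω) ≠ m)
      ≤ ∑ a, q a * ∑ ω, W a ω * ind (ρ a (bf ω) < γ) + Fintype.card M / γ := by
  choose d hd using fun cb : M → A => exists_decoder
    (fun (m : M) (b : B) => γ ≤ ρ (cb m) b)
  refine ⟨d, fun m => ?_⟩
  have hprod : ∀ cb : M → A, 0 ≤ ∏ i, q (cb i) := fun cb => Finset.prod_nonneg fun i _ => hq _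
  have hq1' : ∀ _m : M, ∑ a, q a = 1 := fun _ => hq1
  have hfalse : ∀ b, ∑ a, q a * ind (γ ≤ ρ a b) ≤ 1 / γ := by
    intro b
    rw [le_div_iff₀ hγ, Finset.sum_mul]
    refine le_trans (Finset.sum_le_sum fun a _ => ?_) (hρ b)
    rw [mul_assoc]
    refine mul_le_mul_of_nonneg_left ?_ (hq a)
    by_cases hv : γ ≤ ρ a b
    · rw [ind_of hv, one_mul]; exact hv
    · rw [ind_not hv, zero_mul]; exact hρ0 a b
  have hpair : ∀ m', ind (m' ≠ m) * ∑ cb : M → A, (∏ i, q (cb i)) *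
      ∑ ω, W (cb m) ω * ind (γ ≤ ρ (cb m') (bf ω)) ≤ 1 / γ := by
    intro m'
    by_cases hm : m' = m
    · rw [ind_not (not_not.2 hm), zero_mul]; positivity
    rw [ind_of hm, one_mul]
    simp only [Finset.mul_sum]
    rw [Finset.sum_comm]
    have e : ∀ ω, ∑ cb : M → A, (∏ i, q (cb i)) * (W (cb m) ω * ind (γ ≤ ρ (cb m') (bf ω)))
        = (∑ a, q a * W a ω) * ∑ a, q a * ind (γ ≤ ρ a (bf ω)) := fun ω =>
      sum_pi_apply₂ (q := fun _ => q) hq1' (Ne.symm hm) (fun a => W a ω)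
        (fun a => ind (γ ≤ ρ a (bf ω)))
    simp only [e]
    calc ∑ ω, (∑ a, q a * W a ω) * ∑ a, q a * ind (γ ≤ ρ a (bf ω))
        ≤ ∑ ω, (∑ a, q a * W a ω) * (1 / γ) := by
          refine Finset.sum_le_sum fun ω _ => mul_le_mul_of_nonneg_left (hfalse _) ?_
          exact Finset.sum_nonneg fun a _ => mul_nonneg (hq a) (hW a ω)
      _ = 1 / γ := by
          rw [← Finset.sum_mul, Finset.sum_comm]
          simp [← Finset.mul_sum, hW1, hq1]
  calc ∑ cb : M → A, (∏ i, q (cb i)) * ∑ ω, W (cb m) ω * ind (d cb (bf ω) ≠ m)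
      ≤ ∑ cb : M → A, (∏ i, q (cb i)) * ∑ ω, W (cb m) ω * (ind (ρ (cb m) (bf ω) < γ)
          + ∑ m', ind (m' ≠ m) * ind (γ ≤ ρ (cb m') (bf ω))) := by
        refine Finset.sum_le_sum fun cb _ => mul_le_mul_of_nonneg_left ?_ (hprod cb)
        refine Finset.sum_le_sum fun ω _ => mul_le_mul_of_nonneg_left ?_ (hW _ _)
        refine (hd cb m (bf ω)).trans ?_
        gcongr
        exact ind_le_ind fun h => not_le.1 h
    _ = ∑ cb : M → A, (∏ i, q (cb i)) * ∑ ω, W (cb m) ω * ind (ρ (cb m) (bf ω) < γ)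
        + ∑ m', ind (m' ≠ m) * ∑ cb : M → A, (∏ i, q (cb i)) *
          ∑ ω, W (cb m) ω * ind (γ ≤ ρ (cb m') (bf ω)) := by
        simp only [mul_add, Finset.sum_add_distrib]
        congr 1
        have e : ∀ cb : M → A, ∑ ω, W (cb m) ω * ∑ m', ind (m' ≠ m) * ind (γ ≤ ρ (cb m') (bf ω))
            = ∑ m', ind (m' ≠ m) * ∑ ω, W (cb m) ω * ind (γ ≤ ρ (cb m') (bf ω)) := by
          intro cb
          simp only [Finset.mul_sum]
          rw [Finset.sum_comm]
          exact Finset.sum_congr rfl fun m' _ => Finset.sum_congr rfl fun ω _ => by ring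
        simp only [e]
        simp only [Finset.mul_sum (s := (Finset.univ : Finset M))]
        rw [Finset.sum_comm]
        refine Finset.sum_congr rfl fun m' _ => ?_
        rw [Finset.mul_sum]
        exact Finset.sum_congr rfl fun cb _ => by ring
    _ ≤ _ := by
        gcongr
        · exact le_of_eq (sum_pi_apply (q := fun _ => q) hq1' m
            (fun a => ∑ ω, W a ω * ind (ρ a (bf ω) < γ)))
        · refine (Finset.sum_le_sum fun m' _ => hpair m').trans ?_
          rw [Finset.sum_const, Finset.card_univ, nsmul_eq_mul]
          exact le_of_eq (by ring)

/-- If `f` is an estimate of `k` that is conditionally independent of `k` given `b`, then `k` can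
also be estimated from `b`, with at most twice the error probability. -/
lemma exists_estimate {T K B : Type*} [Fintype T] [Fintype K] [Nonempty K] [Fintype B]
    {w : K → B → ℝ} (hw : ∀ k b, 0 ≤ w k b) {V : B → T → ℝ} (hV : ∀ b t, 0 ≤ V b t)
    (f : B → T → K) :
    ∃ ψ : B → K, ∑ k, ∑ b, w k b * ∑ t, V b t * ind (ψ b ≠ k)
      ≤ 2 * ∑ k, ∑ b, w k b * ∑ t, V b t * ind (f b t ≠ k) := by
  have hmax : ∀ b, ∃ k, ∀ k', ∑ t, V b t * ind (f b t = k') ≤ ∑ t, V b t * ind (f b t = k) :=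
    fun b => by
      obtain ⟨k, -, hk⟩ := Finset.exists_max_image Finset.univ
        (fun k => ∑ t, V b t * ind (f b t = k)) Finset.univ_nonempty
      exact ⟨k, fun k' => hk k' (Finset.mem_univ _)⟩
  choose ψ hψ using hmax
  refine ⟨ψ, ?_⟩
  simp only [Finset.mul_sum (s := Finset.univ) (a := (2 : ℝ))]
  refine Finset.sum_le_sum fun k _ => Finset.sum_le_sum fun b _ => ?_
  rw [mul_left_comm]
  refine mul_le_mul_of_nonneg_left ?_ (hw k b)
  have hsum : ∑ t, V b t * ind (f b t ≠ k) + ∑ t, V b t * ind (f b t = k) = ∑ t, V b t := by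
    rw [← Finset.sum_add_distrib]
    refine Finset.sum_congr rfl fun t _ => ?_
    rw [← mul_add, add_comm, ind_add_ind_not, mul_one]
  have h0 : 0 ≤ ∑ t, V b t * ind (f b t ≠ k) :=
    Finset.sum_nonneg fun t _ => mul_nonneg (hV b t) (ind_nonneg _)
  by_cases hk : ψ b = k
  · simp only [ind_not (not_not.2 hk), mul_zero, Finset.sum_const_zero]; linarith
  · simp only [ind_of (p := ψ b ≠ k) hk, mul_one]
    have h2 : ∑ t, V b t * ind (f b t = ψ b) ≤ ∑ t, V b t * ind (f b t ≠ k) := by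
      refine Finset.sum_le_sum fun t _ => mul_le_mul_of_nonneg_left ?_ (hV b t)
      exact ind_le_ind fun h => h ▸ hk
    linarith [hψ b k]

/-! ### Distance from a uniform and independent key -/

/-- `L¹` distance of the law of `(S, E)` under the weight `w` from the law in which `S` is uniform
and independent of `E`. -/
def secDist {T E : Type*} [Fintype T] [Fintype E] {N : ℕ} (S : T → Fin N) (e : T → E)
    (w : T → ℝ) : ℝ :=
  ∑ s, ∑ x, |∑ t, (ind (S t = s) - 1 / N) * ind (e t = x) * w t|

lemma secDist_le_add {T E : Type*} [Fintype T] [Fintype E] {N : ℕ}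
    (S S' : T → Fin N) (e : T → E) (w w' : T → ℝ) {D : T → ℝ}
    (hD : ∀ t, ∑ s, |(ind (S t = s) - 1 / N) * w t - (ind (S' t = s) - 1 / N) * w' t| ≤ D t) :
    secDist S e w ≤ secDist S' e w' + ∑ t, D t := by
  have h1 : ∀ s x, |∑ t, (ind (S t = s) - 1 / N) * ind (e t = x) * w t|
      ≤ |∑ t, (ind (S' t = s) - 1 / N) * ind (e t = x) * w' t|
        + ∑ t, ind (e t = x) *
          |(ind (S t = s) - 1 / N) * w t - (ind (S' t = s) - 1 / N) * w' t| := by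
    intro s x
    have : ∑ t, (ind (S t = s) - 1 / N) * ind (e t = x) * w t
        = ∑ t, (ind (S' t = s) - 1 / N) * ind (e t = x) * w' t
          + ∑ t, ind (e t = x) *
            ((ind (S t = s) - 1 / N) * w t - (ind (S' t = s) - 1 / N) * w' t) := by
      rw [← Finset.sum_add_distrib]
      exact Finset.sum_congr rfl fun t _ => by ring
    rw [this]
    refine (abs_add_le _ _).trans (add_le_add_right ?_ _)
    refine (Finset.abs_sum_le_sum_abs _ _).trans (le_of_eq ?_)
    exact Finset.sum_congr rfl fun t _ => by rw [abs_mul, abs_of_nonneg (ind_nonneg _)]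
  unfold secDist
  refine (Finset.sum_le_sum fun s _ => Finset.sum_le_sum fun x _ => h1 s x).trans ?_
  simp only [Finset.sum_add_distrib]
  gcongr
  calc ∑ s, ∑ x, ∑ t, ind (e t = x) *
        |(ind (S t = s) - 1 / N) * w t - (ind (S' t = s) - 1 / N) * w' t|
      = ∑ t, ∑ s, |(ind (S t = s) - 1 / N) * w t - (ind (S' t = s) - 1 / N) * w' t| := by
        rw [Finset.sum_comm (s := (Finset.univ : Finset T))]
        refine Finset.sum_congr rfl fun s _ => ?_
        rw [Finset.sum_comm]
        refine Finset.sum_congr rfl fun t _ => ?_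
        rw [← Finset.sum_mul, sum_ind_eq, one_mul]
    _ ≤ _ := Finset.sum_le_sum fun t _ => hD t

lemma sum_abs_ind_sub {N : ℕ} (hN : 0 < N) (a : Fin N) :
    ∑ s, |ind (a = s) - 1 / (N : ℝ)| ≤ 2 := by
  have hNR : (0 : ℝ) < N := by exact_mod_cast hN
  calc ∑ s, |ind (a = s) - 1 / (N : ℝ)| ≤ ∑ s, (ind (a = s) + 1 / (N : ℝ)) := by
        refine Finset.sum_le_sum fun s _ => ?_
        refine (abs_sub _ _).trans ?_
        rw [abs_of_nonneg (ind_nonneg _), abs_of_nonneg (by positivity)]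
    _ = 2 := by
        rw [Finset.sum_add_distrib, sum_ind_eq]
        simp; field_simp; norm_num

lemma secDist_le_of_weight {T E : Type*} [Fintype T] [Fintype E] {N : ℕ} (hN : 0 < N)
    (S : T → Fin N) (e : T → E) (w w' : T → ℝ) :
    secDist S e w ≤ secDist S e w' + 2 * ∑ t, |w t - w' t| := by
  rw [Finset.mul_sum]
  refine secDist_le_add S S e w w' fun t => ?_
  simp only [← mul_sub, abs_mul, ← Finset.sum_mul]
  exact mul_le_mul_of_nonneg_right (sum_abs_ind_sub hN _) (abs_nonneg _)

lemma secDist_le_of_key {T E : Type*} [Fintype T] [Fintype E] {N : ℕ}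
    (S S' : T → Fin N) (e : T → E) {w : T → ℝ} (hw : ∀ t, 0 ≤ w t) :
    secDist S e w ≤ secDist S' e w + 2 * ∑ t, w t * ind (S t ≠ S' t) := by
  rw [Finset.mul_sum]
  refine secDist_le_add S S' e w w fun t => ?_
  simp only [← sub_mul, abs_mul, ← Finset.sum_mul, abs_of_nonneg (hw t)]
  rw [mul_left_comm, mul_comm]
  refine mul_le_mul_of_nonneg_left ?_ (hw t)
  by_cases h : S t = S' t
  · simp [h, ind_not]
  · rw [ind_of h, mul_one]
    calc ∑ s, |ind (S t = s) - 1 / (N : ℝ) - (ind (S' t = s) - 1 / N)|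
        ≤ ∑ s, (ind (S t = s) + ind (S' t = s)) := by
          refine Finset.sum_le_sum fun s _ => ?_
          rw [sub_sub_sub_cancel_right]
          refine (abs_sub _ _).trans ?_
          rw [abs_of_nonneg (ind_nonneg _), abs_of_nonneg (ind_nonneg _)]
      _ = 2 := by rw [Finset.sum_add_distrib, sum_ind_eq, sum_ind_eq]; norm_num

/-! ### Random choice of the code -/

lemma exists_binning {Ω X Y V : Type*} [Fintype Ω] [Fintype V] [Nonempty V]
    {p : Ω → ℝ} (hp : ∀ ω, 0 ≤ p ω) (hp1 : ∑ ω, p ω = 1)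
    {κ : Y → V → ℝ} (hκ : ∀ y v, 0 ≤ κ y v) (hκ1 : ∀ y, ∑ v, κ y v = 1)
    (xf : Ω → X) (yf : Ω → Y) {r : V → X → ℝ} (hr : ∀ v x, 0 ≤ r v x)
    (hr1 : ∀ x, ∑ v, r v x ≤ 1) {NF NG : ℕ} (hF : 0 < NF) (hG : 0 < NG)
    {tY tX : ℝ} (htY : 0 ≤ tY) (htX : 0 < tX) :
    ∃ (φ : V → Fin NF × Fin NG) (d : Fin NF × Fin NG → X → V),
      3 * ∑ ω, p ω * ∑ f, |∑ v, ind ((φ v).1 = f) * κ (yf ω) v - 1 / NF|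
        + ∑ ω, p ω * ∑ v, κ (yf ω) v * ind (d (φ v) (xf ω) ≠ v)
      ≤ 3 * (2 * ∑ ω, p ω * ∑ v, κ (yf ω) v * ind (tY < κ (yf ω) v) + √((NF - 1) * tY))
        + (∑ ω, p ω * ∑ v, κ (yf ω) v * ind (r v (xf ω) < tX) + 1 / (NF * NG) / tX) := by
  classical
  have : Nonempty (Fin NF) := ⟨⟨0, hF⟩⟩
  have : Nonempty (Fin NG) := ⟨⟨0, hG⟩⟩
  have hFR : (0 : ℝ) < NF := by exact_mod_cast hF
  have hGR : (0 : ℝ) < NG := by exact_mod_cast hG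
  set M := Fin NF × Fin NG
  have hcard : (Fintype.card M : ℝ) = NF * NG := by simp [M]
  have h1 : IsHashFamily (fun _ : V → M => ∏ _k : V, (1 / Fintype.card M : ℝ))
      (fun g k => (g k).1) (1 / NF) := by
    refine isHashFamily_uniform (K := V) (M := M) Prod.fst fun s => ?_
    rw [← Finset.mul_sum, Fintype.sum_prod_type, hcard]
    have : ∀ x : Fin NF, ∑ _y : Fin NG, ind (x = s) = NG * ind (x = s) := fun x => by simp
    simp only [this]
    rw [← Finset.mul_sum]
    simp only [eq_comm (b := s), sum_ind_eq]
    field_simp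
  have h2 : IsHashFamily (fun _ : V → M => ∏ _k : V, (1 / Fintype.card M : ℝ))
      (fun g k => g k) (1 / Fintype.card M) := by
    refine isHashFamily_uniform (K := V) (M := M) id fun s => ?_
    simp only [id, ← Finset.mul_sum, eq_comm (b := s), sum_ind_eq, mul_one]
  set μ : (V → M) → ℝ := fun _ => ∏ _k : V, (1 / Fintype.card M : ℝ) with hμ
  have h3 := h1.leftover hF (P := fun v ω => p ω * κ (yf ω) v)
    (fun v ω => mul_nonneg (hp ω) (hκ _ _))
    (by rw [Finset.sum_comm]; simp [← Finset.mul_sum, hκ1, hp1]) (Q := p) hp hp1.le htY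
  obtain ⟨d, hd⟩ := exists_slepian_wolf (V := V) h2.nonneg h2.sum_one (c := 1 / (NF * NG))
    (by positivity) (fun v v' hv => by
      rw [h2.collision hv, hcard]; exact le_of_eq (by field_simp)) hr hr1 htX
  have e1 : ∀ g : V → M, ∑ s, ∑ ω, |∑ v, (ind ((g v).1 = s) - 1 / NF) * (p ω * κ (yf ω) v)|
      = ∑ ω, p ω * ∑ f, |∑ v, ind ((g v).1 = f) * κ (yf ω) v - 1 / NF| := by
    intro g
    rw [Finset.sum_comm]
    refine Finset.sum_congr rfl fun ω _ => ?_
    rw [Finset.mul_sum]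
    refine Finset.sum_congr rfl fun f _ => ?_
    rw [← abs_of_nonneg (hp ω), ← abs_mul, abs_of_nonneg (hp ω)]
    congr 1
    rw [mul_sub, Finset.mul_sum]
    have : p ω * (1 / NF) = ∑ v, p ω * (1 / NF) * κ (yf ω) v := by
      rw [← Finset.mul_sum, hκ1, mul_one]
    rw [this, ← Finset.sum_sub_distrib]
    exact Finset.sum_congr rfl fun v _ => by ring
  have e2 : ∑ v, ∑ ω, p ω * κ (yf ω) v * ind (tY * p ω < p ω * κ (yf ω) v)
      ≤ ∑ ω, p ω * ∑ v, κ (yf ω) v * ind (tY < κ (yf ω) v) := by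
    rw [Finset.sum_comm]
    refine Finset.sum_le_sum fun ω _ => ?_
    rw [Finset.mul_sum]
    refine Finset.sum_le_sum fun v _ => ?_
    rw [mul_assoc]
    refine mul_le_mul_of_nonneg_left (mul_le_mul_of_nonneg_left (ind_le_ind fun h => ?_)
      (hκ _ _)) (hp ω)
    rw [mul_comm] at h
    exact lt_of_mul_lt_mul_left h (hp ω)
  have h4 : ∑ g, μ g * (3 * ∑ ω, p ω * ∑ f, |∑ v, ind ((g v).1 = f) * κ (yf ω) v - 1 / NF|
        + ∑ ω, p ω * ∑ v, κ (yf ω) v * ind (d g (g v) (xf ω) ≠ v))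
      ≤ 3 * (2 * ∑ ω, p ω * ∑ v, κ (yf ω) v * ind (tY < κ (yf ω) v) + √((NF - 1) * tY))
        + (∑ ω, p ω * ∑ v, κ (yf ω) v * ind (r v (xf ω) < tX) + 1 / (NF * NG) / tX) := by
    simp only [mul_add, Finset.sum_add_distrib]
    refine add_le_add ?_ ?_
    · simp only [mul_left_comm _ (3 : ℝ), ← Finset.mul_sum]
      simp only [e1] at h3
      linarith
    · have e3 : ∑ g, μ g * ∑ ω, p ω * ∑ v, κ (yf ω) v * ind (d g (g v) (xf ω) ≠ v)
          = ∑ ω, p ω * ∑ v, κ (yf ω) v * ∑ g, μ g * ind (d g (g v) (xf ω) ≠ v) := by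
        simp only [Finset.mul_sum]
        rw [Finset.sum_comm]
        refine Finset.sum_congr rfl fun ω _ => ?_
        rw [Finset.sum_comm]
        exact Finset.sum_congr rfl fun v _ => Finset.sum_congr rfl fun g _ => by ring
      rw [e3]
      calc ∑ ω, p ω * ∑ v, κ (yf ω) v * ∑ g, μ g * ind (d g (g v) (xf ω) ≠ v)
          ≤ ∑ ω, p ω * ∑ v, κ (yf ω) v * (ind (r v (xf ω) < tX) + 1 / (NF * NG) / tX) := by
            refine Finset.sum_le_sum fun ω _ => mul_le_mul_of_nonneg_left ?_ (hp ω)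
            exact Finset.sum_le_sum fun v _ => mul_le_mul_of_nonneg_left (hd v _) (hκ _ _)
        _ = _ := by
            simp only [mul_add, Finset.sum_add_distrib, ← Finset.sum_mul, hκ1, hp1, one_mul]
  obtain ⟨g, hg⟩ := exists_le_of_average_le h1.nonneg h1.sum_one h4
  exact ⟨g, d g, hg⟩

lemma exists_codebook {M A B C Ω : Type*} [Fintype M] [DecidableEq M] [Nonempty M]
    [Fintype A] [Fintype Ω] [Fintype C]
    {q : A → ℝ} (hq : ∀ a, 0 ≤ q a) (hq1 : ∑ a, q a = 1)
    {W : A → Ω → ℝ} (hW : ∀ a ω, 0 ≤ W a ω) (hW1 : ∀ a, ∑ ω, W a ω = 1) (bf : Ω → B)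
    {ρ : A → B → ℝ} (hρ0 : ∀ a b, 0 ≤ ρ a b) (hρ : ∀ b, ∑ a, q a * ρ a b ≤ 1)
    {γ : ℝ} (hγ : 0 < γ) {wC : A → C → ℝ} {QC : (M → A) → C → ℝ} {τ εC : ℝ}
    (hεC : ∀ m, ∑ cb : M → A, (∏ i, q (cb i)) *
      ∑ c, wC (cb m) c * ind (τ * QC cb c < wC (cb m) c) ≤ εC)
    {PM : M → ℝ} (hPM : ∀ m, 0 ≤ PM m) (hPM1 : ∑ m, PM m = 1) :
    ∃ (cb : M → A) (d : B → M),
      ∑ m, PM m * ∑ ω, W (cb m) ω * ind (d (bf ω) ≠ m)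
        + 2 * ∑ m, PM m * ∑ c, wC (cb m) c * ind (τ * QC cb c < wC (cb m) c)
      ≤ (∑ a, q a * ∑ ω, W a ω * ind (ρ a (bf ω) < γ) + Fintype.card M / γ) + 2 * εC := by
  obtain ⟨d, hd⟩ := exists_channel_decoder (M := M) hq hq1 hW hW1 bf hρ0 hρ hγ
  have key : ∀ F : (M → A) → M → ℝ, ∑ cb : M → A, (∏ i, q (cb i)) * ∑ m, PM m * F cb m
      = ∑ m, PM m * ∑ cb : M → A, (∏ i, q (cb i)) * F cb m := by
    intro F
    simp only [Finset.mul_sum]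
    rw [Finset.sum_comm]
    exact Finset.sum_congr rfl fun v _ => Finset.sum_congr rfl fun g _ => by ring
  have h4 : ∑ cb : M → A, (∏ i, q (cb i)) *
      (∑ m, PM m * ∑ ω, W (cb m) ω * ind (d cb (bf ω) ≠ m)
        + 2 * ∑ m, PM m * ∑ c, wC (cb m) c * ind (τ * QC cb c < wC (cb m) c))
      ≤ (∑ a, q a * ∑ ω, W a ω * ind (ρ a (bf ω) < γ) + Fintype.card M / γ) + 2 * εC := by
    simp only [mul_add, Finset.sum_add_distrib]
    have h5 : ∀ (G : M → ℝ) (b : ℝ), (∀ m, G m ≤ b) → ∑ m, PM m * G m ≤ b := by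
      intro G b hG
      calc ∑ m, PM m * G m ≤ ∑ m, PM m * b :=
            Finset.sum_le_sum fun m _ => mul_le_mul_of_nonneg_left (hG m) (hPM m)
        _ = b := by rw [← Finset.sum_mul, hPM1, one_mul]
    refine add_le_add ?_ ?_
    · rw [key]; exact h5 _ _ hd
    · simp only [mul_left_comm _ (2 : ℝ), ← Finset.mul_sum (a := (2 : ℝ))]
      rw [key]; linarith [h5 _ _ hεC]
  obtain ⟨cb, hcb⟩ := exists_le_of_average_le
    (fun cb => Finset.prod_nonneg fun i _ => hq _)
    (sum_pi_prod_one (q := fun (_ : M) => q) fun _ => hq1) h4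
  exact ⟨cb, d cb, hcb⟩

lemma exists_hash {K E : Type*} [Fintype K] [Fintype E] {N : ℕ} (hN : 0 < N)
    {P : K → E → ℝ} (hP : ∀ k e, 0 ≤ P k e) (hP1 : ∑ k, ∑ e, P k e ≤ 1)
    {Q : E → ℝ} (hQ : ∀ e, 0 ≤ Q e) (hQ1 : ∑ e, Q e ≤ 1) {T : ℝ} (hT : 0 ≤ T) :
    ∃ h : K → Fin N, ∑ s, ∑ e, |∑ k, (ind (h k = s) - 1 / N) * P k e|
      ≤ 2 * ∑ k, ∑ e, P k e * ind (T * Q e < P k e) + √((N - 1) * T) := by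
  classical
  have : Nonempty (Fin N) := ⟨⟨0, hN⟩⟩
  have h1 : IsHashFamily (fun _ : K → Fin N => ∏ _k : K, (1 / Fintype.card (Fin N) : ℝ))
      (fun g k => g k) (1 / N) := by
    refine isHashFamily_uniform (K := K) (M := Fin N) id fun s => ?_
    simp only [id, ← Finset.mul_sum, eq_comm (b := s), sum_ind_eq, mul_one, Fintype.card_fin]
  exact exists_le_of_average_le h1.nonneg h1.sum_one (h1.leftover hN hP hP1 hQ hQ1 hT)

/-! ### Fixing the public bin index -/

/-- Conditional law of `v` given `y` and the bin index `f`. -/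
def binKernel {Y V M : Type*} [Fintype V] (F : V → M) (κ : Y → V → ℝ) (f : M) (y : Y) (v : V) :
    ℝ :=
  @ite ℝ (∑ v', ind (F v' = f) * κ y v' = 0) (Classical.propDecidable _) (κ y v)
    (ind (F v = f) * κ y v / ∑ v', ind (F v' = f) * κ y v')

section binKernel

variable {Y V M : Type*} [Fintype V] (F : V → M) {κ : Y → V → ℝ}

lemma binKernel_nonneg (hκ : ∀ y v, 0 ≤ κ y v) (f : M) (y : Y) (v : V) :
    0 ≤ binKernel F κ f y v := by
  unfold binKernel
  split_ifs
  · exact hκ y v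
  · exact div_nonneg (mul_nonneg (ind_nonneg _) (hκ y v))
      (Finset.sum_nonneg fun v' _ => mul_nonneg (ind_nonneg _) (hκ y v'))

lemma sum_binKernel (hκ1 : ∀ y, ∑ v, κ y v = 1) (f : M) (y : Y) :
    ∑ v, binKernel F κ f y v = 1 := by
  unfold binKernel
  split_ifs with h
  · exact hκ1 y
  · rw [← Finset.sum_div, div_self h]

lemma mul_binKernel (hκ : ∀ y v, 0 ≤ κ y v) (f : M) (y : Y) (v : V) :
    (∑ v', ind (F v' = f) * κ y v') * binKernel F κ f y v = ind (F v = f) * κ y v := by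
  unfold binKernel
  split_ifs with h
  · rw [h, zero_mul]
    exact ((Finset.sum_eq_zero_iff_of_nonneg
      fun v' _ => mul_nonneg (ind_nonneg _) (hκ y v')).1 h v (Finset.mem_univ v)).symm
  · rw [mul_div_cancel₀ _ h]

end binKernel

/-- Joint weight of the source, Bob's value `(v, u)` and the output of the channel. -/
def codeWeight {Ω Y V U A Ω₂ : Type*} [Fintype U] (p : Ω → ℝ) (yf : Ω → Y) (κ : Y → V → ℝ)
    (W : A → Ω₂ → ℝ) (cb : V × U → A) (t : Ω × (V × U) × Ω₂) : ℝ :=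
  p t.1 * (κ (yf t.1) t.2.1.1 * (1 / Fintype.card U)) * W (cb t.2.1) t.2.2

lemma exists_bin_index {Ω X Y V U A Ω₂ B E : Type*} [Fintype Ω] [Fintype V] [Fintype U]
    [Nonempty U] [Fintype Ω₂] [Fintype E]
    {p : Ω → ℝ} (hp : ∀ ω, 0 ≤ p ω)
    {κ : Y → V → ℝ} (hκ : ∀ y v, 0 ≤ κ y v) (hκ1 : ∀ y, ∑ v, κ y v = 1)
    {W : A → Ω₂ → ℝ} (hW : ∀ a ω, 0 ≤ W a ω) (hW1 : ∀ a, ∑ ω, W a ω = 1)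
    (xf : Ω → X) (yf : Ω → Y) (bf : Ω₂ → B) {NF NS : ℕ} (hF : 0 < NF) (hS : 0 < NS)
    (F : V → Fin NF) (cb : V × U → A) (d : Fin NF → X → B → V × U) (s : V × U → Fin NS)
    (ef : Ω × Ω₂ → E) :
    ∃ f : Fin NF,
      ∑ t, codeWeight p yf (binKernel F κ f) W cb t * ind (d f (xf t.1) (bf t.2.2) ≠ t.2.1)
        + secDist (fun t : Ω × (V × U) × Ω₂ => s t.2.1) (fun t => ef (t.1, t.2.2))
          (codeWeight p yf (binKernel F κ f) W cb)
      ≤ ∑ t, codeWeight p yf κ W cb t * ind (d (F t.2.1.1) (xf t.1) (bf t.2.2) ≠ t.2.1)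
        + secDist (fun t : Ω × (V × U) × Ω₂ => s t.2.1)
          (fun t => (F t.2.1.1, ef (t.1, t.2.2))) (codeWeight p yf κ W cb)
        + 3 * ∑ ω, p ω * ∑ f, |∑ v, ind (F v = f) * κ (yf ω) v - 1 / NF| := by
  have hFR : (0 : ℝ) < NF := by exact_mod_cast hF
  set T := Ω × (V × U) × Ω₂
  set J : Fin NF × T → ℝ := fun x =>
    1 / NF * codeWeight p yf (binKernel F κ x.1) W cb x.2 with hJ
  set I : Fin NF × T → ℝ := fun x => ind (F x.2.2.1.1 = x.1) * codeWeight p yf κ W cb x.2 with hI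
  have hdiff : ∑ x, |J x - I x|
      = ∑ ω, p ω * ∑ f, |∑ v, ind (F v = f) * κ (yf ω) v - 1 / NF| := by
    have e : ∀ x : Fin NF × T, |J x - I x|
        = p x.2.1 * |∑ v, ind (F v = x.1) * κ (yf x.2.1) v - 1 / NF|
          * (binKernel F κ x.1 (yf x.2.1) x.2.2.1.1 * (1 / Fintype.card U))
          * W (cb x.2.2.1) x.2.2.2 := by
      rintro ⟨f, ω, ⟨v, u⟩, ω₂⟩
      have hb := binKernel_nonneg F hκ f (yf ω) v
      have : J (f, ω, (v, u), ω₂) - I (f, ω, (v, u), ω₂)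
          = -(p ω * (∑ v, ind (F v = f) * κ (yf ω) v - 1 / NF)
          * (binKernel F κ f (yf ω) v * (1 / Fintype.card U)) * W (cb (v, u)) ω₂) := by
        simp only [hJ, hI, codeWeight]
        linear_combination (p ω * (1 / Fintype.card U) * W (cb (v, u)) ω₂)
          * mul_binKernel F hκ f (yf ω) v
      rw [this, abs_neg, abs_mul, abs_mul, abs_mul, abs_of_nonneg (hp ω),
        abs_of_nonneg (hW _ _), abs_of_nonneg (mul_nonneg hb (by positivity))]
    simp only [e, Fintype.sum_prod_type, T]
    rw [Finset.sum_comm]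
    refine Finset.sum_congr rfl fun ω _ => ?_
    rw [Finset.mul_sum]
    refine Finset.sum_congr rfl fun f _ => ?_
    simp only [← Finset.mul_sum, hW1, mul_one]
    have hU : ∑ _u : U, 1 / (Fintype.card U : ℝ) = 1 := by simp
    simp only [hU, mul_one, sum_binKernel F hκ1, mul_one]
  have herr : ∑ x, J x * ind (d x.1 (xf x.2.1) (bf x.2.2.2) ≠ x.2.2.1)
      ≤ ∑ x, I x * ind (d x.1 (xf x.2.1) (bf x.2.2.2) ≠ x.2.2.1) + ∑ x, |J x - I x| := by
    rw [← Finset.sum_add_distrib]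
    refine Finset.sum_le_sum fun x _ => ?_
    have h0 := ind_nonneg (d x.1 (xf x.2.1) (bf x.2.2.2) ≠ x.2.2.1)
    have h1 := ind_le_one (d x.1 (xf x.2.1) (bf x.2.2.2) ≠ x.2.2.1)
    have h2 : (J x - I x) * ind (d x.1 (xf x.2.1) (bf x.2.2.2) ≠ x.2.2.1) ≤ |J x - I x| * 1 :=
      mul_le_mul (le_abs_self _) h1 h0 (abs_nonneg _)
    linarith
  have hsec := secDist_le_of_weight hS (fun x : Fin NF × T => s x.2.2.1)
    (fun x => (x.1, ef (x.2.1, x.2.2.2))) J I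
  have eIerr : ∑ x, I x * ind (d x.1 (xf x.2.1) (bf x.2.2.2) ≠ x.2.2.1)
      = ∑ t, codeWeight p yf κ W cb t * ind (d (F t.2.1.1) (xf t.1) (bf t.2.2) ≠ t.2.1) := by
    rw [Fintype.sum_prod_type, Finset.sum_comm]
    refine Finset.sum_congr rfl fun t _ => ?_
    simp only [hI, mul_assoc]
    rw [sum_ind_eq_mul (F t.2.1.1) fun f =>
      codeWeight p yf κ W cb t * ind (d f (xf t.1) (bf t.2.2) ≠ t.2.1)]
  have eIsec : secDist (fun x : Fin NF × T => s x.2.2.1) (fun x => (x.1, ef (x.2.1, x.2.2.2))) I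
      = secDist (fun t : T => s t.2.1)
          (fun t => (F t.2.1.1, ef (t.1, t.2.2))) (codeWeight p yf κ W cb) := by
    unfold secDist
    refine Finset.sum_congr rfl fun k _ => Finset.sum_congr rfl fun e _ => ?_
    congr 1
    rw [Fintype.sum_prod_type, Finset.sum_comm]
    refine Finset.sum_congr rfl fun t _ => ?_
    rw [← sum_ind_eq_mul (F t.2.1.1) fun f => (ind (s t.2.1 = k) - 1 / NS) *
      ind ((f, ef (t.1, t.2.2)) = e) * codeWeight p yf κ W cb t]
    refine Finset.sum_congr rfl fun f _ => ?_
    simp only [hI]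
    ring
  have eJsec : secDist (fun x : Fin NF × T => s x.2.2.1) (fun x => (x.1, ef (x.2.1, x.2.2.2))) J
      = ∑ f : Fin NF, 1 / NF * secDist (fun t : T => s t.2.1) (fun t => ef (t.1, t.2.2))
          (codeWeight p yf (binKernel F κ f) W cb) := by
    unfold secDist
    simp only [Finset.mul_sum (a := 1 / (NF : ℝ))]
    rw [Finset.sum_comm (s := (Finset.univ : Finset (Fin NF)))]
    refine Finset.sum_congr rfl fun k _ => ?_
    rw [Fintype.sum_prod_type]
    refine Finset.sum_congr rfl fun f _ => Finset.sum_congr rfl fun e _ => ?_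
    rw [← abs_of_nonneg (a := 1 / (NF : ℝ)) (by positivity), ← abs_mul]
    congr 1
    rw [Fintype.sum_prod_type, Finset.sum_eq_single f]
    · rw [Finset.mul_sum]
      refine Finset.sum_congr rfl fun t _ => ?_
      simp only [hJ, Prod.mk.injEq, true_and]
      ring
    · intro f' _ hf'
      refine Finset.sum_eq_zero fun t _ => ?_
      rw [ind_not (p := (f', _) = (f, e)) (fun h => hf' (Prod.mk.inj h).1)]
      ring
    · simp
  have havg : ∑ f : Fin NF, 1 / (NF : ℝ) * (∑ t, codeWeight p yf (binKernel F κ f) W cb t *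
        ind (d f (xf t.1) (bf t.2.2) ≠ t.2.1)
        + secDist (fun t : T => s t.2.1) (fun t => ef (t.1, t.2.2))
          (codeWeight p yf (binKernel F κ f) W cb))
      ≤ ∑ t, codeWeight p yf κ W cb t * ind (d (F t.2.1.1) (xf t.1) (bf t.2.2) ≠ t.2.1)
        + secDist (fun t : T => s t.2.1)
          (fun t => (F t.2.1.1, ef (t.1, t.2.2))) (codeWeight p yf κ W cb)
        + 3 * ∑ ω, p ω * ∑ f, |∑ v, ind (F v = f) * κ (yf ω) v - 1 / NF| := by
    simp only [mul_add, Finset.sum_add_distrib]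
    rw [← eJsec]
    have : ∑ f : Fin NF, 1 / (NF : ℝ) * ∑ t, codeWeight p yf (binKernel F κ f) W cb t *
        ind (d f (xf t.1) (bf t.2.2) ≠ t.2.1)
        = ∑ x, J x * ind (d x.1 (xf x.2.1) (bf x.2.2.2) ≠ x.2.2.1) := by
      rw [Fintype.sum_prod_type]
      refine Finset.sum_congr rfl fun f _ => ?_
      rw [Finset.mul_sum]
      exact Finset.sum_congr rfl fun t _ => by simp only [hJ]; ring
    rw [this]
    rw [eIerr, hdiff] at herr
    rw [eIsec, hdiff] at hsec
    linarith
  exact exists_le_of_average_le (fun _ => by positivity) (by simp; field_simp) havg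

/-! ### The one-shot bound -/

lemma sum_codeWeight {Ω Y V U A Ω₂ : Type*} [Fintype Ω] [Fintype V] [Fintype U] [Fintype Ω₂]
    (p : Ω → ℝ) (yf : Ω → Y) (κ : Y → V → ℝ) (W : A → Ω₂ → ℝ) (cb : V × U → A)
    (h : Ω → V × U → Ω₂ → ℝ) :
    ∑ t, codeWeight p yf κ W cb t * h t.1 t.2.1 t.2.2
      = ∑ k : V × U, ∑ ω, p ω * (κ (yf ω) k.1 * (1 / Fintype.card U))
          * ∑ ω₂, W (cb k) ω₂ * h ω k ω₂ := by
  rw [Fintype.sum_prod_type]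
  simp only [Fintype.sum_prod_type (α₁ := V × U)]
  rw [Finset.sum_comm]
  refine Finset.sum_congr rfl fun k _ => Finset.sum_congr rfl fun ω _ => ?_
  rw [Finset.mul_sum]
  refine Finset.sum_congr rfl fun ω₂ _ => ?_
  simp only [codeWeight]
  ring

lemma exists_bob_estimate {Ω X Y V U A Ω₂ B : Type*} [Fintype Ω] [Fintype Y] [Fintype V]
    [Nonempty V] [Fintype U] [Nonempty U] [Fintype A] [Fintype Ω₂]
    {p : Ω → ℝ} (hp : ∀ ω, 0 ≤ p ω) {κ : Y → V → ℝ} (hκ : ∀ y v, 0 ≤ κ y v)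
    {W : A → Ω₂ → ℝ} (hW : ∀ a ω, 0 ≤ W a ω) (xf : Ω → X) (yf : Ω → Y) (bf : Ω₂ → B)
    (cb : V × U → A) (d : X → B → V × U) :
    ∃ ψ : Y → A → V × U,
      ∑ t, codeWeight p yf κ W cb t * ind (ψ (yf t.1) (cb t.2.1) ≠ t.2.1)
        ≤ 2 * ∑ t, codeWeight p yf κ W cb t * ind (d (xf t.1) (bf t.2.2) ≠ t.2.1) := by
  obtain ⟨ψ, hψ⟩ := exists_estimate (T := Ω × Ω₂) (K := V × U) (B := Y × A)
    (w := fun k b => κ b.1 k.1 * (1 / Fintype.card U) * ind (cb k = b.2))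
    (fun k b => mul_nonneg (mul_nonneg (hκ _ _) (by positivity)) (ind_nonneg _))
    (V := fun b t => ind (yf t.1 = b.1) * p t.1 * W b.2 t.2)
    (fun b t => mul_nonneg (mul_nonneg (ind_nonneg _) (hp _)) (hW _ _))
    (fun _ t => d (xf t.1) (bf t.2))
  have key : ∀ h : V × U → Y × A → Ω × Ω₂ → ℝ,
      ∑ k : V × U, ∑ b : Y × A, κ b.1 k.1 * (1 / (Fintype.card U : ℝ)) * ind (cb k = b.2) *
        ∑ t : Ω × Ω₂, ind (yf t.1 = b.1) * p t.1 * W b.2 t.2 * h k b t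
      = ∑ t : Ω × (V × U) × Ω₂,
          codeWeight p yf κ W cb t * h t.2.1 (yf t.1, cb t.2.1) (t.1, t.2.2) := by
    intro h
    rw [sum_codeWeight p yf κ W cb fun ω k ω₂ => h k (yf ω, cb k) (ω, ω₂)]
    refine Finset.sum_congr rfl fun k _ => ?_
    simp only [Fintype.sum_prod_type]
    have e1 : ∀ y, ∑ a, κ y k.1 * (1 / (Fintype.card U : ℝ)) * ind (cb k = a) *
        ∑ ω, ∑ ω₂, ind (yf ω = y) * p ω * W a ω₂ * h k (y, a) (ω, ω₂)
        = ∑ ω, ind (yf ω = y) * (p ω * (κ y k.1 * (1 / Fintype.card U))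
          * ∑ ω₂, W (cb k) ω₂ * h k (y, cb k) (ω, ω₂)) := by
      intro y
      have : ∀ a, κ y k.1 * (1 / (Fintype.card U : ℝ)) * ind (cb k = a) *
        ∑ ω, ∑ ω₂, ind (yf ω = y) * p ω * W a ω₂ * h k (y, a) (ω, ω₂)
        = ind (cb k = a) * (κ y k.1 * (1 / (Fintype.card U : ℝ)) *
        ∑ ω, ∑ ω₂, ind (yf ω = y) * p ω * W a ω₂ * h k (y, a) (ω, ω₂)) := fun a => by ring
      simp only [this]
      rw [sum_ind_eq_mul (cb k) fun a => κ y k.1 * (1 / (Fintype.card U : ℝ)) *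
        ∑ ω, ∑ ω₂, ind (yf ω = y) * p ω * W a ω₂ * h k (y, a) (ω, ω₂)]
      simp only [Finset.mul_sum]
      exact Finset.sum_congr rfl fun ω _ => Finset.sum_congr rfl fun ω₂ _ => by ring
    simp only [e1]
    rw [Finset.sum_comm]
    exact Finset.sum_congr rfl fun ω _ => sum_ind_eq_mul (yf ω) fun y =>
      p ω * (κ y k.1 * (1 / Fintype.card U)) * ∑ ω₂, W (cb k) ω₂ * h k (y, cb k) (ω, ω₂)
  rw [key fun k b _ => ind (ψ b ≠ k), key fun k _ t => ind (d (xf t.1) (bf t.2) ≠ k)] at hψ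
  exact ⟨fun y a => ψ (y, a), hψ⟩

/-- One-shot key agreement from a source and one use of a channel. -/
theorem exists_one_shot {Ω X Y Z V A Ω₂ B C : Type*} [Fintype Ω] [Fintype Y] [Fintype Z]
    [Fintype V] [Nonempty V] [Fintype A] [Fintype Ω₂] [Fintype C]
    {p : Ω → ℝ} (hp : ∀ ω, 0 ≤ p ω) (hp1 : ∑ ω, p ω = 1)
    {κ : Y → V → ℝ} (hκ : ∀ y v, 0 ≤ κ y v) (hκ1 : ∀ y, ∑ v, κ y v = 1)
    {q : A → ℝ} (hq : ∀ a, 0 ≤ q a) (hq1 : ∑ a, q a = 1)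
    {W : A → Ω₂ → ℝ} (hW : ∀ a ω, 0 ≤ W a ω) (hW1 : ∀ a, ∑ ω, W a ω = 1)
    (xf : Ω → X) (yf : Ω → Y) (zf : Ω → Z) (bf : Ω₂ → B) (cf : Ω₂ → C)
    {rX : V → X → ℝ} (hrX : ∀ v x, 0 ≤ rX v x) (hrX1 : ∀ x, ∑ v, rX v x ≤ 1)
    {pZ : Z → ℝ} (hpZ : ∀ z, 0 ≤ pZ z) (hpZ1 : ∑ z, pZ z ≤ 1)
    {rZ : V → Z → ℝ} (hrZ : ∀ v z, 0 ≤ rZ v z)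
    (hVZ : ∀ v z, ∑ ω, p ω * κ (yf ω) v * ind (zf ω = z) = rZ v z * pZ z)
    {ρ : A → B → ℝ} (hρ0 : ∀ a b, 0 ≤ ρ a b) (hρ : ∀ b, ∑ a, q a * ρ a b ≤ 1)
    {wC : A → C → ℝ} (hwC : ∀ a c, ∑ ω, W a ω * ind (cf ω = c) = wC a c)
    {NF NG NU NS : ℕ} (hF : 0 < NF) (hG : 0 < NG) (hU : 0 < NU) (hS : 0 < NS)
    {tY tX tZ γ τ εC : ℝ} (htY : 0 ≤ tY) (htX : 0 < tX) (htZ : 0 ≤ tZ) (hγ : 0 < γ) (hτ : 0 ≤ τ)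
    {QC : (Fin NG × Fin NU → A) → C → ℝ} (hQC : ∀ cb c, 0 ≤ QC cb c)
    (hQC1 : ∀ cb, ∑ c, QC cb c ≤ 1)
    (hεC : ∀ m, ∑ cb : Fin NG × Fin NU → A, (∏ i, q (cb i)) *
      ∑ c, wC (cb m) c * ind (τ * QC cb c < wC (cb m) c) ≤ εC)
    {η : ℝ} (hη : 3 * (2 * ∑ ω, p ω * ∑ v, κ (yf ω) v * ind (tY < κ (yf ω) v)
          + √((NF - 1) * tY))
        + (∑ ω, p ω * ∑ v, κ (yf ω) v * ind (rX v (xf ω) < tX) + 1 / (NF * NG) / tX)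
        + (∑ a, q a * ∑ ω, W a ω * ind (ρ a (bf ω) < γ) + NG * NU / γ + 2 * εC)
        + (2 * ∑ ω, p ω * ∑ v, κ (yf ω) v * ind (tZ < rZ v (zf ω))
          + √((NS - 1) * (tZ * τ * NF / NU))) ≤ η) :
    ∃ (κ' : Y → V → ℝ) (cb : V × Fin NU → A) (sA : X → B → Fin NS) (sB : Y → A → Fin NS),
      (∀ y v, 0 ≤ κ' y v) ∧ (∀ y, ∑ v, κ' y v = 1) ∧
      ∑ t, codeWeight p yf κ' W cb t
          * ind (sB (yf t.1) (cb t.2.1) ≠ sA (xf t.1) (bf t.2.2)) ≤ 3 * η ∧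
      secDist (fun t : Ω × (V × Fin NU) × Ω₂ => sA (xf t.1) (bf t.2.2))
        (fun t => (zf t.1, cf t.2.2)) (codeWeight p yf κ' W cb) ≤ 3 * η := by
  classical
  have : Nonempty (Fin NG) := ⟨⟨0, hG⟩⟩
  have : Nonempty (Fin NU) := ⟨⟨0, hU⟩⟩
  have hFR : (0 : ℝ) < NF := by exact_mod_cast hF
  have hUR : (0 : ℝ) < NU := by exact_mod_cast hU
  have hwC0 : ∀ a c, 0 ≤ wC a c := fun a c => by
    rw [← hwC]; exact Finset.sum_nonneg fun ω _ => mul_nonneg (hW _ _) (ind_nonneg _)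
  have hwC1 : ∀ a, ∑ c, wC a c = 1 := fun a => by
    simp only [← hwC]
    rw [Finset.sum_comm]
    simp only [← Finset.mul_sum, sum_ind_eq, mul_one, hW1]
  obtain ⟨φ, dX, hφ⟩ := exists_binning hp hp1 hκ hκ1 xf yf hrX hrX1 hF hG htY htX
  -- the codebook
  set PM : Fin NG × Fin NU → ℝ := fun m =>
    ∑ ω, p ω * ∑ v, κ (yf ω) v * ind ((φ v).2 = m.1) * (1 / NU) with hPMdef
  have hPM : ∀ m, 0 ≤ PM m := fun m => Finset.sum_nonneg fun ω _ => mul_nonneg (hp ω)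
    (Finset.sum_nonneg fun v _ => mul_nonneg (mul_nonneg (hκ _ _) (ind_nonneg _)) (by positivity))
  have hPMsum : ∀ h : Fin NG × Fin NU → ℝ, ∑ m, PM m * h m
      = ∑ k : V × Fin NU, ∑ ω, p ω * (κ (yf ω) k.1 * (1 / NU)) * h ((φ k.1).2, k.2) := by
    intro h
    simp only [hPMdef, Fintype.sum_prod_type, Finset.sum_mul, Finset.mul_sum]
    rw [Finset.sum_comm]
    rw [Finset.sum_comm (s := (Finset.univ : Finset V))]
    refine Finset.sum_congr rfl fun u _ => ?_
    rw [Finset.sum_comm]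
    rw [Finset.sum_comm (s := (Finset.univ : Finset V))]
    refine Finset.sum_congr rfl fun ω _ => ?_
    rw [Finset.sum_comm]
    refine Finset.sum_congr rfl fun v _ => ?_
    rw [← sum_ind_eq_mul (φ v).2 fun g => p ω * (κ (yf ω) v * (1 / NU)) * h (g, u)]
    exact Finset.sum_congr rfl fun g _ => by ring
  have hU1 : ∑ _u : Fin NU, 1 / (NU : ℝ) = 1 := by simp; field_simp
  have hsum1 : ∀ h : V → Ω → ℝ, ∑ k : V × Fin NU, ∑ ω, p ω * (κ (yf ω) k.1 * (1 / NU)) * h k.1 ω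
      = ∑ ω, p ω * ∑ v, κ (yf ω) v * h v ω := by
    intro h
    rw [Finset.sum_comm]
    refine Finset.sum_congr rfl fun ω _ => ?_
    rw [Fintype.sum_prod_type, Finset.mul_sum]
    refine Finset.sum_congr rfl fun v _ => ?_
    have : p ω * (κ (yf ω) v * (1 / NU)) * h v ω
        = p ω * (κ (yf ω) v * h v ω) * (1 / NU) := by ring
    simp only [this]
    rw [← Finset.mul_sum, hU1, mul_one]
  have hPM1 : ∑ m, PM m = 1 := by
    have := hPMsum fun _ => 1
    simp only [mul_one] at this
    rw [this]
    have := hsum1 fun _ _ => 1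
    simp only [mul_one] at this
    rw [this]
    simp [hκ1, hp1]
  obtain ⟨cb₀, dB, hcb⟩ := exists_codebook hq hq1 hW hW1 bf hρ0 hρ hγ hεC hPM hPM1
  set cb : V × Fin NU → A := fun k => cb₀ ((φ k.1).2, k.2) with hcbdef
  -- the key
  set P : V × Fin NU → Fin NF × (Z × C) → ℝ := fun k e =>
    ind ((φ k.1).1 = e.1) * (rZ k.1 e.2.1 * pZ e.2.1) * (1 / NU) * wC (cb k) e.2.2 with hPdef
  set Q : Fin NF × (Z × C) → ℝ := fun e => 1 / NF * pZ e.2.1 * QC cb₀ e.2.2 with hQdef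
  have hP : ∀ k e, 0 ≤ P k e := fun k e => mul_nonneg (mul_nonneg (mul_nonneg (ind_nonneg _)
    (mul_nonneg (hrZ _ _) (hpZ _))) (by positivity)) (hwC0 _ _)
  have hQ : ∀ e, 0 ≤ Q e := fun e => mul_nonneg (mul_nonneg (by positivity) (hpZ _)) (hQC _ _)
  have hQ1 : ∑ e, Q e ≤ 1 := by
    simp only [hQdef, Fintype.sum_prod_type, ← Finset.mul_sum, ← Finset.sum_mul]
    have h1 : (∑ z, pZ z) * ∑ c, QC cb₀ c ≤ 1 := by
      have := hQC1 cb₀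
      have h2 : 0 ≤ ∑ c, QC cb₀ c := Finset.sum_nonneg fun c _ => hQC _ _
      nlinarith
    refine le_trans (le_of_eq ?_) h1
    rw [Finset.sum_const, Finset.card_univ, Fintype.card_fin, nsmul_eq_mul]
    field_simp
  have hPV : ∀ (v : V) (h : Z → ℝ), ∑ z, rZ v z * pZ z * h z
      = ∑ ω, p ω * κ (yf ω) v * h (zf ω) := by
    intro v h
    simp only [← hVZ, Finset.sum_mul]
    rw [Finset.sum_comm]
    refine Finset.sum_congr rfl fun ω _ => ?_
    rw [← sum_ind_eq_mul (zf ω) fun z => p ω * κ (yf ω) v * h z]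
    exact Finset.sum_congr rfl fun z _ => by ring
  have hPsum : ∀ (k : V × Fin NU) (h : Z → C → ℝ), ∑ e, P k e * h e.2.1 e.2.2
      = ∑ ω, p ω * (κ (yf ω) k.1 * (1 / NU)) * ∑ c, wC (cb k) c * h (zf ω) c := by
    intro k h
    rw [Fintype.sum_prod_type]
    have : ∀ f, ∑ e : Z × C, P k (f, e) * h e.1 e.2
        = ind ((φ k.1).1 = f) *
          ∑ e : Z × C, (rZ k.1 e.1 * pZ e.1) * (1 / NU) * wC (cb k) e.2 * h e.1 e.2 := by
      intro f
      rw [Finset.mul_sum]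
      exact Finset.sum_congr rfl fun e _ => by simp only [hPdef]; ring
    simp only [this, sum_ind_eq_mul]
    rw [Fintype.sum_prod_type]
    have e2 := hPV k.1 fun z => 1 / NU * ∑ c, wC (cb k) c * h z c
    simp only [Finset.mul_sum] at e2 ⊢
    refine Eq.trans (Finset.sum_congr rfl fun z _ => Finset.sum_congr rfl fun c _ => ?_)
      (e2.trans (Finset.sum_congr rfl fun z _ => Finset.sum_congr rfl fun c _ => ?_)) <;> ring
  have hP1 : ∑ k, ∑ e, P k e = 1 := by
    have h1 := fun k => hPsum k fun _ _ => 1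
    simp only [mul_one, hwC1] at h1
    simp only [h1]
    have := hsum1 fun _ _ => 1
    simp only [mul_one] at this
    rw [this]
    simp [hκ1, hp1]
  have hT : 0 ≤ tZ * τ * NF / NU := by positivity
  obtain ⟨s, hs⟩ := exists_hash hS hP hP1.le hQ hQ1 hT
  have hbad : ∑ k, ∑ e, P k e * ind (tZ * τ * NF / NU * Q e < P k e)
      ≤ ∑ ω, p ω * ∑ v, κ (yf ω) v * ind (tZ < rZ v (zf ω))
        + ∑ m, PM m * ∑ c, wC (cb₀ m) c * ind (τ * QC cb₀ c < wC (cb₀ m) c) := by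
    calc ∑ k, ∑ e, P k e * ind (tZ * τ * NF / NU * Q e < P k e)
        ≤ ∑ k, ∑ e, P k e * (ind (tZ < rZ k.1 e.2.1)
            + ind (τ * QC cb₀ e.2.2 < wC (cb k) e.2.2)) := by
          refine Finset.sum_le_sum fun k _ => Finset.sum_le_sum fun e _ =>
            mul_le_mul_of_nonneg_left (ind_or_le fun h => ?_) (hP k e)
          by_contra! hc
          obtain ⟨h1, h2⟩ := hc
          refine absurd h (not_lt.2 ?_)
          have e1 : tZ * τ * NF / NU * Q e
              = (1 / NU) * pZ e.2.1 * (tZ * (τ * QC cb₀ e.2.2)) := by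
            simp only [hQdef]; field_simp
          have e2 : P k e = (1 / NU) * pZ e.2.1 *
              (ind ((φ k.1).1 = e.1) * (rZ k.1 e.2.1 * wC (cb k) e.2.2)) := by
            simp only [hPdef]; ring
          rw [e1, e2]
          refine mul_le_mul_of_nonneg_left ?_ (mul_nonneg (by positivity) (hpZ _))
          calc ind ((φ k.1).1 = e.1) * (rZ k.1 e.2.1 * wC (cb k) e.2.2)
              ≤ 1 * (rZ k.1 e.2.1 * wC (cb k) e.2.2) :=
                mul_le_mul_of_nonneg_right (ind_le_one _) (mul_nonneg (hrZ _ _) (hwC0 _ _))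
            _ ≤ tZ * (τ * QC cb₀ e.2.2) := by
                rw [one_mul]
                exact mul_le_mul h1 h2 (hwC0 _ _) htZ
      _ = ∑ k : V × Fin NU, ∑ ω, p ω * (κ (yf ω) k.1 * (1 / NU)) * ind (tZ < rZ k.1 (zf ω))
          + ∑ k : V × Fin NU, ∑ ω, p ω * (κ (yf ω) k.1 * (1 / NU)) *
            ∑ c, wC (cb k) c * ind (τ * QC cb₀ c < wC (cb k) c) := by
          rw [← Finset.sum_add_distrib]
          refine Finset.sum_congr rfl fun k _ => ?_
          rw [hPsum k fun z c => ind (tZ < rZ k.1 z) + ind (τ * QC cb₀ c < wC (cb k) c),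
            ← Finset.sum_add_distrib]
          refine Finset.sum_congr rfl fun ω _ => ?_
          simp only [mul_add, Finset.sum_add_distrib, ← Finset.sum_mul, hwC1, one_mul]
      _ = _ := by
          rw [hsum1 fun v ω => ind (tZ < rZ v (zf ω)), hPMsum]
  obtain ⟨f, hf⟩ := exists_bin_index (E := Z × C) hp hκ hκ1 hW hW1 xf yf bf hF hS
    (fun v => (φ v).1) cb
    (fun f x b => (dX (f, (dB b).1) x, (dB b).2)) s (fun t => (zf t.1, cf t.2))
  have hsec : secDist (fun t : Ω × (V × Fin NU) × Ω₂ => s t.2.1)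
      (fun t => ((φ t.2.1.1).1, (zf t.1, cf t.2.2))) (codeWeight p yf κ W cb)
      = ∑ i, ∑ e, |∑ k, (ind (s k = i) - 1 / NS) * P k e| := by
    unfold secDist
    refine Finset.sum_congr rfl fun i _ => Finset.sum_congr rfl fun e _ => ?_
    congr 1
    have e0 := sum_codeWeight p yf κ W cb fun ω k ω₂ => (ind (s k = i) - 1 / NS) *
      ind (((φ k.1).1, (zf ω, cf ω₂)) = e)
    refine Eq.trans (Finset.sum_congr rfl fun t _ => ?_) (e0.trans
      (Finset.sum_congr rfl fun k _ => ?_))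
    · ring
    obtain ⟨f', z, c⟩ := e
    have e1 : ∀ ω ω₂, ind (((φ k.1).1, (zf ω, cf ω₂)) = (f', z, c))
        = ind ((φ k.1).1 = f') * (ind (zf ω = z) * ind (cf ω₂ = c)) := by
      intro ω ω₂
      rw [← ind_and, ← ind_and]
      simp only [Prod.mk.injEq]
    simp only [e1, hPdef, ← hVZ, ← hwC, Finset.sum_mul, Finset.mul_sum, Fintype.card_fin]
    rw [Finset.sum_comm]
    exact Finset.sum_congr rfl fun ω _ => Finset.sum_congr rfl fun ω₂ _ => by ring
  have herr : ∑ t, codeWeight p yf κ W cb t *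
      ind ((dX ((φ t.2.1.1).1, (dB (bf t.2.2)).1) (xf t.1), (dB (bf t.2.2)).2) ≠ t.2.1)
      ≤ ∑ ω, p ω * ∑ v, κ (yf ω) v * ind (dX (φ v) (xf ω) ≠ v)
        + ∑ m, PM m * ∑ ω, W (cb₀ m) ω * ind (dB (bf ω) ≠ m) := by
    rw [sum_codeWeight p yf κ W cb fun ω k ω₂ =>
      ind ((dX ((φ k.1).1, (dB (bf ω₂)).1) (xf ω), (dB (bf ω₂)).2) ≠ k), hPMsum,
      ← hsum1 fun v ω => ind (dX (φ v) (xf ω) ≠ v), ← Finset.sum_add_distrib]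
    refine Finset.sum_le_sum fun k _ => ?_
    rw [← Finset.sum_add_distrib]
    refine Finset.sum_le_sum fun ω _ => ?_
    rw [← mul_add, Fintype.card_fin]
    refine mul_le_mul_of_nonneg_left ?_
      (mul_nonneg (hp ω) (mul_nonneg (hκ _ _) (by positivity)))
    rw [← one_mul (ind (dX (φ k.1) (xf ω) ≠ k.1)), ← hW1 (cb k), Finset.sum_mul,
      ← Finset.sum_add_distrib]
    refine Finset.sum_le_sum fun ω₂ _ => ?_
    rw [← mul_add]
    refine mul_le_mul_of_nonneg_left (ind_or_le fun h => ?_) (hW _ _)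
    by_contra! hc
    obtain ⟨h1, h2⟩ := hc
    refine h ?_
    rw [h2]
    exact Prod.ext h1 rfl
  have hη' : ∑ t, codeWeight p yf (binKernel (fun v => (φ v).1) κ f) W cb t *
      ind ((dX (f, (dB (bf t.2.2)).1) (xf t.1), (dB (bf t.2.2)).2) ≠ t.2.1)
        + secDist (fun t : Ω × (V × Fin NU) × Ω₂ => s t.2.1) (fun t => (zf t.1, cf t.2.2))
          (codeWeight p yf (binKernel (fun v => (φ v).1) κ f) W cb) ≤ η := by
    refine le_trans (hf.trans ?_) hη
    rw [hsec]
    have : (Fintype.card (Fin NG × Fin NU) : ℝ) = NG * NU := by simp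
    rw [this] at hcb
    linarith
  set κ' := binKernel (fun v => (φ v).1) κ f
  have hκ' : ∀ y v, 0 ≤ κ' y v := fun y v => binKernel_nonneg _ hκ f y v
  set dA : X → B → V × Fin NU := fun x b => (dX (f, (dB b).1) x, (dB b).2)
  obtain ⟨ψ, hψ⟩ := exists_bob_estimate hp hκ' hW xf yf bf cb dA
  have hw : ∀ t, 0 ≤ codeWeight p yf κ' W cb t := fun t =>
    mul_nonneg (mul_nonneg (hp _) (mul_nonneg (hκ' _ _) (by positivity))) (hW _ _)
  have hsec0 : 0 ≤ secDist (fun t : Ω × (V × Fin NU) × Ω₂ => s t.2.1)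
      (fun t => (zf t.1, cf t.2.2)) (codeWeight p yf κ' W cb) :=
    Finset.sum_nonneg fun _ _ => Finset.sum_nonneg fun _ _ => abs_nonneg _
  have herr0 : 0 ≤ ∑ t, codeWeight p yf κ' W cb t * ind (dA (xf t.1) (bf t.2.2) ≠ t.2.1) :=
    Finset.sum_nonneg fun t _ => mul_nonneg (hw t) (ind_nonneg _)
  refine ⟨κ', cb, fun x b => s (dA x b), fun y a => s (ψ y a), hκ', sum_binKernel _ hκ1 f, ?_, ?_⟩
  · calc ∑ t, codeWeight p yf κ' W cb t
          * ind (s (ψ (yf t.1) (cb t.2.1)) ≠ s (dA (xf t.1) (bf t.2.2)))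
        ≤ ∑ t, codeWeight p yf κ' W cb t * (ind (ψ (yf t.1) (cb t.2.1) ≠ t.2.1)
          + ind (dA (xf t.1) (bf t.2.2) ≠ t.2.1)) := by
          refine Finset.sum_le_sum fun t _ => mul_le_mul_of_nonneg_left
            (ind_or_le fun h => ?_) (hw t)
          by_contra! hc
          exact h (by rw [hc.1, hc.2])
      _ ≤ 3 * η := by
          simp only [mul_add, Finset.sum_add_distrib]
          linarith
  · refine (secDist_le_of_key _ (fun t : Ω × (V × Fin NU) × Ω₂ => s t.2.1) _ hw).trans ?_
    have : ∑ t, codeWeight p yf κ' W cb t * ind (s (dA (xf t.1) (bf t.2.2)) ≠ s t.2.1)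
        ≤ ∑ t, codeWeight p yf κ' W cb t * ind (dA (xf t.1) (bf t.2.2) ≠ t.2.1) :=
      Finset.sum_le_sum fun t _ => mul_le_mul_of_nonneg_left
        (ind_le_ind fun h h' => h (by rw [h'])) (hw t)
    linarith

/-! ### Memoryless extensions -/

lemma sum_arrow_prod {ι α β R : Type*} [Fintype ι] [DecidableEq ι] [Fintype α] [Fintype β]
    [AddCommMonoid R] (F : (ι → α × β) → R) :
    ∑ f, F f = ∑ a : ι → α, ∑ b : ι → β, F fun i => (a i, b i) := by
  rw [← Fintype.sum_prod_type' fun (a : ι → α) (b : ι → β) => F fun i => (a i, b i)]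
  exact Fintype.sum_equiv (Equiv.arrowProdEquivProdArrow ι (fun _ => α) (fun _ => β)) _ _
    fun f => rfl

lemma ind_funext {ι α : Type*} [Fintype ι] (f g : ι → α) :
    ind (f = g) = ∏ i, ind (f i = g i) := by
  by_cases h : f = g
  · simp [h, ind_of]
  · obtain ⟨i, hi⟩ := Function.ne_iff.1 h
    rw [ind_not h, Finset.prod_eq_zero (Finset.mem_univ i) (ind_not hi)]

/-- Chebyshev's inequality for sums of independent, identically distributed variables. -/
lemma sum_prod_mul_ind_le {Ω : Type*} [Fintype Ω] {w : Ω → ℝ} (hw : ∀ ω, 0 ≤ w ω)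
    (hw1 : ∑ ω, w ω = 1) (g : Ω → ℝ) {n : ℕ} {t : ℝ} (ht : 0 < t) {E : (Fin n → Ω) → Prop}
    (hE : ∀ ω, (∀ i, 0 < w (ω i)) → E ω →
      t ≤ |∑ i, g (ω i) - n * ∑ x, w x * g x|) :
    ∑ ω : Fin n → Ω, (∏ i, w (ω i)) * ind (E ω)
      ≤ n * (∑ x, w x * (g x - ∑ y, w y * g y) ^ 2) / t ^ 2 := by
  set m := ∑ x, w x * g x with hm
  set h : Ω → ℝ := fun x => g x - m with hh
  have hw1' : ∀ _i : Fin n, ∑ ω, w ω = 1 := fun _ => hw1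
  have hmean : ∑ x, w x * h x = 0 := by
    simp only [hh, mul_sub, Finset.sum_sub_distrib, ← Finset.sum_mul, hw1, one_mul]
    rw [← hm, sub_self]
  have hsq : ∑ ω : Fin n → Ω, (∏ i, w (ω i)) * (∑ i, h (ω i)) ^ 2 = n * ∑ x, w x * h x ^ 2 := by
    have e : ∀ ω : Fin n → Ω, (∏ i, w (ω i)) * (∑ i, h (ω i)) ^ 2
        = ∑ i, ∑ j, (∏ i, w (ω i)) * (h (ω i) * h (ω j)) := by
      intro ω
      rw [pow_two, Finset.sum_mul_sum, Finset.mul_sum]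
      exact Finset.sum_congr rfl fun i _ => by rw [Finset.mul_sum]
    simp only [e]
    rw [Finset.sum_comm]
    have e2 : ∀ i : Fin n, ∑ ω : Fin n → Ω, ∑ j, (∏ i, w (ω i)) * (h (ω i) * h (ω j))
        = ∑ x, w x * h x ^ 2 := by
      intro i
      rw [Finset.sum_comm, Finset.sum_eq_single i]
      · rw [← sum_pi_apply (q := fun _ => w) hw1' i fun x => h x ^ 2]
        exact Finset.sum_congr rfl fun ω _ => by rw [pow_two]
      · intro j _ hj
        rw [sum_pi_apply₂ (q := fun _ => w) hw1' (Ne.symm hj) h h, hmean, zero_mul]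
      · simp
    simp only [e2]
    simp
  rw [le_div_iff₀ (by positivity), ← hsq, Finset.sum_mul]
  refine Finset.sum_le_sum fun ω _ => ?_
  have hp : 0 ≤ ∏ i, w (ω i) := Finset.prod_nonneg fun i _ => hw _
  rw [mul_assoc]
  by_cases hpos : ∀ i, 0 < w (ω i)
  · refine mul_le_mul_of_nonneg_left ?_ hp
    by_cases hc : E ω
    · rw [ind_of hc, one_mul, ← sq_abs (∑ i, h (ω i))]
      have := hE ω hpos hc
      have e : ∑ i, h (ω i) = ∑ i, g (ω i) - n * m := by
        simp [hh, Finset.sum_sub_distrib]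
      rw [e]
      gcongr
    · rw [ind_not hc, zero_mul]; positivity
  · push Not at hpos
    obtain ⟨i, hi⟩ := hpos
    rw [Finset.prod_eq_zero (Finset.mem_univ i) (le_antisymm hi (hw _))]
    simp

lemma sum_prod_mul_ind_gt_le {Ω : Type*} [Fintype Ω] {w : Ω → ℝ} (hw : ∀ ω, 0 ≤ w ω)
    (hw1 : ∑ ω, w ω = 1) {r : Ω → ℝ} (hr : ∀ ω, 0 < w ω → 0 < r ω) {n : ℕ} {t : ℝ}
    (ht : 0 < t) {E : (Fin n → Ω) → Prop}
    (hE : ∀ ω, (∀ i, 0 < w (ω i)) → E ω →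
      (2 : ℝ) ^ (n * ∑ x, w x * Real.logb 2 (r x) + t) < ∏ i, r (ω i)) :
    ∑ ω : Fin n → Ω, (∏ i, w (ω i)) * ind (E ω)
      ≤ n * (∑ x, w x * (Real.logb 2 (r x) - ∑ y, w y * Real.logb 2 (r y)) ^ 2) / t ^ 2 := by
  refine sum_prod_mul_ind_le hw hw1 _ ht fun ω h1 h2 => ?_
  have h3 := Real.logb_lt_logb one_lt_two (by positivity) (hE ω h1 h2)
  rw [Real.logb_rpow (by norm_num) (by norm_num),
    Real.logb_prod _ _ fun i _ => (hr _ (h1 i)).ne'] at h3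
  exact le_trans (by linarith) (le_abs_self _)

lemma sum_prod_mul_ind_lt_le {Ω : Type*} [Fintype Ω] {w : Ω → ℝ} (hw : ∀ ω, 0 ≤ w ω)
    (hw1 : ∑ ω, w ω = 1) {r : Ω → ℝ} (hr : ∀ ω, 0 < w ω → 0 < r ω) {n : ℕ} {t : ℝ}
    (ht : 0 < t) {E : (Fin n → Ω) → Prop}
    (hE : ∀ ω, (∀ i, 0 < w (ω i)) → E ω →
      ∏ i, r (ω i) < (2 : ℝ) ^ (n * ∑ x, w x * Real.logb 2 (r x) - t)) :
    ∑ ω : Fin n → Ω, (∏ i, w (ω i)) * ind (E ω)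
      ≤ n * (∑ x, w x * (Real.logb 2 (r x) - ∑ y, w y * Real.logb 2 (r y)) ^ 2) / t ^ 2 := by
  refine sum_prod_mul_ind_le hw hw1 _ ht fun ω h1 h2 => ?_
  have h3 := Real.logb_lt_logb one_lt_two (Finset.prod_pos fun i _ => hr _ (h1 i)) (hE ω h1 h2)
  rw [Real.logb_rpow (by norm_num) (by norm_num),
    Real.logb_prod _ _ fun i _ => (hr _ (h1 i)).ne'] at h3
  exact le_trans (by linarith) (neg_le_abs _)

/-! ### Sizes of the code -/

lemma exists_sizes {a b g u s c z : ℝ} {ε : ℝ} (hε : 0 < ε) (ha : 0 ≤ a) (hg : g = b - a + 4 * ε)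
    (hba : a ≤ b) (hu : 0 < u) (huc : u + g + 2 * ε ≤ c) (k : ℕ) :
    ∃ NF NG NU NS : ℕ, 0 < NF ∧ 0 < NG ∧ 0 < NU ∧ 0 < NS ∧
      (2 : ℝ) ^ (k * s) ≤ NS ∧
      ((NF : ℝ) - 1) * 2 ^ (-(k * a) + ε * k) ≤ 2 ^ (-(ε * k)) ∧
      1 / ((NF : ℝ) * NG) / 2 ^ (-(k * b) - ε * k) ≤ 2 ^ (-(ε * k)) ∧
      (NG : ℝ) * NU / 2 ^ (k * c - ε * k) ≤ 2 * 2 ^ (-(ε * k)) ∧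
      (∀ i : ℝ, s + z + i + a - u + 3 * ε ≤ 0 →
        ((NS : ℝ) - 1) * (2 ^ (k * z + ε * k) * 2 ^ (k * i + ε * k) * NF / NU)
          ≤ 4 * 2 ^ (-(ε * k))) ∧
      (s + z + g + a + 2 * ε ≤ 0 →
        ((NS : ℝ) - 1) * (2 ^ (k * z + ε * k) * (NG * NU) * NF / NU) ≤ 4 * 2 ^ (-(ε * k))) := by
  have h2 : (0 : ℝ) < 2 := by norm_num
  have hk : (0 : ℝ) ≤ k := Nat.cast_nonneg k
  have hεk : 0 ≤ ε * k := by positivity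
  have hle : ∀ {x y : ℝ}, x ≤ y → (2 : ℝ) ^ x ≤ 2 ^ y := fun h =>
    Real.rpow_le_rpow_of_exponent_le (by norm_num) h
  have hone : ∀ {x : ℝ}, 0 ≤ x → (1 : ℝ) ≤ 2 ^ x := fun h => Real.one_le_rpow (by norm_num) h
  have hceil : ∀ x : ℝ, 0 < ⌈(2 : ℝ) ^ x⌉₊ := fun x => Nat.ceil_pos.2 (by positivity)
  have hceil1 : ∀ x : ℝ, (⌈(2 : ℝ) ^ x⌉₊ : ℝ) - 1 ≤ 2 ^ x := fun x => by
    have := Nat.ceil_lt_add_one (a := (2 : ℝ) ^ x) (by positivity)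
    linarith
  have hceil2 : ∀ {x y : ℝ}, x ≤ y → 0 ≤ y → (⌈(2 : ℝ) ^ x⌉₊ : ℝ) ≤ 2 * 2 ^ y :=
      fun {x y} h h0 => by
    linarith [hceil1 x, hle h, hone h0]
  set NF := ⌈(2 : ℝ) ^ (k * (a - 2 * ε))⌉₊
  set NG := ⌈(2 : ℝ) ^ (k * g)⌉₊
  set NU := ⌊(2 : ℝ) ^ (k * u)⌋₊
  set NS := ⌈(2 : ℝ) ^ (k * s)⌉₊
  have hNU : 0 < NU := Nat.floor_pos.2 (hone (by positivity))
  have hNUR : (0 : ℝ) < NU := by exact_mod_cast hNU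
  have hNU1 : (NU : ℝ) ≤ 2 ^ (k * u) := Nat.floor_le (by positivity)
  have hNU2 : (2 : ℝ) ^ (k * u) ≤ 2 * NU := by
    have h1 := Nat.lt_floor_add_one ((2 : ℝ) ^ (k * u))
    have h3 : (1 : ℝ) ≤ NU := by exact_mod_cast hNU
    have : (⌊(2 : ℝ) ^ (k * u)⌋₊ : ℝ) = NU := rfl
    linarith
  have hNF : (NF : ℝ) ≤ 2 * 2 ^ (k * a) := hceil2 (by nlinarith) (by positivity)
  have hNG : (NG : ℝ) ≤ 2 * 2 ^ (k * g) := hceil2 le_rfl (mul_nonneg hk (by linarith))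
  have hNS : (NS : ℝ) - 1 ≤ 2 ^ (k * s) := hceil1 _
  have hNS0 : (0 : ℝ) ≤ (NS : ℝ) - 1 := by
    have : (1 : ℝ) ≤ NS := by exact_mod_cast hceil _
    linarith
  refine ⟨NF, NG, NU, NS, hceil _, hceil _, hNU, hceil _, Nat.le_ceil _, ?_, ?_, ?_, ?_, ?_⟩
  · calc ((NF : ℝ) - 1) * 2 ^ (-(k * a) + ε * k)
        ≤ 2 ^ (k * (a - 2 * ε)) * 2 ^ (-(k * a) + ε * k) := by
          gcongr; exact hceil1 _
      _ = 2 ^ (-(ε * k)) := by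
          rw [← Real.rpow_add h2]; congr 1; ring
  · have h1 : (2 : ℝ) ^ (k * (a - 2 * ε)) * 2 ^ (k * g) ≤ NF * NG := by
      gcongr <;> exact Nat.le_ceil _
    calc 1 / ((NF : ℝ) * NG) / 2 ^ (-(k * b) - ε * k)
        ≤ 1 / (2 ^ (k * (a - 2 * ε)) * 2 ^ (k * g)) / 2 ^ (-(k * b) - ε * k) := by
          gcongr
      _ = 2 ^ (-(ε * k)) := by
          rw [div_div, ← Real.rpow_add h2, ← Real.rpow_add h2, one_div, ← Real.rpow_neg h2.le]
          congr 1; rw [hg]; ring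
  · calc (NG : ℝ) * NU / 2 ^ (k * c - ε * k)
        ≤ 2 * 2 ^ (k * g) * 2 ^ (k * u) / 2 ^ (k * c - ε * k) := by gcongr
      _ = 2 * 2 ^ (k * g + k * u - (k * c - ε * k)) := by
          rw [Real.rpow_sub h2 (k * g + k * u), Real.rpow_add h2 (k * g)]; ring
      _ ≤ 2 * 2 ^ (-(ε * k)) := by
          refine mul_le_mul_of_nonneg_left (hle ?_) (by norm_num)
          nlinarith
  · intro i hi
    calc ((NS : ℝ) - 1) * (2 ^ (k * z + ε * k) * 2 ^ (k * i + ε * k) * NF / NU)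
        ≤ 2 ^ (k * s) * (2 ^ (k * z + ε * k) * 2 ^ (k * i + ε * k) * (2 * 2 ^ (k * a))
          / (2 ^ (k * u) / 2)) := by
          gcongr
          linarith
      _ = 4 * 2 ^ (k * s + (k * z + ε * k) + (k * i + ε * k) + k * a - k * u) := by
          rw [Real.rpow_sub h2 (k * s + (k * z + ε * k) + (k * i + ε * k) + k * a),
            Real.rpow_add h2 (k * s + (k * z + ε * k) + (k * i + ε * k)),
            Real.rpow_add h2 (k * s + (k * z + ε * k)), Real.rpow_add h2 (k * s)]
          rw [div_div_eq_mul_div]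
          ring
      _ ≤ _ := by
          refine mul_le_mul_of_nonneg_left (hle ?_) (by norm_num)
          nlinarith
  · intro hi
    calc ((NS : ℝ) - 1) * (2 ^ (k * z + ε * k) * (NG * NU) * NF / NU)
        = ((NS : ℝ) - 1) * (2 ^ (k * z + ε * k) * NG * NF) := by
          field_simp
      _ ≤ 2 ^ (k * s) * (2 ^ (k * z + ε * k) * (2 * 2 ^ (k * g)) * (2 * 2 ^ (k * a))) := by
          gcongr
      _ = 4 * 2 ^ (k * s + (k * z + ε * k) + k * g + k * a) := by
          rw [Real.rpow_add h2 (k * s + (k * z + ε * k) + k * g),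
            Real.rpow_add h2 (k * s + (k * z + ε * k)), Real.rpow_add h2 (k * s)]
          ring
      _ ≤ _ := by
          refine mul_le_mul_of_nonneg_left (hle ?_) (by norm_num)
          nlinarith

/-! ### Block codes -/

section Single

variable {X Y Z V A B C : Type*} [Fintype X] [Fintype Y] [Fintype Z] [Fintype V]
  [Fintype A] [Fintype B] [Fintype C]

/-- Joint weight of `(x, (y, z), v)`. -/
def jointW (pX : X → ℝ) (W : X → Y × Z → ℝ) (κ : Y → V → ℝ) (t : X × (Y × Z) × V) : ℝ :=
  pX t.1 * W t.1 t.2.1 * κ t.2.1.1 t.2.2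

/-- `P(v | x)` -/
def condVX (W : X → Y × Z → ℝ) (κ : Y → V → ℝ) (v : V) (x : X) : ℝ := ∑ o, W x o * κ o.1 v

/-- `P(z)` -/
def margZ (pX : X → ℝ) (W : X → Y × Z → ℝ) (z : Z) : ℝ := ∑ x, ∑ o, pX x * W x o * ind (o.2 = z)

/-- `P(v, z)` -/
def margVZ (pX : X → ℝ) (W : X → Y × Z → ℝ) (κ : Y → V → ℝ) (v : V) (z : Z) : ℝ :=
  ∑ x, ∑ o, pX x * W x o * κ o.1 v * ind (o.2 = z)

/-- `P(v | z)` -/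
def condVZ (pX : X → ℝ) (W : X → Y × Z → ℝ) (κ : Y → V → ℝ) (v : V) (z : Z) : ℝ :=
  margVZ pX W κ v z / margZ pX W z

/-- `P(π(b, c) | a)` -/
def outW {S : Type*} (W : A → B × C → ℝ) (π : B × C → S) (a : A) (s : S) : ℝ :=
  ∑ o, W a o * ind (π o = s)

/-- `P(π(b, c))` -/
def outQ {S : Type*} (q : A → ℝ) (W : A → B × C → ℝ) (π : B × C → S) (s : S) : ℝ :=
  ∑ a, q a * outW W π a s

/-- `P(π(b, c) | a) / P(π(b, c))` -/
def outR {S : Type*} (q : A → ℝ) (W : A → B × C → ℝ) (π : B × C → S) (a : A) (s : S) : ℝ :=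
  outW W π a s / outQ q W π s

variable {pX : X → ℝ} {W : X → Y × Z → ℝ} {κ : Y → V → ℝ} {q : A → ℝ} {W₂ : A → B × C → ℝ}

lemma jointW_nonneg (hp : ∀ x, 0 ≤ pX x) (hW : ∀ x o, 0 ≤ W x o) (hκ : ∀ y v, 0 ≤ κ y v)
    (t : X × (Y × Z) × V) : 0 ≤ jointW pX W κ t :=
  mul_nonneg (mul_nonneg (hp _) (hW _ _)) (hκ _ _)

lemma sum_jointW (hp1 : ∑ x, pX x = 1) (hW1 : ∀ x, ∑ o, W x o = 1)
    (hκ1 : ∀ y, ∑ v, κ y v = 1) : ∑ t, jointW pX W κ t = 1 := by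
  have h1 : ∀ x, ∑ t : (Y × Z) × V, jointW pX W κ (x, t) = pX x := fun x => by
    rw [Fintype.sum_prod_type]
    simp only [jointW, ← Finset.mul_sum, hκ1, mul_one, hW1]
  rw [Fintype.sum_prod_type]
  simp only [h1, hp1]

lemma sum_condVX (hW1 : ∀ x, ∑ o, W x o = 1) (hκ1 : ∀ y, ∑ v, κ y v = 1) (x : X) :
    ∑ v, condVX W κ v x = 1 := by
  simp only [condVX]
  rw [Finset.sum_comm]
  simp only [← Finset.mul_sum, hκ1, mul_one, hW1]

lemma condVX_nonneg (hW : ∀ x o, 0 ≤ W x o) (hκ : ∀ y v, 0 ≤ κ y v) (v : V) (x : X) :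
    0 ≤ condVX W κ v x := Finset.sum_nonneg fun _ _ => mul_nonneg (hW _ _) (hκ _ _)

lemma margZ_nonneg (hp : ∀ x, 0 ≤ pX x) (hW : ∀ x o, 0 ≤ W x o) (z : Z) : 0 ≤ margZ pX W z :=
  Finset.sum_nonneg fun _ _ => Finset.sum_nonneg fun _ _ =>
    mul_nonneg (mul_nonneg (hp _) (hW _ _)) (ind_nonneg _)

lemma margVZ_nonneg (hp : ∀ x, 0 ≤ pX x) (hW : ∀ x o, 0 ≤ W x o) (hκ : ∀ y v, 0 ≤ κ y v)
    (v : V) (z : Z) : 0 ≤ margVZ pX W κ v z :=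
  Finset.sum_nonneg fun _ _ => Finset.sum_nonneg fun _ _ =>
    mul_nonneg (mul_nonneg (mul_nonneg (hp _) (hW _ _)) (hκ _ _)) (ind_nonneg _)

lemma sum_margZ (hp1 : ∑ x, pX x = 1) (hW1 : ∀ x, ∑ o, W x o = 1) : ∑ z, margZ pX W z = 1 := by
  simp only [margZ]
  rw [Finset.sum_comm]
  rw [← hp1]
  refine Finset.sum_congr rfl fun x _ => ?_
  rw [Finset.sum_comm]
  simp only [← Finset.mul_sum, sum_ind_eq, mul_one, hW1]

lemma sum_margVZ (hκ1 : ∀ y, ∑ v, κ y v = 1) (z : Z) : ∑ v, margVZ pX W κ v z = margZ pX W z := by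
  simp only [margVZ, margZ]
  rw [Finset.sum_comm]
  refine Finset.sum_congr rfl fun x _ => ?_
  rw [Finset.sum_comm]
  refine Finset.sum_congr rfl fun o _ => ?_
  simp only [← Finset.mul_sum, ← Finset.sum_mul, hκ1, mul_one]

lemma condVZ_mul (hp : ∀ x, 0 ≤ pX x) (hW : ∀ x o, 0 ≤ W x o) (hκ : ∀ y v, 0 ≤ κ y v)
    (hκ1 : ∀ y, ∑ v, κ y v = 1) (v : V) (z : Z) :
    condVZ pX W κ v z * margZ pX W z = margVZ pX W κ v z := by
  by_cases h : margZ pX W z = 0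
  · rw [h, mul_zero]
    rw [← sum_margVZ hκ1] at h
    exact ((Finset.sum_eq_zero_iff_of_nonneg fun v' _ => margVZ_nonneg hp hW hκ v' z).1 h v
      (Finset.mem_univ v)).symm
  · exact div_mul_cancel₀ _ h

lemma pos_of_jointW_pos (hp : ∀ x, 0 ≤ pX x) (hW : ∀ x o, 0 ≤ W x o) (hκ : ∀ y v, 0 ≤ κ y v)
    {t : X × (Y × Z) × V} (ht : 0 < jointW pX W κ t) :
    0 < pX t.1 ∧ 0 < W t.1 t.2.1 ∧ 0 < κ t.2.1.1 t.2.2 := by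
  unfold jointW at ht
  refine ⟨(hp _).lt_of_ne' ?_, (hW _ _).lt_of_ne' ?_, (hκ _ _).lt_of_ne' ?_⟩ <;> intro h <;>
    simp [h] at ht

lemma condVX_pos (hp : ∀ x, 0 ≤ pX x) (hW : ∀ x o, 0 ≤ W x o) (hκ : ∀ y v, 0 ≤ κ y v)
    {t : X × (Y × Z) × V} (ht : 0 < jointW pX W κ t) : 0 < condVX W κ t.2.2 t.1 := by
  obtain ⟨-, h2, h3⟩ := pos_of_jointW_pos hp hW hκ ht
  exact Finset.sum_pos' (fun o _ => mul_nonneg (hW _ _) (hκ _ _))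
    ⟨t.2.1, Finset.mem_univ _, mul_pos h2 h3⟩

lemma margVZ_pos (hp : ∀ x, 0 ≤ pX x) (hW : ∀ x o, 0 ≤ W x o) (hκ : ∀ y v, 0 ≤ κ y v)
    {t : X × (Y × Z) × V} (ht : 0 < jointW pX W κ t) :
    0 < margVZ pX W κ t.2.2 t.2.1.2 := by
  have h0 : ∀ x o, 0 ≤ pX x * W x o * κ o.1 t.2.2 * ind (o.2 = t.2.1.2) := fun x o =>
    mul_nonneg (mul_nonneg (mul_nonneg (hp _) (hW _ _)) (hκ _ _)) (ind_nonneg _)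
  refine Finset.sum_pos' (fun x _ => Finset.sum_nonneg fun o _ => h0 x o)
    ⟨t.1, Finset.mem_univ _, Finset.sum_pos' (fun o _ => h0 _ o) ⟨t.2.1, Finset.mem_univ _, ?_⟩⟩
  rw [ind_of rfl, mul_one]
  exact ht

lemma margZ_pos (hp : ∀ x, 0 ≤ pX x) (hW : ∀ x o, 0 ≤ W x o) (hκ : ∀ y v, 0 ≤ κ y v)
    (hκ1 : ∀ y, ∑ v, κ y v = 1)
    {t : X × (Y × Z) × V} (ht : 0 < jointW pX W κ t) : 0 < margZ pX W t.2.1.2 := by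
  rw [← sum_margVZ hκ1]
  exact Finset.sum_pos' (fun v _ => margVZ_nonneg hp hW hκ v _)
    ⟨t.2.2, Finset.mem_univ _, margVZ_pos hp hW hκ ht⟩

section out

variable {S : Type*}

lemma outW_nonneg (hW₂ : ∀ a o, 0 ≤ W₂ a o) (π : B × C → S) (a : A) (s : S) :
    0 ≤ outW W₂ π a s := Finset.sum_nonneg fun _ _ => mul_nonneg (hW₂ _ _) (ind_nonneg _)

lemma outQ_nonneg (hq : ∀ a, 0 ≤ q a) (hW₂ : ∀ a o, 0 ≤ W₂ a o) (π : B × C → S) (s : S) :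
    0 ≤ outQ q W₂ π s :=
  Finset.sum_nonneg fun _ _ => mul_nonneg (hq _) (outW_nonneg hW₂ _ _ _)

lemma sum_outW [Fintype S] (hW₂1 : ∀ a, ∑ o, W₂ a o = 1) (π : B × C → S) (a : A) :
    ∑ s, outW W₂ π a s = 1 := by
  simp only [outW]
  rw [Finset.sum_comm]
  simp only [← Finset.mul_sum, sum_ind_eq, mul_one, hW₂1]

lemma sum_outQ [Fintype S] (hq1 : ∑ a, q a = 1) (hW₂1 : ∀ a, ∑ o, W₂ a o = 1) (π : B × C → S) :
    ∑ s, outQ q W₂ π s = 1 := by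
  simp only [outQ]
  rw [Finset.sum_comm]
  simp only [← Finset.mul_sum, sum_outW hW₂1, mul_one, hq1]

lemma outW_pos (hW₂ : ∀ a o, 0 ≤ W₂ a o) (π : B × C → S) {a : A} {o : B × C}
    (h : 0 < W₂ a o) : 0 < outW W₂ π a (π o) :=
  Finset.sum_pos' (fun _ _ => mul_nonneg (hW₂ _ _) (ind_nonneg _))
    ⟨o, Finset.mem_univ _, by rw [ind_of rfl, mul_one]; exact h⟩

lemma outQ_pos (hq : ∀ a, 0 ≤ q a) (hW₂ : ∀ a o, 0 ≤ W₂ a o) (π : B × C → S) {a : A} {s : S}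
    (h : 0 < q a) (h' : 0 < outW W₂ π a s) : 0 < outQ q W₂ π s :=
  Finset.sum_pos' (fun _ _ => mul_nonneg (hq _) (outW_nonneg hW₂ _ _ _))
    ⟨a, Finset.mem_univ _, mul_pos h h'⟩

end out

/-! Reindexing of the block laws. -/

/-- Law of the input and output sequences for independent, identically distributed inputs. -/
def blockW (pX : X → ℝ) (W : X → Y × Z → ℝ) {n : ℕ} (t : (Fin n → X) × (Fin n → Y × Z)) : ℝ :=
  (∏ i, pX (t.1 i)) * ∏ i, W (t.1 i) (t.2 i)

lemma sum_blockW_kernel {n : ℕ} (pX : X → ℝ) (W : X → Y × Z → ℝ) (κ : Y → V → ℝ)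
    (F : (Fin n → X) → (Fin n → Y × Z) → (Fin n → V) → ℝ) :
    ∑ t, blockW pX W t * ∑ v : Fin n → V, (∏ i, κ (t.2 i).1 (v i)) * F t.1 t.2 v
      = ∑ f : Fin n → X × (Y × Z) × V, (∏ i, jointW pX W κ (f i)) *
        F (fun i => (f i).1) (fun i => (f i).2.1) (fun i => (f i).2.2) := by
  rw [sum_arrow_prod (α := X) (β := (Y × Z) × V), Fintype.sum_prod_type]
  refine Finset.sum_congr rfl fun x _ => ?_
  rw [sum_arrow_prod (α := Y × Z) (β := V)]
  refine Finset.sum_congr rfl fun o _ => ?_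
  rw [Finset.mul_sum]
  refine Finset.sum_congr rfl fun v _ => ?_
  simp only [jointW, blockW, Finset.prod_mul_distrib]
  ring

lemma sum_blockW {n : ℕ} (pX : X → ℝ) (W : X → Y × Z → ℝ)
    (F : (Fin n → X) → (Fin n → Y × Z) → ℝ) :
    ∑ t, blockW pX W t * F t.1 t.2
      = ∑ f : Fin n → X × (Y × Z), (∏ i, pX (f i).1 * W (f i).1 (f i).2) *
        F (fun i => (f i).1) (fun i => (f i).2) := by
  rw [sum_arrow_prod, Fintype.sum_prod_type]
  simp only [blockW, Finset.prod_mul_distrib]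

lemma sum_block_out {n : ℕ} {S : Type*} (W : A → B × C → ℝ) (π : B × C → S) (a : Fin n → A)
    (s : Fin n → S) :
    ∑ o : Fin n → B × C, (∏ i, W (a i) (o i)) * ind ((fun i => π (o i)) = s)
      = ∏ i, outW W π (a i) (s i) := by
  simp only [outW, ← sum_pi_prod, ind_funext, Finset.prod_mul_distrib]

end Single

lemma tendsto_error_bound (c₁ c₂ c₃ c₄ c₅ : ℝ) {ε : ℝ} (hε : 0 < ε) :
    Tendsto (fun k : ℕ => 3 * (2 * (c₁ / k) + √((2 : ℝ) ^ (-(ε * k))))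
        + (c₂ / k + (2 : ℝ) ^ (-(ε * k)))
        + (c₃ / k + 2 * (2 : ℝ) ^ (-(ε * k)) + 2 * (c₄ / k))
        + (2 * (c₅ / k) + √(4 * (2 : ℝ) ^ (-(ε * k))))) atTop (𝓝 0) := by
  have h1 : ∀ c : ℝ, Tendsto (fun k : ℕ => c / k) atTop (𝓝 0) := fun c =>
    tendsto_const_div_atTop_nhds_zero_nat c
  have h2 : Tendsto (fun k : ℕ => (2 : ℝ) ^ (-(ε * k))) atTop (𝓝 0) := by
    have : ∀ k : ℕ, (2 : ℝ) ^ (-(ε * k)) = ((2 : ℝ) ^ (-ε)) ^ k := fun k => by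
      rw [← Real.rpow_natCast, ← Real.rpow_mul (by norm_num), neg_mul]
    simp only [this]
    exact tendsto_pow_atTop_nhds_zero_of_lt_one (by positivity)
      (Real.rpow_lt_one_of_one_lt_of_neg (by norm_num) (by linarith))
  have h3 : ∀ c : ℝ, Tendsto (fun k : ℕ => √(c * (2 : ℝ) ^ (-(ε * k)))) atTop (𝓝 0) := fun c => by
    have := (h2.const_mul c).sqrt
    simpa using this
  have h4 := ((((((h1 c₁).const_mul 2).add (by simpa using h3 1)).const_mul 3).add
    ((h1 c₂).add h2)).add (((h1 c₃).add (h2.const_mul 2)).add ((h1 c₄).const_mul 2))).add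
    (((h1 c₅).const_mul 2).add (h3 4))
  simpa using h4

/-- Mean of the logarithm of `r` under the weight `w`. -/
def meanLog {Ω : Type*} [Fintype Ω] (w r : Ω → ℝ) : ℝ := ∑ t, w t * Real.logb 2 (r t)

/-- Variance of the logarithm of `r` under the weight `w`. -/
def varLog {Ω : Type*} [Fintype Ω] (w r : Ω → ℝ) : ℝ :=
  ∑ t, w t * (Real.logb 2 (r t) - meanLog w r) ^ 2

theorem exists_block_one_shot {X Y Z V A B C : Type*} [Fintype X] [Fintype Y] [Fintype Z]
    [Fintype V] [Nonempty V] [Fintype A] [Fintype B] [Fintype C]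
    {pX : X → ℝ} {W : X → Y × Z → ℝ} {κ : Y → V → ℝ} {q : A → ℝ} {W₂ : A → B × C → ℝ}
    (hp : ∀ x, 0 ≤ pX x) (hp1 : ∑ x, pX x = 1) (hW : ∀ x o, 0 ≤ W x o)
    (hW1 : ∀ x, ∑ o, W x o = 1) (hκ : ∀ y v, 0 ≤ κ y v) (hκ1 : ∀ y, ∑ v, κ y v = 1)
    (hq : ∀ a, 0 ≤ q a) (hq1 : ∑ a, q a = 1) (hW₂ : ∀ a o, 0 ≤ W₂ a o)
    (hW₂1 : ∀ a, ∑ o, W₂ a o = 1) (n m : ℕ)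
    {NF NG NU NS : ℕ} (hF : 0 < NF) (hG : 0 < NG) (hU : 0 < NU) (hS : 0 < NS)
    {tY tX tZ γ τ εC : ℝ} (htY : 0 ≤ tY) (htX : 0 < tX) (htZ : 0 ≤ tZ) (hγ : 0 < γ) (hτ : 0 ≤ τ)
    {QC : (Fin NG × Fin NU → Fin m → A) → (Fin m → C) → ℝ} (hQC : ∀ cb c, 0 ≤ QC cb c)
    (hQC1 : ∀ cb, ∑ c, QC cb c ≤ 1)
    (hεC : ∀ l, ∑ cb : Fin NG × Fin NU → Fin m → A, (∏ j, ∏ i, q (cb j i)) *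
        ∑ c : Fin m → C, (∏ i, outW W₂ Prod.snd (cb l i) (c i)) *
          ind (τ * QC cb c < ∏ i, outW W₂ Prod.snd (cb l i) (c i)) ≤ εC)
    {η : ℝ} (hη : 3 * (2 * ∑ t : (Fin n → X) × (Fin n → Y × Z), blockW pX W t *
          ∑ v : Fin n → V, (∏ i, κ (t.2 i).1 (v i)) * ind (tY < ∏ i, κ (t.2 i).1 (v i))
          + √((NF - 1) * tY))
        + (∑ t : (Fin n → X) × (Fin n → Y × Z), blockW pX W t *
            ∑ v : Fin n → V, (∏ i, κ (t.2 i).1 (v i)) *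
              ind (∏ i, condVX W κ (v i) (t.1 i) < tX) + 1 / (NF * NG) / tX)
        + (∑ a : Fin m → A, (∏ i, q (a i)) * ∑ o : Fin m → B × C, (∏ i, W₂ (a i) (o i)) *
            ind (∏ i, outR q W₂ Prod.fst (a i) (o i).1 < γ) + NG * NU / γ + 2 * εC)
        + (2 * ∑ t : (Fin n → X) × (Fin n → Y × Z), blockW pX W t *
            ∑ v : Fin n → V, (∏ i, κ (t.2 i).1 (v i)) *
              ind (tZ < ∏ i, condVZ pX W κ (v i) (t.2 i).2)
          + √((NS - 1) * (tZ * τ * NF / NU))) ≤ η) :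
    ∃ (κ' : (Fin n → Y) → (Fin n → V) → ℝ) (cb : (Fin n → V) × Fin NU → Fin m → A)
      (sA : (Fin n → X) → (Fin m → B) → Fin NS) (sB : (Fin n → Y) → (Fin m → A) → Fin NS),
      (∀ y v, 0 ≤ κ' y v) ∧ (∀ y, ∑ v, κ' y v = 1) ∧
      ∑ t, codeWeight (blockW pX W) (fun t i => (t.2 i).1) κ'
          (fun a (o : Fin m → B × C) => ∏ i, W₂ (a i) (o i)) cb t
          * ind (sB (fun i => (t.1.2 i).1) (cb t.2.1) ≠ sA t.1.1 fun i => (t.2.2 i).1) ≤ 3 * η ∧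
      secDist (fun t : ((Fin n → X) × (Fin n → Y × Z)) ×
          ((Fin n → V) × Fin NU) × (Fin m → B × C) => sA t.1.1 fun i => (t.2.2 i).1)
        (fun t => ((fun i => (t.1.2 i).2 : Fin n → Z), (fun i => (t.2.2 i).2 : Fin m → C)))
        (codeWeight (blockW pX W) (fun t i => (t.2 i).1) κ'
          (fun a (o : Fin m → B × C) => ∏ i, W₂ (a i) (o i)) cb) ≤ 3 * η := by
  classical
  have b1 : ∀ t : (Fin n → X) × (Fin n → Y × Z), 0 ≤ blockW pX W t := fun t =>
    mul_nonneg (Finset.prod_nonneg fun i _ => hp _) (Finset.prod_nonneg fun i _ => hW _ _)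
  have b2 : ∑ t : (Fin n → X) × (Fin n → Y × Z), blockW pX W t = 1 := by
    rw [Fintype.sum_prod_type]
    have : ∀ x : Fin n → X, ∑ o : Fin n → Y × Z, blockW pX W (x, o) = ∏ i, pX (x i) := by
      intro x
      simp only [blockW, ← Finset.mul_sum]
      rw [sum_pi_prod_one (q := fun i => W (x i)) fun i => hW1 _, mul_one]
    simp only [this]
    exact sum_pi_prod_one (q := fun _ => pX) fun _ => hp1
  have b3 : ∀ (v : Fin n → V) (z : Fin n → Z), ∑ t : (Fin n → X) × (Fin n → Y × Z),
      blockW pX W t * (∏ i, κ (t.2 i).1 (v i)) * ind ((fun i => (t.2 i).2) = z)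
      = (∏ i, condVZ pX W κ (v i) (z i)) * ∏ i, margZ pX W (z i) := by
    intro v z
    rw [← Finset.prod_mul_distrib]
    simp only [condVZ_mul hp hW hκ hκ1, mul_assoc]
    rw [sum_blockW pX W fun x o => (∏ i, κ (o i).1 (v i)) * ind ((fun i => (o i).2) = z)]
    simp only [ind_funext, ← Finset.prod_mul_distrib]
    rw [sum_pi_prod fun (i : Fin n) (t : X × (Y × Z)) =>
      pX t.1 * W t.1 t.2 * (κ t.2.1 (v i) * ind (t.2.2 = z i))]
    refine Finset.prod_congr rfl fun i _ => ?_
    rw [Fintype.sum_prod_type]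
    simp only [margVZ, mul_assoc]
  have b4 : ∀ b : Fin m → B, ∑ a : Fin m → A,
      (∏ i, q (a i)) * ∏ i, outR q W₂ Prod.fst (a i) (b i) ≤ 1 := by
    intro b
    simp only [← Finset.prod_mul_distrib]
    rw [sum_pi_prod fun (i : Fin m) a => q a * outR q W₂ Prod.fst a (b i)]
    refine Finset.prod_le_one (fun i _ => Finset.sum_nonneg fun a _ => mul_nonneg (hq _)
      (div_nonneg (outW_nonneg hW₂ _ _ _) (outQ_nonneg hq hW₂ _ _))) fun i _ => ?_
    simp only [outR, ← mul_div_assoc]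
    rw [← Finset.sum_div]
    exact div_self_le_one _
  exact exists_one_shot (p := blockW pX W (n := n))
    (κ := fun (y : Fin n → Y) (v : Fin n → V) => ∏ i, κ (y i) (v i))
    (q := fun a : Fin m → A => ∏ i, q (a i))
    (W := fun a (o : Fin m → B × C) => ∏ i, W₂ (a i) (o i)) b1 b2
    (fun y v => Finset.prod_nonneg fun i _ => hκ _ _)
    (fun y => sum_pi_prod_one (q := fun i => κ (y i)) fun i => hκ1 _)
    (fun a => Finset.prod_nonneg fun i _ => hq _)
    (sum_pi_prod_one (q := fun _ => q) fun _ => hq1)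
    (fun a o => Finset.prod_nonneg fun i _ => hW₂ _ _)
    (fun a => sum_pi_prod_one (q := fun i => W₂ (a i)) fun i => hW₂1 _)
    (fun t => t.1) (fun t i => (t.2 i).1) (fun t i => (t.2 i).2)
    (fun o i => (o i).1) (fun o i => (o i).2)
    (rX := fun v x => ∏ i, condVX W κ (v i) (x i))
    (fun v x => Finset.prod_nonneg fun i _ => condVX_nonneg hW hκ _ _)
    (fun x => (sum_pi_prod_one (q := fun i v => condVX W κ v (x i))
      fun i => sum_condVX hW1 hκ1 _).le)
    (pZ := fun z => ∏ i, margZ pX W (z i))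
    (fun z => Finset.prod_nonneg fun i _ => margZ_nonneg hp hW _)
    (sum_pi_prod_one (q := fun _ => margZ pX W) fun _ => sum_margZ hp1 hW1).le
    (rZ := fun v z => ∏ i, condVZ pX W κ (v i) (z i))
    (fun v z => Finset.prod_nonneg fun i _ =>
      div_nonneg (margVZ_nonneg hp hW hκ _ _) (margZ_nonneg hp hW _)) b3
    (ρ := fun a b => ∏ i, outR q W₂ Prod.fst (a i) (b i))
    (fun a b => Finset.prod_nonneg fun i _ =>
      div_nonneg (outW_nonneg hW₂ _ _ _) (outQ_nonneg hq hW₂ _ _)) b4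
    (wC := fun a c => ∏ i, outW W₂ Prod.snd (a i) (c i))
    (fun a c => sum_block_out W₂ Prod.snd a c) hF hG hU hS
    htY htX htZ hγ hτ hQC hQC1 hεC hη

theorem exists_block_code {X Y Z V A B C : Type*} [Fintype X] [Fintype Y] [Fintype Z] [Fintype V]
    [Nonempty V] [Fintype A] [Fintype B] [Fintype C]
    {pX : X → ℝ} {W : X → Y × Z → ℝ} {κ : Y → V → ℝ} {q : A → ℝ} {W₂ : A → B × C → ℝ}
    (hp : ∀ x, 0 ≤ pX x) (hp1 : ∑ x, pX x = 1) (hW : ∀ x o, 0 ≤ W x o)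
    (hW1 : ∀ x, ∑ o, W x o = 1) (hκ : ∀ y v, 0 ≤ κ y v) (hκ1 : ∀ y, ∑ v, κ y v = 1)
    (hq : ∀ a, 0 ≤ q a) (hq1 : ∑ a, q a = 1) (hW₂ : ∀ a o, 0 ≤ W₂ a o)
    (hW₂1 : ∀ a, ∑ o, W₂ a o = 1) {mY mX mZ iB iC : ℝ}
    (hmY : mY = meanLog (jointW pX W κ) fun t => κ t.2.1.1 t.2.2)
    (hmX : mX = meanLog (jointW pX W κ) fun t => condVX W κ t.2.2 t.1)
    (hmZ : mZ = meanLog (jointW pX W κ) fun t => condVZ pX W κ t.2.2 t.2.1.2)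
    (hiB : iB = meanLog (fun t : A × (B × C) => q t.1 * W₂ t.1 t.2)
      fun t => outR q W₂ Prod.fst t.1 t.2.1)
    (hiC : iC = meanLog (fun t : A × (B × C) => q t.1 * W₂ t.1 t.2)
      fun t => outR q W₂ Prod.snd t.1 t.2.2)
    (hXY : mX ≤ mY) (nf nb : ℕ) (hcon : nf * (mY - mX) < nb * iB)
    {s : ℝ} (hs : s < nf * (mX - mZ) + nb * max (iB - iC) 0) {η : ℝ} (hη : 0 < η) :
    ∀ᶠ k : ℕ in atTop, ∃ (NU NS : ℕ) (κ' : (Fin (nf * k) → Y) → (Fin (nf * k) → V) → ℝ)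
      (cb : (Fin (nf * k) → V) × Fin NU → Fin (nb * k) → A)
      (sA : (Fin (nf * k) → X) → (Fin (nb * k) → B) → Fin NS)
      (sB : (Fin (nf * k) → Y) → (Fin (nb * k) → A) → Fin NS),
      0 < NU ∧ 0 < NS ∧ (2 : ℝ) ^ (k * s) ≤ NS ∧
      (∀ y v, 0 ≤ κ' y v) ∧ (∀ y, ∑ v, κ' y v = 1) ∧
      ∑ t, codeWeight (blockW pX W) (fun t i => (t.2 i).1) κ'
          (fun a (o : Fin (nb * k) → B × C) => ∏ i, W₂ (a i) (o i)) cb t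
          * ind (sB (fun i => (t.1.2 i).1) (cb t.2.1) ≠ sA t.1.1 fun i => (t.2.2 i).1) ≤ η ∧
      secDist (fun t : ((Fin (nf * k) → X) × (Fin (nf * k) → Y × Z)) ×
          ((Fin (nf * k) → V) × Fin NU) × (Fin (nb * k) → B × C) => sA t.1.1 fun i => (t.2.2 i).1)
        (fun t => ((fun i => (t.1.2 i).2 : Fin (nf * k) → Z), (fun i => (t.2.2 i).2 :
          Fin (nb * k) → C)))
        (codeWeight (blockW pX W) (fun t i => (t.2 i).1) κ'
          (fun a (o : Fin (nb * k) → B × C) => ∏ i, W₂ (a i) (o i)) cb) ≤ η := by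
  classical
  -- slack
  obtain ⟨ε, hε, hε1, hε2⟩ : ∃ ε > 0, nf * (mY - mX) + 10 * ε < nb * iB ∧
      s + 10 * ε ≤ nf * (mX - mZ) + nb * max (iB - iC) 0 := by
    refine ⟨min (nb * iB - nf * (mY - mX)) (nf * (mX - mZ) + nb * max (iB - iC) 0 - s) / 20,
      ?_, ?_, ?_⟩
    · have := lt_min (sub_pos.2 hcon) (sub_pos.2 hs)
      positivity
    · have := min_le_left (nb * iB - nf * (mY - mX))
        (nf * (mX - mZ) + nb * max (iB - iC) 0 - s)
      linarith
    · have := min_le_right (nb * iB - nf * (mY - mX))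
        (nf * (mX - mZ) + nb * max (iB - iC) 0 - s)
      linarith
  have hj := jointW_nonneg hp hW hκ
  have hj1 := sum_jointW (pX := pX) (W := W) (κ := κ) hp1 hW1 hκ1
  set w₂ : A × (B × C) → ℝ := fun t => q t.1 * W₂ t.1 t.2 with hw₂
  have hw₂0 : ∀ t, 0 ≤ w₂ t := fun t => mul_nonneg (hq _) (hW₂ _ _)
  have hw₂1 : ∑ t, w₂ t = 1 := by
    rw [Fintype.sum_prod_type]
    simp only [hw₂, ← Finset.mul_sum, hW₂1, mul_one, hq1]
  have hw₂pos : ∀ t, 0 < w₂ t → 0 < q t.1 ∧ 0 < W₂ t.1 t.2 := fun t ht => by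
    constructor
    · exact (hq _).lt_of_ne' fun h => by simp [hw₂, h] at ht
    · exact (hW₂ _ _).lt_of_ne' fun h => by simp [hw₂, h] at ht
  set a : ℝ := -(nf * mY) with ha
  set b : ℝ := -(nf * mX) with hb
  have hnf : (0 : ℝ) ≤ nf := Nat.cast_nonneg _
  have hκle : ∀ y v, κ y v ≤ 1 := fun y v => by
    rw [← hκ1 y]; exact Finset.single_le_sum (fun v _ => hκ y v) (Finset.mem_univ v)
  have ha0 : 0 ≤ a := by
    have : mY ≤ 0 := by
      rw [hmY]
      refine Finset.sum_nonpos fun t _ => mul_nonpos_of_nonneg_of_nonpos (hj t) ?_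
      exact Real.logb_nonpos (by norm_num) (hκ _ _) (hκle _ _)
    rw [ha]; nlinarith
  have hab : a ≤ b := by rw [ha, hb]; nlinarith
  set u : ℝ := nb * iB - (b - a + 4 * ε) - 2 * ε with hu
  have hu0 : 0 < u := by rw [hu, ha, hb]; nlinarith
  set c₁ := nf * varLog (jointW pX W κ) (fun t => κ t.2.1.1 t.2.2) / ε ^ 2 with hc₁
  set c₂ := nf * varLog (jointW pX W κ) (fun t => condVX W κ t.2.2 t.1) / ε ^ 2 with hc₂
  set c₃ := nb * varLog w₂ (fun t => outR q W₂ Prod.fst t.1 t.2.1) / ε ^ 2 with hc₃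
  set c₄ := nb * varLog w₂ (fun t => outR q W₂ Prod.snd t.1 t.2.2) / ε ^ 2 with hc₄
  set c₅ := nf * varLog (jointW pX W κ) (fun t => condVZ pX W κ t.2.2 t.2.1.2) / ε ^ 2 with hc₅
  have hlim := tendsto_error_bound c₁ c₂ c₃ c₄ c₅ hε
  filter_upwards [hlim.eventually_le_const (show (0 : ℝ) < η / 3 by positivity),
    eventually_gt_atTop 0] with k hk hk0
  have hkR : (0 : ℝ) < k := by exact_mod_cast hk0
  have ht : 0 < ε * k := by positivity
  have hdiv : ∀ (n : ℕ) (c : ℝ), ((n * k : ℕ) : ℝ) * c / (ε * k) ^ 2 = n * c / ε ^ 2 / k := by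
    intro n c; push_cast; field_simp
  obtain ⟨NF, NG, NU, NS, hF, hG, hU, hS, hNS, hY, hX, hBo, hC1, hC2⟩ :=
    exists_sizes (a := a) (b := b) (g := b - a + 4 * ε) (u := u) (s := s) (c := nb * iB)
      (z := nf * mZ) hε ha0 rfl hab hu0 (by rw [hu]; linarith) k
  set n := nf * k
  set m := nb * k
  -- the reference law of Eve's second observation
  have hwC : ∀ (a : Fin m → A) (c : Fin m → C),
      ∑ o : Fin m → B × C, (∏ i, W₂ (a i) (o i)) * ind ((fun i => (o i).2) = c)
        = ∏ i, outW W₂ Prod.snd (a i) (c i) := fun a c => sum_block_out W₂ Prod.snd a c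
  have hwC0 : ∀ (a : Fin m → A) (c : Fin m → C), 0 ≤ ∏ i, outW W₂ Prod.snd (a i) (c i) :=
    fun a c => Finset.prod_nonneg fun i _ => outW_nonneg hW₂ _ _ _
  have hwC1 : ∀ a : Fin m → A, ∑ c : Fin m → C, ∏ i, outW W₂ Prod.snd (a i) (c i) = 1 :=
    fun a => sum_pi_prod_one (q := fun i => outW W₂ Prod.snd (a i)) fun i => sum_outW hW₂1 _ _
  have hqm : ∀ a : Fin m → A, 0 ≤ ∏ i, q (a i) := fun a => Finset.prod_nonneg fun i _ => hq _
  have hqm1 : ∑ a : Fin m → A, ∏ i, q (a i) = 1 := sum_pi_prod_one (q := fun _ => q) fun _ => hq1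
  have hNGU : (0 : ℝ) < NG * NU := by positivity
  obtain ⟨τ, QC, hτ, hQC, hQC1, hεC, hkey⟩ : ∃ (τ : ℝ)
      (QC : (Fin NG × Fin NU → Fin m → A) → (Fin m → C) → ℝ), 0 ≤ τ ∧ (∀ cb c, 0 ≤ QC cb c) ∧
      (∀ cb, ∑ c, QC cb c ≤ 1) ∧
      (∀ l, ∑ cb : Fin NG × Fin NU → Fin m → A, (∏ j, ∏ i, q (cb j i)) *
        ∑ c : Fin m → C, (∏ i, outW W₂ Prod.snd (cb l i) (c i)) *
          ind (τ * QC cb c < ∏ i, outW W₂ Prod.snd (cb l i) (c i)) ≤ c₄ / k) ∧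
      ((NS : ℝ) - 1) * (2 ^ (k * (nf * mZ) + ε * k) * τ * NF / NU) ≤ 4 * 2 ^ (-(ε * k)) := by
    rcases le_total iC iB with h | h
    · refine ⟨2 ^ (k * (nb * iC) + ε * k), fun _ c => ∏ i, outQ q W₂ Prod.snd (c i),
        by positivity, fun _ c => Finset.prod_nonneg fun i _ => outQ_nonneg hq hW₂ _ _,
        fun _ => (sum_pi_prod_one (q := fun _ => outQ q W₂ Prod.snd)
          fun _ => sum_outQ hq1 hW₂1 _).le, fun l => ?_, hC1 (nb * iC) ?_⟩
      · rw [sum_pi_apply (q := fun _ (a : Fin m → A) => ∏ i, q (a i)) (fun _ => hqm1) l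
          fun a => ∑ c : Fin m → C, (∏ i, outW W₂ Prod.snd (a i) (c i)) *
            ind ((2 : ℝ) ^ (k * (nb * iC) + ε * k) * ∏ i, outQ q W₂ Prod.snd (c i)
              < ∏ i, outW W₂ Prod.snd (a i) (c i))]
        have e : ∀ (a : Fin m → A), ∑ c : Fin m → C, (∏ i, outW W₂ Prod.snd (a i) (c i)) *
            ind ((2 : ℝ) ^ (k * (nb * iC) + ε * k) * ∏ i, outQ q W₂ Prod.snd (c i)
              < ∏ i, outW W₂ Prod.snd (a i) (c i))
            = ∑ o : Fin m → B × C, (∏ i, W₂ (a i) (o i)) *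
              ind ((2 : ℝ) ^ (k * (nb * iC) + ε * k) * ∏ i, outQ q W₂ Prod.snd (o i).2
              < ∏ i, outW W₂ Prod.snd (a i) (o i).2) := by
          intro a
          simp only [← hwC a, Finset.sum_mul]
          rw [Finset.sum_comm]
          refine Finset.sum_congr rfl fun o _ => ?_
          simp only [hwC]
          rw [← sum_ind_eq_mul (fun i => (o i).2) fun c => (∏ i, W₂ (a i) (o i)) *
            ind ((2 : ℝ) ^ (k * (nb * iC) + ε * k) * ∏ i, outQ q W₂ Prod.snd (c i)
              < ∏ i, outW W₂ Prod.snd (a i) (c i))]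
          exact Finset.sum_congr rfl fun c _ => by ring
        simp only [e]
        rw [hc₄, ← hdiv]
        refine le_trans (le_of_eq ?_) (sum_prod_mul_ind_gt_le (n := m) hw₂0 hw₂1
          (r := fun t => outR q W₂ Prod.snd t.1 t.2.2) (fun t h => ?_) ht
          (E := fun f => (2 : ℝ) ^ (k * (nb * iC) + ε * k) *
            ∏ i, outQ q W₂ Prod.snd (f i).2.2 < ∏ i, outW W₂ Prod.snd (f i).1 (f i).2.2) ?_)
        · rw [sum_arrow_prod]
          refine Finset.sum_congr rfl fun a _ => ?_
          rw [Finset.mul_sum]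
          refine Finset.sum_congr rfl fun o _ => ?_
          simp only [hw₂, Finset.prod_mul_distrib]
          ring
        · have h1 := outW_pos hW₂ Prod.snd (hw₂pos t h).2
          exact div_pos h1 (outQ_pos hq hW₂ _ (hw₂pos t h).1 h1)
        · intro f hf h
          have e1 : ∏ i, outR q W₂ Prod.snd (f i).1 (f i).2.2
              = (∏ i, outW W₂ Prod.snd (f i).1 (f i).2.2) / ∏ i, outQ q W₂ Prod.snd (f i).2.2 :=
            Finset.prod_div_distrib ..
          rw [e1, lt_div_iff₀]
          · have e2 : (m : ℝ) * ∑ x, w₂ x * Real.logb 2 (outR q W₂ Prod.snd x.1 x.2.2) + ε * k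
                = k * (nb * iC) + ε * k := by
              rw [hiC]; simp only [m, meanLog]; push_cast; ring
            rw [e2]; exact h
          · exact Finset.prod_pos fun i _ => outQ_pos hq hW₂ _ (hw₂pos _ (hf i)).1
              (outW_pos hW₂ Prod.snd (hw₂pos _ (hf i)).2)
      · rw [max_eq_left (by linarith)] at hε2
        rw [hu, ha, hb]; linarith
    · refine ⟨NG * NU, fun cb c => (∑ l, ∏ i, outW W₂ Prod.snd (cb l i) (c i)) / (NG * NU),
        hNGU.le, fun cb c => div_nonneg (Finset.sum_nonneg fun l _ => hwC0 _ _) hNGU.le,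
        fun cb => ?_, fun l => ?_, hC2 ?_⟩
      · rw [← Finset.sum_div, Finset.sum_comm]
        simp only [hwC1]
        simp only [Finset.sum_const, Finset.card_univ, Fintype.card_prod, Fintype.card_fin,
          nsmul_eq_mul, mul_one]
        push_cast
        rw [div_self hNGU.ne']
      · refine le_trans (le_of_eq (Finset.sum_eq_zero fun cb _ => ?_)) (?_ : 0 ≤ c₄ / k)
        · rw [Finset.sum_eq_zero fun c _ => ?_, mul_zero]
          rw [ind_not, mul_zero]
          rw [mul_div_cancel₀ _ hNGU.ne', not_lt]
          exact Finset.single_le_sum (f := fun l => ∏ i, outW W₂ Prod.snd (cb l i) (c i))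
            (fun l _ => hwC0 _ _) (Finset.mem_univ l)
        · have : 0 ≤ varLog w₂ (fun t => outR q W₂ Prod.snd t.1 t.2.2) :=
            Finset.sum_nonneg fun t _ => mul_nonneg (hw₂0 t) (sq_nonneg _)
          positivity
      · rw [max_eq_right (by linarith)] at hε2
        rw [ha, hb]; linarith
  have hprob : ∀ (E : (Fin n → X) → (Fin n → Y × Z) → (Fin n → V) → Prop) (c : ℝ),
      ∑ f : Fin n → X × (Y × Z) × V, (∏ i, jointW pX W κ (f i)) *
        ind (E (fun i => (f i).1) (fun i => (f i).2.1) (fun i => (f i).2.2)) ≤ c →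
      ∑ t, blockW pX W t * ∑ v : Fin n → V, (∏ i, κ (t.2 i).1 (v i)) * ind (E t.1 t.2 v) ≤ c := by
    intro E c h
    rwa [sum_blockW_kernel pX W κ fun x o v => ind (E x o v)]
  have p1 : ∑ t, blockW pX W t * ∑ v : Fin n → V, (∏ i, κ (t.2 i).1 (v i)) *
      ind ((2 : ℝ) ^ (-(k * a) + ε * k) < ∏ i, κ (t.2 i).1 (v i)) ≤ c₁ / k := by
    refine hprob (fun x o v => (2 : ℝ) ^ (-(k * a) + ε * k) < ∏ i, κ (o i).1 (v i)) _ ?_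
    rw [hc₁, ← hdiv]
    refine sum_prod_mul_ind_gt_le (r := fun t : X × (Y × Z) × V => κ t.2.1.1 t.2.2) hj hj1
      (fun t h => (pos_of_jointW_pos hp hW hκ h).2.2) ht fun f _ h => ?_
    convert h using 2
    rw [ha, hmY]; simp only [n, meanLog]; push_cast; ring
  have p2 : ∑ t, blockW pX W t * ∑ v : Fin n → V, (∏ i, κ (t.2 i).1 (v i)) *
      ind (∏ i, condVX W κ (v i) (t.1 i) < (2 : ℝ) ^ (-(k * b) - ε * k)) ≤ c₂ / k := by
    refine hprob (fun x o v => ∏ i, condVX W κ (v i) (x i) < (2 : ℝ) ^ (-(k * b) - ε * k)) _ ?_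
    rw [hc₂, ← hdiv]
    refine sum_prod_mul_ind_lt_le (r := fun t : X × (Y × Z) × V => condVX W κ t.2.2 t.1) hj hj1
      (fun t h => condVX_pos hp hW hκ h) ht fun f _ h => ?_
    convert h using 2
    rw [hb, hmX]; simp only [n, meanLog]; push_cast; ring
  have p5 : ∑ t, blockW pX W t * ∑ v : Fin n → V, (∏ i, κ (t.2 i).1 (v i)) *
      ind ((2 : ℝ) ^ (k * (nf * mZ) + ε * k) < ∏ i, condVZ pX W κ (v i) (t.2 i).2) ≤ c₅ / k := by
    refine hprob (fun x o v => (2 : ℝ) ^ (k * (nf * mZ) + ε * k)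
      < ∏ i, condVZ pX W κ (v i) (o i).2) _ ?_
    rw [hc₅, ← hdiv]
    refine sum_prod_mul_ind_gt_le (r := fun t : X × (Y × Z) × V => condVZ pX W κ t.2.2 t.2.1.2)
      hj hj1 (fun t h => div_pos (margVZ_pos hp hW hκ h) (margZ_pos hp hW hκ hκ1 h)) ht
      fun f _ h => ?_
    convert h using 2
    rw [hmZ]; simp only [n, meanLog]; push_cast; ring
  have p3 : ∑ a : Fin m → A, (∏ i, q (a i)) * ∑ o : Fin m → B × C, (∏ i, W₂ (a i) (o i)) *
      ind (∏ i, outR q W₂ Prod.fst (a i) (o i).1 < (2 : ℝ) ^ (k * (nb * iB) - ε * k))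
      ≤ c₃ / k := by
    rw [hc₃, ← hdiv]
    refine le_trans (le_of_eq ?_) (sum_prod_mul_ind_lt_le (n := m) hw₂0 hw₂1
      (r := fun t => outR q W₂ Prod.fst t.1 t.2.1) (fun t h => ?_) ht
      (E := fun f => ∏ i, outR q W₂ Prod.fst (f i).1 (f i).2.1
        < (2 : ℝ) ^ (k * (nb * iB) - ε * k)) ?_)
    · rw [sum_arrow_prod]
      refine Finset.sum_congr rfl fun a _ => ?_
      rw [Finset.mul_sum]
      refine Finset.sum_congr rfl fun o _ => ?_
      simp only [hw₂, Finset.prod_mul_distrib]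
      ring
    · have h1 := outW_pos hW₂ Prod.fst (hw₂pos t h).2
      exact div_pos h1 (outQ_pos hq hW₂ _ (hw₂pos t h).1 h1)
    · intro f _ h
      convert h using 2
      rw [hiB]; simp only [m, meanLog]; push_cast; ring
  obtain ⟨κ', cb, sA, sB, h1, h2, h3, h4⟩ := exists_block_one_shot hp hp1 hW hW1 hκ hκ1 hq hq1 hW₂
    hW₂1 n m hF hG hU hS
    (tY := 2 ^ (-(k * a) + ε * k)) (tX := 2 ^ (-(k * b) - ε * k))
    (tZ := 2 ^ (k * (nf * mZ) + ε * k)) (γ := 2 ^ (k * (nb * iB) - ε * k))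
    (by positivity) (by positivity) (by positivity) (by positivity) hτ hQC hQC1 hεC
    (η := η / 3) (by
      refine le_trans ?_ hk
      have s1 := Real.sqrt_le_sqrt hY
      have s2 := Real.sqrt_le_sqrt hkey
      linarith)
  rw [mul_div_cancel₀ _ (by norm_num : (3 : ℝ) ≠ 0)] at h3 h4
  exact ⟨NU, NS, κ', cb, sA, sB, hU, hS, hNS, h1, h2, h3, h4⟩

/-! ### Entropy bounds -/

/-- Contribution of a weight `r` to a conditional entropy. -/
def localEnt {α : Type*} [Fintype α] (r : α → ℝ) : ℝ :=
  ∑ a, -(r a) * Real.logb 2 (r a / ∑ a', r a')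

lemma logb_two_le {x : ℝ} (hx : 0 < x) : Real.logb 2 x ≤ (x - 1) / Real.log 2 := by
  unfold Real.logb
  have := Real.log_le_sub_one_of_pos hx
  gcongr

lemma localEnt_nonneg {α : Type*} [Fintype α] {r : α → ℝ} (hr : ∀ a, 0 ≤ r a) :
    0 ≤ localEnt r := by
  refine Finset.sum_nonneg fun a _ => ?_
  rw [neg_mul]
  have h0 : 0 ≤ ∑ a', r a' := Finset.sum_nonneg fun a' _ => hr a'
  exact neg_nonneg.2 (mul_nonpos_of_nonneg_of_nonpos (hr a) (Real.logb_nonpos (by norm_num)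
    (div_nonneg (hr a) h0)
    (div_le_one_of_le₀ (Finset.single_le_sum (fun a' _ => hr a') (Finset.mem_univ a)) h0)))

lemma localEnt_le {α : Type*} [Fintype α] {r : α → ℝ} (hr : ∀ a, 0 ≤ r a) :
    localEnt r ≤ (∑ a, r a) * Real.logb 2 (Fintype.card α) := by
  set s := ∑ a, r a with hs
  have h0 : 0 ≤ s := Finset.sum_nonneg fun a' _ => hr a'
  rcases h0.eq_or_lt with h | h
  · have hz : ∀ a, r a = 0 := fun a =>
      (Finset.sum_eq_zero_iff_of_nonneg fun a' _ => hr a').1 h.symm a (Finset.mem_univ a)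
    rw [← h, zero_mul]
    simp [localEnt, hz]
  obtain ⟨a₀, -, -⟩ := Finset.exists_ne_zero_of_sum_ne_zero h.ne'
  have hcard : (0 : ℝ) < Fintype.card α := by
    exact_mod_cast Fintype.card_pos_iff.2 ⟨a₀⟩
  have hl : 0 < Real.log 2 := Real.log_pos (by norm_num)
  have key : ∀ a, -(r a) * Real.logb 2 (r a / s)
      ≤ r a * Real.logb 2 (Fintype.card α) + (s / Fintype.card α - r a) / Real.log 2 := by
    intro a
    rcases (hr a).eq_or_lt with ha | ha
    · rw [← ha]; simp; positivity
    have h1 := logb_two_le (x := s / r a / Fintype.card α) (by positivity)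
    rw [Real.logb_div (by positivity) hcard.ne', Real.logb_div h.ne' ha.ne'] at h1
    rw [Real.logb_div ha.ne' h.ne']
    have h2 : r a * ((s / r a / Fintype.card α - 1) / Real.log 2)
        = (s / Fintype.card α - r a) / Real.log 2 := by field_simp
    have h3 := mul_le_mul_of_nonneg_left h1 ha.le
    rw [h2] at h3
    linarith
  calc localEnt r ≤ ∑ a, (r a * Real.logb 2 (Fintype.card α)
        + (s / Fintype.card α - r a) / Real.log 2) := Finset.sum_le_sum fun a _ => key a
    _ = s * Real.logb 2 (Fintype.card α) := by
        rw [Finset.sum_add_distrib, ← Finset.sum_mul, ← Finset.sum_div, Finset.sum_sub_distrib]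
        simp only [Finset.sum_const, Finset.card_univ, nsmul_eq_mul]
        rw [mul_div_cancel₀ _ hcard.ne', ← hs]
        simp

lemma le_localEnt {N : ℕ} (hN : 0 < N) {r : Fin N → ℝ} (hr : ∀ a, 0 ≤ r a) :
    (∑ a, r a) * Real.logb 2 N
      - (∑ a, |r a - 1 / N * ∑ a', r a'|) * (Real.logb 2 N + 2) ≤ localEnt r := by
  set s := ∑ a, r a with hs
  have hNR : (0 : ℝ) < N := by exact_mod_cast hN
  have hN1 : (1 : ℝ) ≤ N := by exact_mod_cast hN
  have h0 : 0 ≤ s := Finset.sum_nonneg fun a' _ => hr a'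
  have hlN : 0 ≤ Real.logb 2 N := Real.logb_nonneg (by norm_num) hN1
  rcases h0.eq_or_lt with h | h
  · rw [← h, zero_mul, zero_sub]
    refine le_trans (neg_nonpos.2 ?_) (localEnt_nonneg hr)
    exact mul_nonneg (Finset.sum_nonneg fun a _ => abs_nonneg _) (by linarith)
  have hl : 1 / 2 ≤ Real.log 2 := by linarith [Real.log_two_gt_d9]
  have key : ∀ a, r a * Real.logb 2 N - |r a - 1 / N * s| * (Real.logb 2 N + 2)
      ≤ -(r a) * Real.logb 2 (r a / s) := by
    intro a
    rcases (hr a).eq_or_lt with ha | ha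
    · rw [← ha]
      simp only [zero_mul, neg_zero, zero_sub]
      exact neg_nonpos.2 (mul_nonneg (abs_nonneg _) (by linarith))
    have hle : r a ≤ s := Finset.single_le_sum (fun a' _ => hr a') (Finset.mem_univ a)
    have e : r a * Real.logb 2 N + r a * Real.logb 2 (r a / s)
        = r a * Real.logb 2 (N * (r a / s)) := by
      rw [Real.logb_mul hNR.ne' (by positivity)]; ring
    suffices r a * Real.logb 2 (N * (r a / s)) ≤ |r a - 1 / N * s| * (Real.logb 2 N + 2) by
      linarith
    by_cases hc : r a ≤ 1 / N * s
    · have h1 : Real.logb 2 (N * (r a / s)) ≤ 0 := by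
        refine Real.logb_nonpos (by norm_num) (by positivity) ?_
        rw [← mul_div_assoc, div_le_one h]
        calc N * r a ≤ N * (1 / N * s) := by gcongr
          _ = s := by field_simp
      exact (mul_nonpos_of_nonneg_of_nonpos ha.le h1).trans
        (mul_nonneg (abs_nonneg _) (by linarith))
    · rw [not_le] at hc
      have hd : 0 < r a - 1 / N * s := by linarith
      rw [abs_of_pos hd]
      have h1 : Real.logb 2 (N * (r a / s)) ≤ Real.logb 2 N := by
        refine Real.logb_le_logb_of_le (by norm_num) (by positivity) ?_
        exact mul_le_of_le_one_right hNR.le (div_le_one_of_le₀ hle h0)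
      have h2 := logb_two_le (x := N * (r a / s)) (by positivity)
      have h3 : (N * (r a / s) - 1) / Real.log 2 ≤ (N * (r a / s) - 1) / (1 / 2) := by
        gcongr
        have : 1 ≤ N * (r a / s) := by
          rw [← mul_div_assoc, one_le_div h]
          calc s = N * (1 / N * s) := by field_simp
            _ ≤ N * r a := by gcongr
        linarith
      have h4 : 1 / N * s * ((N * (r a / s) - 1) / (1 / 2)) = 2 * (r a - 1 / N * s) := by
        field_simp
      have h5 : 1 / N * s * Real.logb 2 (N * (r a / s)) ≤ 2 * (r a - 1 / N * s) := by
        rw [← h4]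
        exact mul_le_mul_of_nonneg_left (h2.trans h3) (by positivity)
      have h6 := mul_le_mul_of_nonneg_left h1 hd.le
      nlinarith
  have := Finset.sum_le_sum fun a (_ : a ∈ Finset.univ) => key a
  rw [Finset.sum_sub_distrib, ← Finset.sum_mul, ← Finset.sum_mul] at this
  exact this

section PMF

lemma toReal_map {T α : Type*} [Fintype T] (p : PMF T) (f : T → α) (a : α) :
    ((p.map f) a).toReal = ∑ t, ind (f t = a) * (p t).toReal := by
  classical
  rw [PMF.map_apply, tsum_fintype, ENNReal.toReal_sum]
  · refine Finset.sum_congr rfl fun t _ => ?_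
    by_cases h : f t = a
    · rw [if_pos h.symm, ind_of h, one_mul]
    · rw [if_neg (Ne.symm h), ind_not h, zero_mul, ENNReal.toReal_zero]
  · intro t _
    split_ifs
    · exact p.apply_ne_top t
    · exact ENNReal.zero_ne_top

lemma sum_toReal {T : Type*} [Fintype T] (p : PMF T) : ∑ t, (p t).toReal = 1 := by
  rw [← ENNReal.toReal_sum fun t _ => p.apply_ne_top t, ← tsum_fintype (L := .unconditional _),
    p.tsum_coe, ENNReal.toReal_one]

/-- The marginal of a pair with finite first component. -/
lemma toReal_map_snd {Ω α β : Type*} [Fintype α] (p : PMF Ω) (A : Ω → α) (B : Ω → β) (b : β) :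
    ((p.map B) b).toReal = ∑ a, ((p.map fun ω => (A ω, B ω)) (a, b)).toReal := by
  classical
  have h : p.map B = (p.map fun ω => (A ω, B ω)).map Prod.snd := by
    rw [PMF.map_comp]; rfl
  rw [h, PMF.map_apply, ENNReal.tsum_prod', tsum_fintype, ENNReal.toReal_sum]
  · refine Finset.sum_congr rfl fun a _ => ?_
    rw [tsum_eq_single b]
    · simp
    · intro b' hb'
      simp [Ne.symm hb']
  · intro a _
    refine ne_top_of_le_ne_top ENNReal.one_ne_top ?_
    rw [← (p.map fun ω => (A ω, B ω)).tsum_coe, ENNReal.tsum_prod']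
    refine le_trans ?_ (ENNReal.le_tsum a)
    exact ENNReal.tsum_le_tsum fun b' => by split_ifs <;> simp

lemma condH_eq_tsum {Ω α β : Type*} [Fintype α] (p : PMF Ω) (A : Ω → α) (B : Ω → β) :
    condH p A B = ∑' b, localEnt fun a => ((p.map fun ω => (A ω, B ω)) (a, b)).toReal := by
  simp only [condH, localEnt, toReal_map_snd p A B]

lemma H_eq_localEnt {Ω α : Type*} [Fintype α] (p : PMF Ω) (A : Ω → α) :
    H p A = localEnt fun a => ((p.map A) a).toReal := by
  simp only [H, entropy, localEnt, sum_toReal, div_one, neg_mul]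

lemma H_le {Ω : Type*} {N : ℕ} (p : PMF Ω) (S : Ω → Fin N) : H p S ≤ Real.logb 2 N := by
  rw [H_eq_localEnt]
  refine (localEnt_le fun _ => ENNReal.toReal_nonneg).trans ?_
  rw [sum_toReal, one_mul, Fintype.card_fin]

variable {T E : Type*} [Fintype T] [Fintype E] {N : ℕ}

lemma le_condH (hN : 0 < N) (p : PMF T) (S : T → Fin N) (e : T → E) :
    Real.logb 2 N - secDist S e (fun t => (p t).toReal) * (Real.logb 2 N + 2)
      ≤ condH p S e := by
  rw [condH_eq_tsum, tsum_fintype]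
  refine le_trans (le_of_eq ?_) (Finset.sum_le_sum fun x _ =>
    le_localEnt hN (r := fun a => ((p.map fun ω => (S ω, e ω)) (a, x)).toReal)
      fun _ => ENNReal.toReal_nonneg)
  simp only [← toReal_map_snd p S e]
  rw [Finset.sum_sub_distrib, ← Finset.sum_mul, ← Finset.sum_mul, sum_toReal, one_mul]
  congr 2
  unfold secDist
  rw [Finset.sum_comm]
  refine Finset.sum_congr rfl fun x _ => Finset.sum_congr rfl fun s _ => ?_
  congr 1
  rw [toReal_map, toReal_map, Finset.mul_sum, ← Finset.sum_sub_distrib]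
  refine Finset.sum_congr rfl fun t _ => ?_
  have : ind ((S t, e t) = (s, x)) = ind (S t = s) * ind (e t = x) := by
    rw [← ind_and]; simp only [Prod.mk.injEq]
  rw [this]; ring

lemma le_H (hN : 0 < N) (p : PMF T) (S : T → Fin N) (e : T → E) :
    Real.logb 2 N - secDist S e (fun t => (p t).toReal) * (Real.logb 2 N + 2) ≤ H p S := by
  have h := le_localEnt hN (r := fun a => ((p.map S) a).toReal) fun _ => ENNReal.toReal_nonneg
  rw [← H_eq_localEnt, sum_toReal, one_mul, mul_one] at h
  refine le_trans (sub_le_sub_left (mul_le_mul_of_nonneg_right ?_ ?_) _) h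
  · unfold secDist
    refine Finset.sum_le_sum fun s _ => ?_
    have : ((p.map S) s).toReal - 1 / N
        = ∑ x, ∑ t, (ind (S t = s) - 1 / N) * ind (e t = x) * (p t).toReal := by
      rw [Finset.sum_comm, toReal_map]
      have h1 : ∀ t, ∑ x, (ind (S t = s) - 1 / N) * ind (e t = x) * (p t).toReal
          = ind (S t = s) * (p t).toReal - 1 / N * (p t).toReal := fun t => by
        rw [← Finset.sum_mul, ← Finset.mul_sum, sum_ind_eq]; ring
      simp only [h1]
      rw [Finset.sum_sub_distrib, ← Finset.mul_sum, sum_toReal, mul_one]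
    rw [this]
    exact Finset.abs_sum_le_sum_abs _ _
  · have : 0 ≤ Real.logb 2 N := Real.logb_nonneg (by norm_num) (by exact_mod_cast hN)
    linarith

end PMF

/-! ### Security of a joint law of keys and observation -/

/-- The security conditions for the joint law `μ` of the key, its estimate and Eve's view after
`n` channel uses. -/
def SecureLaw {K : ℕ} {E : Type*} (μ : PMF (Fin K × Fin K × E)) (n R δ : ℝ) : Prop :=
  H μ (fun ω => ω.1) / n > R - δ ∧
    (μ.toOuterMeasure {ω | ω.2.1 ≠ ω.1}).toReal < δ ∧
    condH μ (fun ω => ω.1) (fun ω => ω.2.2) / H μ (fun ω => ω.1) > 1 - δ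

lemma secureLaw_map {T E : Type*} [Fintype T] [Fintype E] {N : ℕ} (hN : 0 < N) (p : PMF T)
    (S S' : T → Fin N) (e : T → E) {n R δ η : ℝ} (hR : 0 ≤ R) (hη : 0 ≤ η) (hn : 1 ≤ n)
    (hRn : R * n ≤ Real.logb 2 N) (hN1 : 1 ≤ Real.logb 2 N)
    (hδ : δ ≤ 1 / 2) (hηδ : η * (R + 5) < δ)
    (herr : ∑ t, (p t).toReal * ind (S' t ≠ S t) ≤ η)
    (hsec : secDist S e (fun t => (p t).toReal) ≤ η) :
    SecureLaw (p.map fun t => (S t, S' t, e t)) n R δ := by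
  set L := Real.logb 2 N with hL
  have h1 : H (p.map fun t => (S t, S' t, e t)) (fun ω => ω.1) = H p S := by
    unfold H; rw [PMF.map_comp]; rfl
  have h2 : condH (p.map fun t => (S t, S' t, e t)) (fun ω => ω.1) (fun ω => ω.2.2)
      = condH p S e := by
    unfold condH; rw [PMF.map_comp, PMF.map_comp]; rfl
  have hm : secDist S e (fun t => (p t).toReal) * (L + 2) ≤ η * (L + 2) :=
    mul_le_mul_of_nonneg_right hsec (by linarith)
  have hc := le_condH hN p S e
  have hH := le_H hN p S e
  have hHle := H_le p S
  rw [← hL] at hc hH hHle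
  have hη1 : η < 1 / 10 := by nlinarith
  have hHpos : 0 < H p S := by nlinarith
  refine ⟨?_, ?_, ?_⟩
  · rw [h1, gt_iff_lt, lt_div_iff₀ (by linarith)]
    nlinarith
  · refine lt_of_le_of_lt (le_trans (le_of_eq ?_) herr) (by nlinarith)
    classical
    rw [PMF.toOuterMeasure_map_apply, PMF.toOuterMeasure_apply_fintype, ENNReal.toReal_sum]
    · refine Finset.sum_congr rfl fun t _ => ?_
      by_cases h : S' t = S t
      · rw [ind_not (not_not.2 h)]; simp [h]
      · rw [ind_of h]; simp [h]
    · intro t _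
      unfold Set.indicator
      split_ifs
      · exact p.apply_ne_top t
      · exact ENNReal.zero_ne_top
  · rw [h1, h2, gt_iff_lt, lt_div_iff₀ hHpos]
    have h3 : 5 * η < δ := by nlinarith
    have h4 : (1 - δ) * H p S ≤ (1 - δ) * L := mul_le_mul_of_nonneg_left hHle (by linarith)
    have h5 : 5 * η * L < δ * L := mul_lt_mul_of_pos_right h3 (by linarith)
    have h6 : η * 1 ≤ η * L := mul_le_mul_of_nonneg_left hN1 hη
    nlinarith

/-! ### Realization by protocols -/

/-- Law of `(a, b)`, where `a` has law `p` and `b` has law `f a` given `a`. -/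
def joinPMF {α β : Type*} (p : PMF α) (f : α → PMF β) : PMF (α × β) :=
  p.bind fun a => (f a).map fun b => (a, b)

lemma joinPMF_apply {α β : Type*} (p : PMF α) (f : α → PMF β) (a : α) (b : β) :
    joinPMF p f (a, b) = p a * f a b := by
  classical
  unfold joinPMF
  rw [PMF.bind_apply, tsum_eq_single a]
  · congr 1
    rw [PMF.map_apply, tsum_eq_single b]
    · simp
    · intro b' hb'; simp [Ne.symm hb']
  · intro a' ha'
    rw [PMF.map_apply]
    simp [Ne.symm ha']

lemma joinPMF_toReal {α β : Type*} (p : PMF α) (f : α → PMF β) (t : α × β) :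
    (joinPMF p f t).toReal = (p t.1).toReal * (f t.1 t.2).toReal := by
  obtain ⟨a, b⟩ := t
  rw [joinPMF_apply, ENNReal.toReal_mul]

lemma map_joinPMF {α β γ : Type*} (p : PMF α) (f : α → PMF β) (g : α × β → γ) :
    (joinPMF p f).map g = p.bind fun a => (f a).map fun b => g (a, b) := by
  unfold joinPMF
  rw [PMF.map_bind]
  simp only [PMF.map_comp]
  rfl

lemma bind_joinPMF {α β γ : Type*} (p : PMF α) (f : α → PMF β) (g : α × β → PMF γ) :
    (joinPMF p f).bind g = p.bind fun a => (f a).bind fun b => g (a, b) := by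
  unfold joinPMF
  rw [PMF.bind_bind]
  simp only [PMF.bind_map]
  rfl

/-- Law of independent coordinates. -/
def piPMF {ι α : Type*} [Fintype ι] [DecidableEq ι] [Fintype α] (p : ι → PMF α) : PMF (ι → α) :=
  PMF.ofFintype (fun x => ∏ i, p i (x i)) (by
    refine sum_pi_prod_one (q := fun i => p i) fun i => ?_
    rw [← tsum_fintype (L := .unconditional _)]; exact (p i).tsum_coe)

/-- Every finite family of distributions is realized by a random function with values in it. -/
lemma exists_random_function {Y : Type*} {K : Type} [Fintype Y] [Fintype K] (κ : Y → PMF K) :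
    ∃ (R : Type) (p : PMF R) (g : R → Y → K), ∀ y, p.map (fun r => g r y) = κ y := by
  classical
  set e := Fintype.equivFin Y
  refine ⟨Fin (Fintype.card Y) → K, piPMF fun i => κ (e.symm i), fun r y => r (e y), fun y => ?_⟩
  ext k
  rw [PMF.map_apply, tsum_fintype]
  have h1 : ∀ i : Fin (Fintype.card Y), ∑ a, κ (e.symm i) a = 1 := fun i => by
    rw [← tsum_fintype (L := .unconditional _)]; exact (κ (e.symm i)).tsum_coe
  have h := sum_pi_apply (q := fun i => κ (e.symm i)) h1 (e y)
    (fun a => if k = a then (1 : ENNReal) else 0)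
  simp only [mul_ite, mul_one, mul_zero, Finset.sum_ite_eq, Finset.mem_univ, if_true,
    Equiv.symm_apply_apply] at h
  rw [← h]
  refine Finset.sum_congr rfl fun r _ => ?_
  by_cases hr : k = r (e y) <;> simp [hr, piPMF]

/-- A distribution on a finite set is realized by a random variable on a set in `Type`. -/
lemma exists_random_variable {α : Type*} [Fintype α] (p : PMF α) :
    ∃ (R : Type) (pR : PMF R) (g : R → α), pR.map g = p := by
  refine ⟨Fin (Fintype.card α), p.map (Fintype.equivFin α), (Fintype.equivFin α).symm, ?_⟩
  rw [PMF.map_comp]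
  simp [PMF.map_id]

section TwoRound

variable {X₁ Y₁ Z₁ X₂ Y₂ Z₂ : Type u} [Fintype Y₁] [Fintype Z₁] [Fintype Y₂]
  [Fintype Z₂] {K : Type} {n m N : ℕ}

/-- Joint law of two rounds of communication: the first party sends a sequence with law `p`, the
other party answers with `cb k`, where `k` has law `κ y` given the received sequence `y`. -/
def twoRoundLaw (W₁ : DMBC X₁ Y₁ Z₁) (W₂ : DMBC X₂ Y₂ Z₂) (p : PMF (Fin n → X₁))
    (κ : (Fin n → Y₁) → PMF K) (cb : K → Fin m → X₂) :
    PMF (((Fin n → X₁) × (Fin n → Y₁ × Z₁)) × K × (Fin m → Y₂ × Z₂)) :=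
  joinPMF (joinPMF p fun x => W₁.block x) fun t =>
    joinPMF (κ fun i => (t.2 i).1) fun k => W₂.block (cb k)

/-- Joint law of the key of the first party, the key of the other party, and Eve's view. -/
def twoRoundOutcome (W₁ : DMBC X₁ Y₁ Z₁) (W₂ : DMBC X₂ Y₂ Z₂) (p : PMF (Fin n → X₁))
    (κ : (Fin n → Y₁) → PMF K) (cb : K → Fin m → X₂)
    (sA : (Fin n → X₁) → (Fin m → Y₂) → Fin N) (sB : (Fin n → Y₁) → (Fin m → X₂) → Fin N) :
    PMF (Fin N × Fin N × ((PUnit.{u+1} × (Fin n → Z₁)) × (Fin m → Z₂))) :=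
  (twoRoundLaw W₁ W₂ p κ cb).map fun t =>
    (sA t.1.1 fun i => (t.2.2 i).1, sB (fun i => (t.1.2 i).1) (cb t.2.1),
      (PUnit.unit, fun i => (t.1.2 i).2), fun i => (t.2.2 i).2)

lemma twoRoundOutcome_eq {RA RB : Type} (W₁ : DMBC X₁ Y₁ Z₁) (W₂ : DMBC X₂ Y₂ Z₂)
    {p : PMF (Fin n → X₁)} {κ : (Fin n → Y₁) → PMF K} (cb : K → Fin m → X₂)
    (sA : (Fin n → X₁) → (Fin m → Y₂) → Fin N) (sB : (Fin n → Y₁) → (Fin m → X₂) → Fin N)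
    {pA : PMF RA} {xA : RA → Fin n → X₁} (hA : pA.map xA = p)
    {pB : PMF RB} {g : RB → (Fin n → Y₁) → K} (hB : ∀ y, pB.map (fun r => g r y) = κ y) :
    twoRoundOutcome W₁ W₂ p κ cb sA sB
      = pA.bind fun a => pB.bind fun b => (W₁.block (xA a)).bind fun o =>
        (W₂.block (cb (g b fun i => (o i).1))).map fun o' =>
          (sA (xA a) fun i => (o' i).1, sB (fun i => (o i).1) (cb (g b fun i => (o i).1)),
            (PUnit.unit, fun i => (o i).2), fun i => (o' i).2) := by
  unfold twoRoundOutcome twoRoundLaw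
  rw [map_joinPMF, bind_joinPMF, ← hA, PMF.bind_map]
  congr 1
  funext a
  rw [PMF.bind_comm]
  simp only [Function.comp]
  congr 1
  funext o
  rw [map_joinPMF, ← hB, PMF.bind_map]
  rfl

end TwoRound

section Protocols

variable {Xf Yf Zf Xb Yb Zb : Type u} [Fintype Yf] [Fintype Zf] [Fintype Yb] [Fintype Zb]
  {K : Type} [Fintype K] {n m N : ℕ} {R δ : ℝ}

lemma exists_protocol_alice [Fintype Xf] (Wf : DMBC Xf Yf Zf) (Wb : DMBC Xb Yb Zb)
    (p : PMF (Fin n → Xf)) (κ : (Fin n → Yf) → PMF K) (cb : K → Fin m → Xb)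
    (sA : (Fin n → Xf) → (Fin m → Yb) → Fin N) (sB : (Fin n → Yf) → (Fin m → Xb) → Fin N)
    (h : SecureLaw (twoRoundOutcome Wf Wb p κ cb sA sB) (n + m) R δ) :
    ∃ P : Protocol Xf Yf Xb Yb, P.IsSecure Wf Wb R δ := by
  obtain ⟨RA, pA, xA, hA⟩ := exists_random_variable p
  obtain ⟨RB, pB, g, hB⟩ := exists_random_function κ
  let P : Protocol Xf Yf Xb Yb :=
    { RA := RA
      RB := RB
      pA := pA
      pB := pB
      rounds := [⟨.bob, m⟩, ⟨.alice, n⟩]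
      comm := .bob (.alice .start n fun a _ => xA a) m
        fun b (v : PUnit × (Fin n → Yf)) => cb (g b v.2)
      keyCard := N
      keyA := fun v : (PUnit × (Fin n → Xf)) × (Fin m → Yb) => sA v.1.2 v.2
      keyB := fun v : (PUnit × (Fin n → Yf)) × (Fin m → Xb) => sB v.1.2 v.2
      owner := .alice }
  refine ⟨P, ?_⟩
  have hout : P.outcome Wf Wb = twoRoundOutcome Wf Wb p κ cb sA sB := by
    rw [twoRoundOutcome_eq Wf Wb cb sA sB hA hB]
    unfold Protocol.outcome
    simp only [P, Communication.law, PMF.map_bind, PMF.bind_bind, PMF.bind_map, PMF.map_comp]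
    refine congrArg _ (funext fun a => congrArg _ (funext fun b => ?_))
    exact PMF.bind_map _ _ _
  have hN : ((forwardUses P.rounds : ℝ) + (backwardUses P.rounds : ℝ)) = n + m := by
    simp [P, forwardUses, backwardUses]
  have h' : SecureLaw (P.outcome Wf Wb)
      ((forwardUses P.rounds : ℝ) + (backwardUses P.rounds : ℝ)) R δ := by
    rw [hN]; exact hout ▸ h
  exact h'

lemma exists_protocol_bob [Fintype Xb] (Wf : DMBC Xf Yf Zf) (Wb : DMBC Xb Yb Zb)
    (p : PMF (Fin n → Xb)) (κ : (Fin n → Yb) → PMF K) (cb : K → Fin m → Xf)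
    (sA : (Fin n → Xb) → (Fin m → Yf) → Fin N) (sB : (Fin n → Yb) → (Fin m → Xf) → Fin N)
    (h : SecureLaw (twoRoundOutcome Wb Wf p κ cb sA sB) (n + m) R δ) :
    ∃ P : Protocol Xf Yf Xb Yb, P.IsSecure Wf Wb R δ := by
  obtain ⟨RA, pA, xA, hA⟩ := exists_random_variable p
  obtain ⟨RB, pB, g, hB⟩ := exists_random_function κ
  let P : Protocol Xf Yf Xb Yb :=
    { RA := RB
      RB := RA
      pA := pB
      pB := pA
      rounds := [⟨.alice, m⟩, ⟨.bob, n⟩]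
      comm := .alice (.bob .start n fun a _ => xA a) m
        fun b (v : PUnit × (Fin n → Yb)) => cb (g b v.2)
      keyCard := N
      keyA := fun v : (PUnit × (Fin n → Yb)) × (Fin m → Xf) => sB v.1.2 v.2
      keyB := fun v : (PUnit × (Fin n → Xb)) × (Fin m → Yf) => sA v.1.2 v.2
      owner := .bob }
  refine ⟨P, ?_⟩
  have hout : P.outcome Wf Wb = twoRoundOutcome Wb Wf p κ cb sA sB := by
    rw [twoRoundOutcome_eq Wb Wf cb sA sB hA hB, PMF.bind_comm]
    unfold Protocol.outcome
    simp only [P, Communication.law, PMF.map_bind, PMF.bind_bind, PMF.bind_map, PMF.map_comp]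
    refine congrArg _ (funext fun a => congrArg _ (funext fun b => ?_))
    exact PMF.bind_map _ _ _
  have hN : ((forwardUses P.rounds : ℝ) + (backwardUses P.rounds : ℝ)) = n + m := by
    simp [P, forwardUses, backwardUses, add_comm]
  have h' : SecureLaw (P.outcome Wf Wb)
      ((forwardUses P.rounds : ℝ) + (backwardUses P.rounds : ℝ)) R δ := by
    rw [hN]; exact hout ▸ h
  exact h'

end Protocols

lemma secDist_comp_equiv {T E E' : Type*} [Fintype T] [Fintype E] [Fintype E'] {N : ℕ}
    (S : T → Fin N) (e : T → E) (f : E ≃ E') (w : T → ℝ) :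
    secDist S (fun t => f (e t)) w = secDist S e w := by
  unfold secDist
  refine Finset.sum_congr rfl fun s _ => ?_
  rw [← f.sum_comp]
  simp only [EmbeddingLike.apply_eq_iff_eq]

lemma block_toReal {X Y Z : Type u} [Fintype Y] [Fintype Z] (W : DMBC X Y Z) {n : ℕ}
    (x : Fin n → X) (o : Fin n → Y × Z) :
    (W.block x o).toReal = ∏ i, (W (x i) (o i)).toReal := by
  simp [DMBC.block, ENNReal.toReal_prod]

lemma exists_pmf {α : Type*} [Fintype α] {f : α → ℝ} (hf : ∀ a, 0 ≤ f a) (h1 : ∑ a, f a = 1) :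
    ∃ p : PMF α, ∀ a, (p a).toReal = f a := by
  refine ⟨PMF.ofFintype (fun a => ENNReal.ofReal (f a)) ?_, fun a => ?_⟩
  · rw [← ENNReal.ofReal_sum_of_nonneg fun a _ => hf a, h1, ENNReal.ofReal_one]
  · simp [ENNReal.toReal_ofReal (hf a)]

/-- A pair of channels as real kernels. -/
def realKernel {α β : Type*} (f : α → PMF β) (a : α) (b : β) : ℝ := (f a b).toReal

lemma realKernel_nonneg {α β : Type*} (f : α → PMF β) (a : α) (b : β) : 0 ≤ realKernel f a b :=
  ENNReal.toReal_nonneg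

lemma sum_realKernel {α β : Type*} [Fintype β] (f : α → PMF β) (a : α) :
    ∑ b, realKernel f a b = 1 := sum_toReal _

/-- Codes with small error and leakage give secure two-round laws at every rate below the bound. -/
theorem exists_secure_two_round {X₁ Y₁ Z₁ X₂ Y₂ Z₂ : Type u} [Fintype X₁] [Fintype Y₁]
    [Fintype Z₁] [Fintype X₂] [Fintype Y₂] [Fintype Z₂] {V : Type} [Fintype V] [Nonempty V]
    (W₁ : DMBC X₁ Y₁ Z₁) (W₂ : DMBC X₂ Y₂ Z₂) (p₁ : PMF X₁) (τ : Y₁ → PMF V) (p₂ : PMF X₂)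
    {pX : X₁ → ℝ} {q : X₂ → ℝ} (hpX : pX = fun x => (p₁ x).toReal)
    (hq : q = fun x => (p₂ x).toReal) {mY mX mZ iB iC : ℝ}
    (hmY : mY = meanLog (jointW pX (realKernel W₁) (realKernel τ))
      fun t => realKernel τ t.2.1.1 t.2.2)
    (hmX : mX = meanLog (jointW pX (realKernel W₁) (realKernel τ))
      fun t => condVX (realKernel W₁) (realKernel τ) t.2.2 t.1)
    (hmZ : mZ = meanLog (jointW pX (realKernel W₁) (realKernel τ))
      fun t => condVZ pX (realKernel W₁) (realKernel τ) t.2.2 t.2.1.2)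
    (hiB : iB = meanLog (fun t : X₂ × (Y₂ × Z₂) => q t.1 * realKernel W₂ t.1 t.2)
      fun t => outR q (realKernel W₂) Prod.fst t.1 t.2.1)
    (hiC : iC = meanLog (fun t : X₂ × (Y₂ × Z₂) => q t.1 * realKernel W₂ t.1 t.2)
      fun t => outR q (realKernel W₂) Prod.snd t.1 t.2.2)
    (hXY : mX ≤ mY) (nf nb : ℕ) (hcon : nf * (mY - mX) < nb * iB)
    {R : ℝ} (hR : 0 < R) (hRs : R * (nf + nb) < nf * (mX - mZ) + nb * max (iB - iC) 0)
    (hn : 0 < nf + nb) {δ : ℝ} (hδ : 0 < δ) :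
    ∃ (n m N : ℕ) (K : Type) (_ : Fintype K) (p : PMF (Fin n → X₁))
      (κ : (Fin n → Y₁) → PMF K) (cb : K → Fin m → X₂)
      (sA : (Fin n → X₁) → (Fin m → Y₂) → Fin N) (sB : (Fin n → Y₁) → (Fin m → X₂) → Fin N),
      SecureLaw (twoRoundOutcome W₁ W₂ p κ cb sA sB) (n + m) R δ := by
  have hp0 : ∀ x, 0 ≤ pX x := fun x => by rw [hpX]; exact ENNReal.toReal_nonneg
  have hp1 : ∑ x, pX x = 1 := by rw [hpX]; exact sum_toReal _
  have hq0 : ∀ x, 0 ≤ q x := fun x => by rw [hq]; exact ENNReal.toReal_nonneg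
  have hq1 : ∑ x, q x = 1 := by rw [hq]; exact sum_toReal _
  have hnR : (0 : ℝ) < nf + nb := by exact_mod_cast hn
  set δ' := min δ (1 / 2) with hδ'
  have hδ'0 : 0 < δ' := lt_min hδ (by norm_num)
  set η := δ' / (2 * (R + 5)) with hη
  have hη0 : 0 < η := by positivity
  have hηδ : η * (R + 5) < δ' := by
    have : η * (R + 5) = δ' / 2 := by rw [hη]; field_simp
    linarith
  have hev := exists_block_code hp0 hp1 (realKernel_nonneg W₁) (sum_realKernel W₁)
    (realKernel_nonneg τ) (sum_realKernel τ) hq0 hq1 (realKernel_nonneg W₂) (sum_realKernel W₂)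
    hmY hmX hmZ hiB hiC hXY nf nb hcon hRs hη0
  have hlarge : ∀ᶠ k : ℕ in atTop, 1 ≤ (k : ℝ) * (R * (nf + nb)) :=
    (tendsto_natCast_atTop_atTop.atTop_mul_const (by positivity)).eventually_ge_atTop 1
  obtain ⟨k, ⟨NU, NS, κ', cb, sA, sB, hU, hS, hNS, hκ0, hκ1, herr, hsec⟩, hk, hk0⟩ :=
    (hev.and (hlarge.and (eventually_gt_atTop 0))).exists
  have hkey : ∀ y : Fin (nf * k) → Y₁, ∃ r : PMF ((Fin (nf * k) → V) × Fin NU),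
      ∀ t, (r t).toReal = κ' y t.1 * (1 / Fintype.card (Fin NU)) := by
    intro y
    refine exists_pmf (fun t => mul_nonneg (hκ0 _ _) (by positivity)) ?_
    rw [Fintype.sum_prod_type]
    have : (NU : ℝ) ≠ 0 := by exact_mod_cast hU.ne'
    have h1 : ∑ _u : Fin NU, 1 / (Fintype.card (Fin NU) : ℝ) = 1 := by
      simp [this]
    simp only [← Finset.mul_sum, h1, mul_one, hκ1]
  choose κP hκP using hkey
  have hw : ∀ t, (twoRoundLaw W₁ W₂ (piPMF fun _ => p₁) κP cb t).toReal
      = codeWeight (blockW pX (realKernel W₁)) (fun t i => (t.2 i).1) κ'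
          (fun a (o : Fin (nb * k) → Y₂ × Z₂) => ∏ i, realKernel W₂ (a i) (o i)) cb t := by
    intro t
    unfold twoRoundLaw
    rw [joinPMF_toReal, joinPMF_toReal, joinPMF_toReal, hκP, block_toReal, block_toReal]
    simp only [codeWeight, blockW, realKernel, piPMF, PMF.ofFintype_apply, ENNReal.toReal_prod,
      hpX]
    ring
  refine ⟨nf * k, nb * k, NS, (Fin (nf * k) → V) × Fin NU, inferInstance, piPMF fun _ => p₁, κP,
    cb, sA, sB, ?_⟩
  have hlog : (k : ℝ) * (R * (nf + nb)) ≤ Real.logb 2 NS := by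
    rw [Real.le_logb_iff_rpow_le (by norm_num) (by exact_mod_cast hS)]
    exact hNS
  have hkR : (1 : ℝ) ≤ k := by exact_mod_cast hk0
  have hsecure := secureLaw_map (n := ((nf * k : ℕ) : ℝ) + ((nb * k : ℕ) : ℝ)) (R := R)
    (δ := δ') (η := η) hS (twoRoundLaw W₁ W₂ (piPMF fun _ => p₁) κP cb)
    (fun t => sA t.1.1 fun i => (t.2.2 i).1)
    (fun t => sB (fun i => (t.1.2 i).1) (cb t.2.1))
    (fun t => ((PUnit.unit.{u+1}, fun i => (t.1.2 i).2), fun i => (t.2.2 i).2))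
    hR.le hη0.le ?_ ?_ (hk.trans hlog) (min_le_right _ _) hηδ ?_ ?_
  · obtain ⟨h1, h2, h3⟩ := hsecure
    have hle : δ' ≤ δ := min_le_left _ _
    exact ⟨lt_of_le_of_lt (by linarith) h1, h2.trans_le hle, lt_of_le_of_lt (by linarith) h3⟩
  · have h1 : 1 ≤ (nf + nb) * k := Nat.mul_pos hn hk0
    have h2 : (1 : ℝ) ≤ ((nf + nb) * k : ℕ) := by exact_mod_cast h1
    push_cast at h2 ⊢
    linarith
  · refine le_trans (le_of_eq ?_) hlog
    push_cast; ring
  · simp only [hw]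
    exact herr
  · simp only [hw]
    refine le_trans (le_of_eq ?_) hsec
    exact secDist_comp_equiv _ (fun t : ((Fin (nf * k) → X₁) × (Fin (nf * k) → Y₁ × Z₁)) ×
          ((Fin (nf * k) → V) × Fin NU) × (Fin (nb * k) → Y₂ × Z₂) =>
        ((fun i => (t.1.2 i).2 : Fin (nf * k) → Z₁), (fun i => (t.2.2 i).2 : Fin (nb * k) → Z₂)))
      ((Equiv.punitProd _).symm.prodCongr (Equiv.refl _)) _

/-! ### Information measures as means of logarithms -/

lemma condH_eq_sum {Ω α β : Type*} [Fintype Ω] [Fintype α] [Fintype β] (p : PMF Ω) (A : Ω → α)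
    (B : Ω → β) : condH p A B = ∑ ω, (p ω).toReal * -Real.logb 2
      (((p.map fun ω => (A ω, B ω)) (A ω, B ω)).toReal / ((p.map B) (B ω)).toReal) := by
  unfold condH
  rw [tsum_fintype, ← Fintype.sum_prod_type' fun (b : β) (a : α) =>
    -((p.map fun ω => (A ω, B ω)) (a, b)).toReal *
    Real.logb 2 (((p.map fun ω => (A ω, B ω)) (a, b)).toReal / ((p.map B) b).toReal)]
  have h : ∀ t : β × α, -((p.map fun ω => (A ω, B ω)) (t.2, t.1)).toReal *
      Real.logb 2 (((p.map fun ω => (A ω, B ω)) (t.2, t.1)).toReal / ((p.map B) t.1).toReal)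
      = ∑ ω, ind ((B ω, A ω) = t) * ((p ω).toReal * -Real.logb 2
        (((p.map fun ω => (A ω, B ω)) (t.2, t.1)).toReal / ((p.map B) t.1).toReal)) := by
    rintro ⟨b, a⟩
    have e : ((p.map fun ω => (A ω, B ω)) (a, b)).toReal
        = ∑ ω, ind ((B ω, A ω) = (b, a)) * (p ω).toReal := by
      rw [toReal_map]
      refine Finset.sum_congr rfl fun ω _ => ?_
      congr 2
      simp only [Prod.mk.injEq]
      rw [and_comm]
    rw [neg_mul, ← mul_neg]
    conv_lhs => rw [e]
    rw [Finset.sum_mul]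
    exact Finset.sum_congr rfl fun ω _ => by rw [e]; ring
  simp only [h]
  rw [Finset.sum_comm]
  exact Finset.sum_congr rfl fun ω _ => sum_ind_eq_mul (B ω, A ω) fun t => (p ω).toReal *
    -Real.logb 2 (((p.map fun ω => (A ω, B ω)) (t.2, t.1)).toReal / ((p.map B) t.1).toReal)

lemma H_eq_sum {Ω α : Type*} [Fintype Ω] [Fintype α] (p : PMF Ω) (A : Ω → α) :
    H p A = ∑ ω, (p ω).toReal * -Real.logb 2 ((p.map A) (A ω)).toReal := by
  unfold H entropy
  have h : ∀ a, -(((p.map A) a).toReal * Real.logb 2 ((p.map A) a).toReal)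
      = ∑ ω, ind (A ω = a) * ((p ω).toReal * -Real.logb 2 ((p.map A) a).toReal) := by
    intro a
    rw [← mul_neg]
    conv_lhs => rw [toReal_map]
    rw [Finset.sum_mul]
    exact Finset.sum_congr rfl fun ω _ => by rw [toReal_map]; ring
  simp only [h]
  rw [Finset.sum_comm]
  exact Finset.sum_congr rfl fun ω _ => sum_ind_eq_mul (A ω) fun a => (p ω).toReal *
    -Real.logb 2 ((p.map A) a).toReal

/-! ### Single-letter information measures of channels with finite auxiliary variables -/

lemma sum_mul_ind_eq {α : Type*} [Fintype α] (a : α) (f : α → ℝ) :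
    ∑ s, f s * ind (s = a) = f a := by
  rw [← sum_ind_eq_mul a f]
  exact Finset.sum_congr rfl fun s _ => by rw [mul_comm, eq_comm (a := a)]

lemma ind_prod_eq {α β : Type*} (a a' : α) (b b' : β) :
    ind ((a, b) = (a', b')) = ind (a = a') * ind (b = b') := by
  rw [← ind_and, Prod.mk.injEq]

section

variable {X Y Z : Type u}

lemma ioLaw_apply (W : DMBC X Y Z) (p : PMF X) (t : X × Y × Z) :
    ioLaw W p t = p t.1 * W t.1 t.2 := by
  classical
  obtain ⟨x, y, z⟩ := t
  unfold ioLaw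
  rw [PMF.bind_apply, tsum_eq_single x]
  · congr 1
    rw [PMF.map_apply, tsum_eq_single (y, z)]
    · simp
    · rintro ⟨y', z'⟩ h
      rw [if_neg]
      rintro h'
      simp only [Prod.mk.injEq, true_and] at h'
      exact h (by rw [h'.1, h'.2])
  · intro x' hx
    rw [PMF.map_apply, ENNReal.tsum_eq_zero.2, mul_zero]
    rintro ⟨y', z'⟩
    rw [if_neg]
    simp [hx.symm]

lemma auxLaw_apply {V : Type} (W : DMBC X Y Z) (p : PMF X) (τ : Y → PMF V) (t : V × X × Y × Z) :
    auxLaw W p τ t = p t.2.1 * W t.2.1 t.2.2 * τ t.2.2.1 t.1 := by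
  classical
  obtain ⟨v, x, y, z⟩ := t
  unfold auxLaw
  rw [PMF.bind_apply, tsum_eq_single (x, y, z)]
  · rw [ioLaw_apply]
    congr 1
    rw [PMF.map_apply, tsum_eq_single v]
    · simp
    · intro v' h
      rw [if_neg]
      simp [h.symm]
  · rintro ⟨x', y', z'⟩ h
    rw [PMF.map_apply, ENNReal.tsum_eq_zero.2, mul_zero]
    intro v'
    rw [if_neg]
    intro h'
    simp only [Prod.mk.injEq] at h'
    exact h (by rw [h'.2.1, h'.2.2.1, h'.2.2.2])

variable [Fintype X] [Fintype Y] [Fintype Z] {V : Type} [Fintype V]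

lemma sum_auxLaw (W : DMBC X Y Z) (p : PMF X) (τ : Y → PMF V) (F : V × X × Y × Z → ℝ) :
    ∑ ω, (auxLaw W p τ ω).toReal * F ω
      = ∑ t, jointW (fun x => (p x).toReal) (realKernel W) (realKernel τ) t *
          F (t.2.2, t.1, t.2.1) := by
  rw [Fintype.sum_prod_type, Finset.sum_comm, Fintype.sum_prod_type, Fintype.sum_prod_type]
  refine Finset.sum_congr rfl fun x _ => ?_
  rw [Fintype.sum_prod_type (α₁ := Y × Z) (α₂ := V)]
  refine Finset.sum_congr rfl fun o _ => Finset.sum_congr rfl fun v _ => ?_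
  rw [auxLaw_apply]
  simp [jointW, realKernel]

lemma auxLaw_map_toReal {S : Type*} (W : DMBC X Y Z) (p : PMF X) (τ : Y → PMF V)
    (f : V × X × Y × Z → S) (s : S) :
    (((auxLaw W p τ).map f) s).toReal
      = ∑ x, (p x).toReal * ∑ o, realKernel W x o *
          ∑ v, realKernel τ o.1 v * ind (f (v, x, o) = s) := by
  rw [toReal_map]
  simp only [mul_comm (ind _)]
  rw [sum_auxLaw W p τ fun ω => ind (f ω = s), Fintype.sum_prod_type]
  refine Finset.sum_congr rfl fun x _ => ?_
  rw [Fintype.sum_prod_type, Finset.mul_sum]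
  refine Finset.sum_congr rfl fun o _ => ?_
  rw [Finset.mul_sum, Finset.mul_sum]
  refine Finset.sum_congr rfl fun v _ => ?_
  simp only [jointW]
  ring

lemma condH_auxLaw {α β : Type*} [Fintype α] [Fintype β] (W : DMBC X Y Z) (p : PMF X)
    (τ : Y → PMF V) (A : V × X × Y × Z → α) (B : V × X × Y × Z → β) :
    condH (auxLaw W p τ) A B
      = ∑ t, jointW (fun x => (p x).toReal) (realKernel W) (realKernel τ) t *
          -Real.logb 2
            ((((auxLaw W p τ).map fun ω => (A ω, B ω))
                (A (t.2.2, t.1, t.2.1), B (t.2.2, t.1, t.2.1))).toReal /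
              (((auxLaw W p τ).map B) (B (t.2.2, t.1, t.2.1))).toReal) := by
  rw [condH_eq_sum]
  exact sum_auxLaw W p τ _

variable (W : DMBC X Y Z) (p : PMF X) (τ : Y → PMF V)

lemma sum_realKernel_mul_fst (x : X) (f : Y → ℝ) :
    ∑ o, realKernel W x o * f o.1 = ∑ y, outW (realKernel W) Prod.fst x y * f y := by
  simp only [outW, Finset.sum_mul]
  rw [Finset.sum_comm]
  refine Finset.sum_congr rfl fun o _ => ?_
  rw [← sum_ind_eq_mul o.1 f, Finset.mul_sum]
  exact Finset.sum_congr rfl fun y _ => by ring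

lemma realKernel_eq_mul (hW : W.HasIndependentChannels) (x : X) (o : Y × Z) :
    realKernel W x o
      = outW (realKernel W) Prod.fst x o.1 * outW (realKernel W) Prod.snd x o.2 := by
  have h := congrArg ENNReal.toReal (hW x o.1 o.2)
  rw [ENNReal.toReal_mul, DMBC.toY, DMBC.toZ, toReal_map, toReal_map] at h
  simp only [mul_comm (ind _)] at h
  exact h

lemma sum_indep (hW : W.HasIndependentChannels) (x : X) (v : V) (z : Z) :
    ∑ o, realKernel W x o * (realKernel τ o.1 v * ind (o.2 = z))
      = outW (realKernel W) Prod.snd x z * condVX (realKernel W) (realKernel τ) v x := by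
  rw [condVX, sum_realKernel_mul_fst W x fun y => realKernel τ y v, Fintype.sum_prod_type,
    Finset.mul_sum]
  refine Finset.sum_congr rfl fun y _ => ?_
  simp only [realKernel_eq_mul W hW x (y, _)]
  have e : ∀ z', outW (realKernel W) Prod.fst x y * outW (realKernel W) Prod.snd x z' *
      (realKernel τ y v * ind (z' = z)) = (outW (realKernel W) Prod.fst x y *
        realKernel τ y v * outW (realKernel W) Prod.snd x z') * ind (z' = z) := fun z' => by ring
  simp only [e]
  rw [sum_mul_ind_eq z fun z' => outW (realKernel W) Prod.fst x y *
        realKernel τ y v * outW (realKernel W) Prod.snd x z']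
  ring

lemma infoVYgivenX_eq : infoVYgivenX W p τ
    = meanLog (jointW (fun x => (p x).toReal) (realKernel W) (realKernel τ))
        (fun t => realKernel τ t.2.1.1 t.2.2)
      - meanLog (jointW (fun x => (p x).toReal) (realKernel W) (realKernel τ))
        (fun t => condVX (realKernel W) (realKernel τ) t.2.2 t.1) := by
  unfold infoVYgivenX condMutualInfo meanLog
  rw [condH_auxLaw, condH_auxLaw, ← Finset.sum_sub_distrib, ← Finset.sum_sub_distrib]
  have hp : ∀ x, 0 ≤ (p x).toReal := fun x => ENNReal.toReal_nonneg
  refine Finset.sum_congr rfl fun t _ => ?_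
  rcases (jointW_nonneg hp (realKernel_nonneg W) (realKernel_nonneg τ) t).eq_or_lt with h | h
  · rw [← h]; ring
  obtain ⟨h1, h2, h3⟩ := pos_of_jointW_pos hp (realKernel_nonneg W) (realKernel_nonneg τ) h
  have h4 := condVX_pos hp (realKernel_nonneg W) (realKernel_nonneg τ) h
  have h5 := outW_pos (realKernel_nonneg W) Prod.fst h2
  obtain ⟨x, ⟨y, z⟩, v⟩ := t
  simp only at h1 h2 h3 h4 h5 ⊢
  have e1 : (((auxLaw W p τ).map fun ω => (ω.2.2.1, ω.2.1)) (y, x)).toReal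
      = (p x).toReal * outW (realKernel W) Prod.fst x y := by
    rw [auxLaw_map_toReal]
    refine (Finset.sum_congr rfl fun x' _ => ?_).trans
      (sum_mul_ind_eq x fun x' => (p x').toReal * outW (realKernel W) Prod.fst x' y)
    simp only [ind_prod_eq, ← Finset.sum_mul, sum_realKernel, one_mul, outW]
    rw [mul_assoc, Finset.sum_mul]
    simp only [mul_assoc]
  have e2 : (((auxLaw W p τ).map fun ω => ω.2.1) x).toReal = (p x).toReal := by
    rw [auxLaw_map_toReal]
    simp only [← Finset.sum_mul, sum_realKernel, one_mul]
    exact sum_mul_ind_eq x _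
  have e3 : (((auxLaw W p τ).map fun ω => (ω.2.2.1, (ω.1, ω.2.1))) (y, (v, x))).toReal
      = (p x).toReal * (outW (realKernel W) Prod.fst x y * realKernel τ y v) := by
    rw [auxLaw_map_toReal]
    refine (Finset.sum_congr rfl fun x' _ => ?_).trans (sum_mul_ind_eq x fun x' =>
      (p x').toReal * (outW (realKernel W) Prod.fst x' y * realKernel τ y v))
    have ev : ∀ o : Y × Z, ∑ v', realKernel τ o.1 v' * ind ((o.1, v', x') = (y, v, x))
        = realKernel τ o.1 v * ind (o.1 = y) * ind (x' = x) := fun o => by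
      rw [← sum_mul_ind_eq v fun v' => realKernel τ o.1 v' * ind (o.1 = y) * ind (x' = x)]
      exact Finset.sum_congr rfl fun v' _ => by rw [ind_prod_eq, ind_prod_eq]; ring
    simp only [ev]
    rw [sum_realKernel_mul_fst W x' fun y' => realKernel τ y' v * ind (y' = y) * ind (x' = x),
      mul_assoc, ← sum_mul_ind_eq y fun y' => outW (realKernel W) Prod.fst x' y' *
        realKernel τ y' v, Finset.sum_mul]
    congr 1
    exact Finset.sum_congr rfl fun y' _ => by ring
  have e4 : (((auxLaw W p τ).map fun ω => (ω.1, ω.2.1)) (v, x)).toReal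
      = (p x).toReal * condVX (realKernel W) (realKernel τ) v x := by
    rw [auxLaw_map_toReal]
    refine (Finset.sum_congr rfl fun x' _ => ?_).trans (sum_mul_ind_eq x fun x' =>
      (p x').toReal * condVX (realKernel W) (realKernel τ) v x')
    have ev : ∀ o : Y × Z, ∑ v', realKernel τ o.1 v' * ind ((v', x') = (v, x))
        = realKernel τ o.1 v * ind (x' = x) := fun o => by
      rw [← sum_mul_ind_eq v fun v' => realKernel τ o.1 v' * ind (x' = x)]
      exact Finset.sum_congr rfl fun v' _ => by rw [ind_prod_eq]; ring
    simp only [ev, condVX]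
    rw [mul_assoc, Finset.sum_mul]
    simp only [mul_assoc]
  rw [e1, e2, e3, e4, mul_div_cancel_left₀ _ h1.ne', mul_div_mul_left _ _ h1.ne',
    Real.logb_div (mul_pos h5 h3).ne' h4.ne', Real.logb_mul h5.ne' h3.ne']
  ring

lemma infoVXgivenZ_eq (hW : W.HasIndependentChannels) : infoVXgivenZ W p τ
    = meanLog (jointW (fun x => (p x).toReal) (realKernel W) (realKernel τ))
        (fun t => condVX (realKernel W) (realKernel τ) t.2.2 t.1)
      - meanLog (jointW (fun x => (p x).toReal) (realKernel W) (realKernel τ))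
        (fun t => condVZ (fun x => (p x).toReal) (realKernel W) (realKernel τ) t.2.2 t.2.1.2) := by
  unfold infoVXgivenZ condMutualInfo meanLog
  rw [condH_auxLaw, condH_auxLaw, ← Finset.sum_sub_distrib, ← Finset.sum_sub_distrib]
  have hp : ∀ x, 0 ≤ (p x).toReal := fun x => ENNReal.toReal_nonneg
  refine Finset.sum_congr rfl fun t _ => ?_
  rcases (jointW_nonneg hp (realKernel_nonneg W) (realKernel_nonneg τ) t).eq_or_lt with h | h
  · rw [← h]; ring
  obtain ⟨h1, h2, h3⟩ := pos_of_jointW_pos hp (realKernel_nonneg W) (realKernel_nonneg τ) h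
  have h4 := condVX_pos hp (realKernel_nonneg W) (realKernel_nonneg τ) h
  have h5 := outW_pos (realKernel_nonneg W) Prod.snd h2
  have h6 := margVZ_pos hp (realKernel_nonneg W) (realKernel_nonneg τ) h
  have h7 := margZ_pos hp (realKernel_nonneg W) (realKernel_nonneg τ) (sum_realKernel τ) h
  obtain ⟨x, ⟨y, z⟩, v⟩ := t
  simp only at h1 h2 h3 h4 h5 h6 h7 ⊢
  have e1 : (((auxLaw W p τ).map fun ω => (ω.2.1, ω.2.2.2)) (x, z)).toReal
      = (p x).toReal * outW (realKernel W) Prod.snd x z := by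
    rw [auxLaw_map_toReal]
    refine (Finset.sum_congr rfl fun x' _ => ?_).trans
      (sum_mul_ind_eq x fun x' => (p x').toReal * outW (realKernel W) Prod.snd x' z)
    simp only [ind_prod_eq, ← Finset.sum_mul, sum_realKernel, one_mul, outW]
    rw [mul_assoc, Finset.sum_mul]
    congr 1
    exact Finset.sum_congr rfl fun o _ => by ring
  have e2 : (((auxLaw W p τ).map fun ω => ω.2.2.2) z).toReal
      = margZ (fun x => (p x).toReal) (realKernel W) z := by
    rw [auxLaw_map_toReal]
    simp only [← Finset.sum_mul, sum_realKernel, one_mul, margZ, Finset.mul_sum, mul_assoc]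
  have e3 : (((auxLaw W p τ).map fun ω => (ω.2.1, (ω.1, ω.2.2.2))) (x, (v, z))).toReal
      = (p x).toReal * (outW (realKernel W) Prod.snd x z *
          condVX (realKernel W) (realKernel τ) v x) := by
    rw [auxLaw_map_toReal]
    refine (Finset.sum_congr rfl fun x' _ => ?_).trans (sum_mul_ind_eq x fun x' =>
      (p x').toReal * (outW (realKernel W) Prod.snd x' z *
        condVX (realKernel W) (realKernel τ) v x'))
    have ev : ∀ o : Y × Z, ∑ v', realKernel τ o.1 v' * ind ((x', v', o.2) = (x, v, z))
        = realKernel τ o.1 v * ind (o.2 = z) * ind (x' = x) := fun o => by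
      rw [← sum_mul_ind_eq v fun v' => realKernel τ o.1 v' * ind (o.2 = z) * ind (x' = x)]
      exact Finset.sum_congr rfl fun v' _ => by rw [ind_prod_eq, ind_prod_eq]; ring
    simp only [ev]
    rw [← sum_indep W τ hW, mul_assoc, Finset.sum_mul]
    simp only [mul_assoc]
  have e4 : (((auxLaw W p τ).map fun ω => (ω.1, ω.2.2.2)) (v, z)).toReal
      = margVZ (fun x => (p x).toReal) (realKernel W) (realKernel τ) v z := by
    rw [auxLaw_map_toReal]
    refine Finset.sum_congr rfl fun x' _ => ?_
    rw [Finset.mul_sum]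
    refine Finset.sum_congr rfl fun o _ => ?_
    have ev : ∑ v', realKernel τ o.1 v' * ind ((v', o.2) = (v, z))
        = realKernel τ o.1 v * ind (o.2 = z) := by
      rw [← sum_mul_ind_eq v fun v' => realKernel τ o.1 v' * ind (o.2 = z)]
      exact Finset.sum_congr rfl fun v' _ => by rw [ind_prod_eq]; ring
    rw [ev]
    ring
  rw [e1, e2, e3, e4, condVZ, Real.logb_div h6.ne' h7.ne', Real.logb_div (mul_pos h1 h5).ne' h7.ne',
    Real.logb_div (mul_pos h1 (mul_pos h5 h4)).ne' h6.ne', ← mul_assoc,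
    Real.logb_mul (mul_pos h1 h5).ne' h4.ne']
  ring

lemma mutualInfo_ioLaw {S : Type*} [Fintype S] (π : Y × Z → S) :
    mutualInfo (ioLaw W p) (fun ω => ω.1) (fun ω => π ω.2)
      = meanLog (fun t : X × (Y × Z) => (p t.1).toReal * realKernel W t.1 t.2)
        fun t => outR (fun x => (p x).toReal) (realKernel W) π t.1 (π t.2) := by
  unfold mutualInfo meanLog
  rw [H_eq_sum, condH_eq_sum, ← Finset.sum_sub_distrib]
  have hp : ∀ x, 0 ≤ (p x).toReal := fun x => ENNReal.toReal_nonneg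
  refine Finset.sum_congr rfl fun t _ => ?_
  have hw : ∀ t, (ioLaw W p t).toReal = (p t.1).toReal * realKernel W t.1 t.2 := fun t => by
    rw [ioLaw_apply, ENNReal.toReal_mul]; rfl
  rw [hw]
  rcases (mul_nonneg (hp t.1) (realKernel_nonneg W t.1 t.2)).eq_or_lt with h | h
  · simp only [← h, zero_mul, sub_zero]
  have h1 := pos_of_mul_pos_left h (realKernel_nonneg W t.1 t.2)
  have h2 := pos_of_mul_pos_right h (hp t.1)
  have h3 := outW_pos (realKernel_nonneg W) π h2
  have h4 := outQ_pos hp (realKernel_nonneg W) π h1 h3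
  have e1 : (((ioLaw W p).map fun ω => ω.1) t.1).toReal = (p t.1).toReal := by
    simp only [toReal_map, hw, Fintype.sum_prod_type (α₁ := X)]
    simp only [← Finset.mul_sum, sum_realKernel, mul_one]
    simp only [mul_comm (ind _)]
    exact sum_mul_ind_eq _ fun x => (p x).toReal
  have e2 : (((ioLaw W p).map fun ω => (ω.1, π ω.2)) (t.1, π t.2)).toReal
      = (p t.1).toReal * outW (realKernel W) π t.1 (π t.2) := by
    simp only [toReal_map, hw, Fintype.sum_prod_type (α₁ := X)]
    refine (Finset.sum_congr rfl fun x' _ => ?_).trans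
      (sum_mul_ind_eq t.1 fun x' => (p x').toReal * outW (realKernel W) π x' (π t.2))
    rw [mul_assoc, outW, Finset.sum_mul, Finset.mul_sum]
    exact Finset.sum_congr rfl fun o _ => by rw [ind_prod_eq]; ring
  have e3 : (((ioLaw W p).map fun ω => π ω.2) (π t.2)).toReal
      = outQ (fun x => (p x).toReal) (realKernel W) π (π t.2) := by
    simp only [toReal_map, hw, Fintype.sum_prod_type (α₁ := X), outQ, outW, Finset.mul_sum]
    exact Finset.sum_congr rfl fun x' _ => Finset.sum_congr rfl fun o _ => by ring
  simp only [e1, e2, e3, outR]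
  rw [Real.logb_div h3.ne' h4.ne', Real.logb_div (mul_pos h1 h3).ne' h4.ne',
    Real.logb_mul h1.ne' h3.ne']
  ring

lemma infoXY_eq : infoXY W p
      = meanLog (fun t : X × (Y × Z) => (p t.1).toReal * realKernel W t.1 t.2)
        fun t => outR (fun x => (p x).toReal) (realKernel W) Prod.fst t.1 t.2.1 :=
  mutualInfo_ioLaw W p Prod.fst

lemma infoXZ_eq : infoXZ W p
      = meanLog (fun t : X × (Y × Z) => (p t.1).toReal * realKernel W t.1 t.2)
        fun t => outR (fun x => (p x).toReal) (realKernel W) Prod.snd t.1 t.2.2 :=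
  mutualInfo_ioLaw W p Prod.snd

/-- Conditioning on the output makes the auxiliary variable more predictable. -/
lemma meanLog_condVX_le :
    meanLog (jointW (fun x => (p x).toReal) (realKernel W) (realKernel τ))
        (fun t => condVX (realKernel W) (realKernel τ) t.2.2 t.1)
      ≤ meanLog (jointW (fun x => (p x).toReal) (realKernel W) (realKernel τ))
        (fun t => realKernel τ t.2.1.1 t.2.2) := by
  have hp : ∀ x, 0 ≤ (p x).toReal := fun x => ENNReal.toReal_nonneg
  have hl : 0 < Real.log 2 := Real.log_pos (by norm_num)
  rw [← sub_nonpos, meanLog, meanLog, ← Finset.sum_sub_distrib]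
  have key : ∀ t : X × (Y × Z) × V,
      jointW (fun x => (p x).toReal) (realKernel W) (realKernel τ) t *
        Real.logb 2 (condVX (realKernel W) (realKernel τ) t.2.2 t.1)
      - jointW (fun x => (p x).toReal) (realKernel W) (realKernel τ) t *
        Real.logb 2 (realKernel τ t.2.1.1 t.2.2)
      ≤ ((p t.1).toReal * (realKernel W t.1 t.2.1 *
          condVX (realKernel W) (realKernel τ) t.2.2 t.1)
        - jointW (fun x => (p x).toReal) (realKernel W) (realKernel τ) t) / Real.log 2 := by
    intro t
    rcases (jointW_nonneg hp (realKernel_nonneg W) (realKernel_nonneg τ) t).eq_or_lt with h | h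
    · rw [← h, zero_mul, zero_mul, sub_zero, sub_zero]
      have := condVX_nonneg (realKernel_nonneg W) (realKernel_nonneg τ) t.2.2 t.1
      have := realKernel_nonneg W t.1 t.2.1
      have := hp t.1
      positivity
    obtain ⟨h1, h2, h3⟩ := pos_of_jointW_pos hp (realKernel_nonneg W) (realKernel_nonneg τ) h
    have h4 := condVX_pos hp (realKernel_nonneg W) (realKernel_nonneg τ) h
    have h5 := mul_le_mul_of_nonneg_left (logb_two_le (div_pos h4 h3)) h.le
    rw [Real.logb_div h4.ne' h3.ne', mul_sub] at h5
    refine h5.trans (le_of_eq ?_)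
    simp only [jointW]
    field_simp
  refine (Finset.sum_le_sum fun t _ => key t).trans (le_of_eq ?_)
  rw [← Finset.sum_div, Finset.sum_sub_distrib, sum_jointW (sum_toReal p) (sum_realKernel W)
    (sum_realKernel τ), Fintype.sum_prod_type]
  have : ∀ x, ∑ t : (Y × Z) × V, (p x).toReal * (realKernel W x t.1 *
      condVX (realKernel W) (realKernel τ) t.2 x) = (p x).toReal := fun x => by
    rw [Fintype.sum_prod_type]
    simp only [← Finset.mul_sum, sum_condVX (sum_realKernel W) (sum_realKernel τ), mul_one,
      sum_realKernel]
  simp only [this, sum_toReal, sub_self, zero_div]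

end

/-! ### Truncation of auxiliary variables to finite sets -/

lemma map_apply_congr {Ω α β : Type*} (p : PMF Ω) {f : Ω → α} {g : Ω → β} {a : α} {b : β}
    (h : ∀ ω, f ω = a ↔ g ω = b) : p.map f a = p.map g b := by
  classical
  rw [PMF.map_apply, PMF.map_apply]
  refine tsum_congr fun ω => ?_
  by_cases hω : f ω = a
  · rw [if_pos hω.symm, if_pos ((h ω).1 hω).symm]
  · rw [if_neg (Ne.symm hω), if_neg fun e => hω ((h ω).2 e.symm)]

lemma condH_map {Ω Ω' α β : Type*} [Fintype α] (p : PMF Ω) (g : Ω → Ω') (A : Ω' → α)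
    (B : Ω' → β) : condH (p.map g) A B = condH p (fun ω => A (g ω)) (fun ω => B (g ω)) := by
  unfold condH
  rw [PMF.map_comp, PMF.map_comp]
  rfl

lemma hasSum_toReal {Ω : Type*} (p : PMF Ω) : HasSum (fun ω => (p ω).toReal) 1 := by
  have h := (ENNReal.summable_toReal p.tsum_coe_ne_top).hasSum
  rwa [← ENNReal.tsum_toReal_eq fun ω => p.apply_ne_top ω, p.tsum_coe, ENNReal.toReal_one] at h

open Classical in
/-- Identify all values outside a finite set. -/
def trunc {V : Type*} (F : Finset V) (v : V) : Option F :=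
  if h : v ∈ F then some ⟨v, h⟩ else none

lemma trunc_eq_some {V : Type*} (F : Finset V) (v : V) (w : F) :
    trunc F v = some w ↔ v = w := by
  unfold trunc
  split_ifs with h
  · rw [Option.some.injEq, Subtype.ext_iff]
  · simp only [false_iff]
    rintro rfl
    exact h w.2

variable {Ω α γ : Type*} [Fintype α] [Fintype γ] {V : Type*}

lemma map_trunc_none (p : PMF Ω) (B : Ω → V) (F : Finset V) :
    ((p.map fun ω => trunc F (B ω)) none).toReal = 1 - ∑ v ∈ F, ((p.map B) v).toReal := by
  have h := sum_toReal (p.map fun ω => trunc F (B ω))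
  rw [Fintype.sum_option] at h
  have e : ∀ w : F, (p.map fun ω => trunc F (B ω)) (some w) = (p.map B) w := fun w =>
    map_apply_congr p fun ω => trunc_eq_some F (B ω) w
  simp only [e] at h
  rw [Finset.sum_coe_sort F fun v => ((p.map B) v).toReal] at h
  linarith

/-- Conditional entropies are approximated by truncations of the conditioning variable. -/
theorem tendsto_condH_trunc (p : PMF Ω) (A : Ω → α) (B : Ω → V) (C : Ω → γ) :
    Tendsto (fun F : Finset V => condH p A fun ω => (trunc F (B ω), C ω)) atTop
      (𝓝 (condH p A fun ω => (B ω, C ω))) := by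
  set r : V × γ → α → ℝ := fun b a => ((p.map fun ω => (A ω, (B ω, C ω))) (a, b)).toReal with hr
  have hr0 : ∀ b a, 0 ≤ r b a := fun _ _ => ENNReal.toReal_nonneg
  have hsum : Summable fun b => localEnt (r b) := by
    refine Summable.of_nonneg_of_le (fun b => localEnt_nonneg (hr0 b))
      (fun b => localEnt_le (hr0 b)) (Summable.mul_right _ ?_)
    simp only [hr, ← toReal_map_snd p A fun ω => (B ω, C ω)]
    exact (hasSum_toReal _).summable
  have hlim : Tendsto (fun F : Finset V => ∑ v ∈ F, ∑ c, localEnt (r (v, c))) atTop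
      (𝓝 (condH p A fun ω => (B ω, C ω))) := by
    rw [condH_eq_tsum]
    refine HasSum.prod_fiberwise (f := fun b => localEnt (r b)) hsum.hasSum fun v => ?_
    exact hasSum_fintype _
  set e : Finset V → ℝ := fun F => ∑ c, localEnt fun a =>
    ((p.map fun ω => (A ω, (trunc F (B ω), C ω))) (a, (none, c))).toReal with he
  have hsplit : ∀ F : Finset V, (condH p A fun ω => (trunc F (B ω), C ω))
      = e F + ∑ v ∈ F, ∑ c, localEnt (r (v, c)) := by
    intro F
    rw [condH_eq_tsum, tsum_fintype, Fintype.sum_prod_type, Fintype.sum_option, he]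
    congr 1
    rw [← Finset.sum_coe_sort F fun v => ∑ c, localEnt (r (v, c))]
    refine Finset.sum_congr rfl fun w _ => Finset.sum_congr rfl fun c _ => ?_
    congr 1
    funext a
    congr 1
    refine map_apply_congr p fun ω => ?_
    simp only [Prod.mk.injEq, trunc_eq_some]
  have he0 : Tendsto e atTop (𝓝 0) := by
    have h1 : Tendsto (fun F : Finset V => (1 - ∑ v ∈ F, ((p.map B) v).toReal) *
        Real.logb 2 (Fintype.card α)) atTop (𝓝 ((1 - 1) * Real.logb 2 (Fintype.card α))) :=
      (tendsto_const_nhds.sub (hasSum_toReal (p.map B))).mul_const _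
    rw [sub_self, zero_mul] at h1
    refine squeeze_zero (fun F => Finset.sum_nonneg fun c _ => localEnt_nonneg fun a =>
      ENNReal.toReal_nonneg) (fun F => ?_) h1
    refine (Finset.sum_le_sum fun c _ => localEnt_le fun a => ENNReal.toReal_nonneg).trans
      (le_of_eq ?_)
    rw [← Finset.sum_mul, ← map_trunc_none p B F,
      toReal_map_snd p (fun ω => (C ω, A ω)) fun ω => trunc F (B ω), Fintype.sum_prod_type]
    congr 1
    refine Finset.sum_congr rfl fun c _ => Finset.sum_congr rfl fun a _ => ?_
    congr 1
    refine map_apply_congr p fun ω => ?_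
    simp only [Prod.mk.injEq]
    tauto
  simp only [hsplit]
  simpa using he0.add hlim

section

variable {X Y Z : Type u} {V : Type}

lemma auxLaw_map_aux {V' : Type} (W : DMBC X Y Z) (p : PMF X) (τ : Y → PMF V) (f : V → V') :
    auxLaw W p (fun y => (τ y).map f) = (auxLaw W p τ).map fun ω => (f ω.1, ω.2) := by
  unfold auxLaw
  rw [PMF.map_bind]
  congr 1
  funext ⟨x, y, z⟩
  simp only
  rw [PMF.map_comp, PMF.map_comp]
  rfl

lemma tendsto_infoVXgivenZ [Fintype X] [Fintype Z] (W : DMBC X Y Z) (p : PMF X)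
    (τ : Y → PMF V) :
    Tendsto (fun F : Finset V => infoVXgivenZ W p fun y => (τ y).map (trunc F)) atTop
      (𝓝 (infoVXgivenZ W p τ)) := by
  unfold infoVXgivenZ condMutualInfo
  simp only [auxLaw_map_aux, condH_map]
  exact tendsto_const_nhds.sub (tendsto_condH_trunc _ _ _ _)

lemma tendsto_infoVYgivenX [Fintype X] [Fintype Y] (W : DMBC X Y Z) (p : PMF X)
    (τ : Y → PMF V) :
    Tendsto (fun F : Finset V => infoVYgivenX W p fun y => (τ y).map (trunc F)) atTop
      (𝓝 (infoVYgivenX W p τ)) := by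
  unfold infoVYgivenX condMutualInfo
  simp only [auxLaw_map_aux, condH_map]
  exact tendsto_const_nhds.sub (tendsto_condH_trunc _ _ _ _)

end

/-! ### Achievability of the lower bound -/

section

variable {X₁ Y₁ Z₁ X₂ Y₂ Z₂ : Type u} [Fintype X₁] [Fintype Y₁] [Fintype Z₁] [Fintype X₂]
  [Fintype Y₂] [Fintype Z₂]

/-- Every positive rate below the bound is attained by secure two-round laws. -/
theorem exists_secure_of_lt (W₁ : DMBC X₁ Y₁ Z₁) (W₂ : DMBC X₂ Y₂ Z₂)
    (hW : W₁.HasIndependentChannels) {n₁ n₂ : ℕ} {V : Type} (p₁ : PMF X₁) (τ : Y₁ → PMF V)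
    (p₂ : PMF X₂) (hn : 0 < n₁ + n₂)
    (hcon : (n₁ : ℝ) * infoVYgivenX W₁ p₁ τ < (n₂ : ℝ) * infoXY W₂ p₂) {R : ℝ} (hR : 0 < R)
    (hRs : R * (n₁ + n₂) < (n₁ : ℝ) * infoVXgivenZ W₁ p₁ τ
      + (n₂ : ℝ) * max (infoXY W₂ p₂ - infoXZ W₂ p₂) 0) {δ : ℝ} (hδ : 0 < δ) :
    ∃ (n m N : ℕ) (K : Type) (_ : Fintype K) (p : PMF (Fin n → X₁))
      (κ : (Fin n → Y₁) → PMF K) (cb : K → Fin m → X₂)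
      (sA : (Fin n → X₁) → (Fin m → Y₂) → Fin N) (sB : (Fin n → Y₁) → (Fin m → X₂) → Fin N),
      SecureLaw (twoRoundOutcome W₁ W₂ p κ cb sA sB) (n + m) R δ := by
  have h1 := ((tendsto_infoVYgivenX W₁ p₁ τ).const_mul (n₁ : ℝ)).eventually_lt_const hcon
  have h2 := (((tendsto_infoVXgivenZ W₁ p₁ τ).const_mul (n₁ : ℝ)).add_const
    ((n₂ : ℝ) * max (infoXY W₂ p₂ - infoXZ W₂ p₂) 0)).eventually_const_lt hRs
  obtain ⟨F, hF1, hF2⟩ := (h1.and h2).exists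
  rw [infoVYgivenX_eq, infoXY_eq] at hF1
  rw [infoVXgivenZ_eq _ _ _ hW, infoXY_eq, infoXZ_eq] at hF2
  exact exists_secure_two_round W₁ W₂ p₁ (fun y => (τ y).map (trunc F)) p₂ rfl rfl rfl rfl rfl
    rfl rfl (meanLog_condVX_le _ _ _) n₁ n₂ hF1 hR hF2 hn hδ

/-- The lower bound holds for every quantity that dominates the rates of secure two-round laws. -/
theorem lowerBound_le (W₁ : DMBC X₁ Y₁ Z₁) (W₂ : DMBC X₂ Y₂ Z₂)
    (hW : W₁.HasIndependentChannels) {C : ℝ≥0∞}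
    (hC : ∀ R : ℝ≥0, (∀ δ : ℝ, 0 < δ → ∃ (n m N : ℕ) (K : Type) (_ : Fintype K)
      (p : PMF (Fin n → X₁)) (κ : (Fin n → Y₁) → PMF K) (cb : K → Fin m → X₂)
      (sA : (Fin n → X₁) → (Fin m → Y₂) → Fin N) (sB : (Fin n → Y₁) → (Fin m → X₂) → Fin N),
      SecureLaw (twoRoundOutcome W₁ W₂ p κ cb sA sB) (n + m) R δ) → (R : ℝ≥0∞) ≤ C) :
    lowerBound W₁ W₂ ≤ C := by
  unfold lowerBound
  refine iSup_le fun n₁ => iSup_le fun n₂ => iSup_le fun V => iSup_le fun p₁ => iSup_le fun τ =>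
    iSup_le fun p₂ => iSup_le fun hcon => ENNReal.le_of_forall_nnreal_lt fun R hR => ?_
  rcases R.2.eq_or_lt with h0 | h0
  · rw [show R = 0 from NNReal.eq h0.symm, ENNReal.coe_zero]
    exact bot_le
  have hR' := (ENNReal.lt_ofReal_iff_toReal_lt ENNReal.coe_ne_top).1 hR
  rw [ENNReal.coe_toReal] at hR'
  have hRpos : (0 : ℝ) < R := by exact_mod_cast h0
  have hn0 : (n₁ : ℝ) + n₂ ≠ 0 := by
    intro h
    rw [h, div_zero] at hR'
    linarith
  have hn : (0 : ℝ) < n₁ + n₂ := lt_of_le_of_ne (by positivity) hn0.symm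
  rw [lt_div_iff₀ hn] at hR'
  exact hC R fun δ hδ => exists_secure_of_lt W₁ W₂ hW p₁ τ p₂ (by exact_mod_cast hn) hcon hRpos
    hR' hδ

end

end SKE

end

theorem proposition1 {Xf Yf Zf Xb Yb Zb : Type u} [Fintype Xf] [Fintype Yf] [Fintype Zf]
    [Fintype Xb] [Fintype Yb] [Fintype Zb]
    (Wf : SKE.DMBC Xf Yf Zf) (Wb : SKE.DMBC Xb Yb Zb) (hf : Wf.IsSD) (hb : Wb.IsSD) :
    max (SKE.LA Wf Wb) (SKE.LB Wf Wb) ≤ SKE.capacity Wf Wb := by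
  refine max_le (SKE.lowerBound_le Wf Wb hf.2 fun R h => ?_)
    (SKE.lowerBound_le Wb Wf hb.2 fun R h => ?_)
  · refine le_iSup₂_of_le R (fun δ hδ => ?_) le_rfl
    obtain ⟨n, m, N, K, _, p, κ, cb, sA, sB, hs⟩ := h δ hδ
    exact SKE.exists_protocol_alice Wf Wb p κ cb sA sB hs
  · refine le_iSup₂_of_le R (fun δ hδ => ?_) le_rfl
    obtain ⟨n, m, N, K, _, p, κ, cb, sA, sB, hs⟩ := h δ hδ
    exact SKE.exists_protocol_bob Wf Wb p κ cb sA sB hs
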